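/- **Setting.** Let $n\ge 1$; $|k|=\sum_i|k_i|$ for $k\in\mathbb Z^n$, $\|\cdot\|$ is the Euclidean norm of vectors and $\|\cdot\|_2$ the spectral norm of matrices; $\Lambda_R=\{k\in\mathbb Z^n:\max_i|k_i|\le R\}$. Let $H_1(z,\bar z)=\sum_{\alpha,\beta}h_{\alpha\beta}(z^\alpha\bar z^\beta+z^\beta\bar z^\alpha)$ be a polynomial with real coefficients, $X=\partial H_1/\partial\bar z$, let $\Omega\subseteq\mathbb R^n$ be a bounded domain and $\tau>n-1$. For $0<\varepsilon<1$ put $$M=\exp\{(\log\tfrac1\varepsilon)^{1/20}\},\quad M_0=\exp\{(\log M)^{1/20}\},\quad \varepsilon_x=\exp\{-(\log x)^{15}\},\quad N'=\exp\{(\log N)^{1/10}\}.$$ Let $\hat z=\{\hat z(k)\}_{k\in\mathbb Z^n}$, $\hat z(k)\in\mathbb R^n$, be a family of Fourier vectors depending on the frequency $\omega$, with $\hat z_j(e_j)=a_j:=e^{-1}$, and let $z(\theta)=\sum_k\hat z(k)e^{i\langle k,\theta\rangle}$. Write $\hat z\in\mathcal K(s)$ if, at the frequency $\omega$ considered, $\hat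 z$ is differentiable in $\omega$, $\|\hat z\|_{\ell_2}+\|\partial_\omega\hat z\|_{\ell_2}<\infty$ and $(\|\hat z(k)\|+\|\partial_\omega\hat z(k)\|_2)\,e^{|k|^s}\le1$ for all $k$. With hats denoting Fourier coefficients in $\theta$ along $(z(\theta),\overline{z(\theta)})$, the drifted frequency is $\omega'_j=\omega_j+\varepsilon\hat X_j(e_j)/a_j$, and $T+\varepsilon B=D+\varepsilon S+\varepsilon B$, where $D$ is diagonal with entries $-\langle k,\omega'\rangle+\omega_j$ and $$S((k,i),(k',j))=\frac{\partial\hat X_i(k)}{\partial\hat z_j(k')}=\widehat{\tfrac{\partial X_i}{\partial z_j}}(k-k')+\widehat{\tfrac{\partial X_i}{\partial\bar z_j}}(k+k'),\qquad B((k,i),(k',j))=-\frac1e\,\hat z_i(k)\sum_{l=1}^nk_l\,\frac{\partial\hat X_l(e_l)}{\partial\hat z_j(k')} .$$ For an integer $N$ and $k_0\notin\Lambda_{2N}$ (an *off-side* box of size $N$) let $(T+\varepsilon B)_{k_0,N}$ be the restriction of $T+\varepsilon B$ to the indices $k\in k_0+\Lambda_N$; entries such as $(T+\varepsilon B)_{k_0,N}^{-1}(k_1,k_2)$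 are $n\times n$ blocks, measured in the spectral norm $|\cdot|$. Consider * **(Inv)** $(T+\varepsilon B)_{k_0,N}$ is invertible and $\|(T+\varepsilon B)_{k_0,N}^{-1}\|_2\le1/\varepsilon_N$; * **(Loc$_\pm$)** $|(T+\varepsilon B)_{k_0,N}^{-1}(k_1,k_2)|\le e^{-|k_1-k_2|^s/2}+e^{-|k_1+k_2|^s/2}$ for all $k_1,k_2\in k_0+\Lambda_N$ with $|k_1-k_2|>N^{1/2}$ and $|k_1+k_2|>N^{1/2}$; * **(Loc)** $|(T+\varepsilon B)_{k_0,N}^{-1}(k_1,k_2)|\le e^{-|k_1-k_2|^s/2}$ for all $k_1,k_2\in k_0+\Lambda_N$ with $|k_1-k_2|>N^{1/2}$. The excluded sets are $$\Omega_M^\tau=\{\omega\in\Omega:\ |\langle k,\omega\rangle|<|k|^{-\tau}\text{ for some }k\in\Lambda_{2(M+1)}\setminus\{0\}\},$$ $$\Omega_2=\bigcup_{N>M}\{\omega\in\Omega:\ |-\langle k,\omega'\rangle+\omega_{j_1}-\omega_{j_2}|<4\varepsilon_{N'}\text{ for some }k\in\Lambda_{2N}\setminus\Lambda_{2N'}\text{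 and some }j_1,j_2\}.$$ **Theorem.** Let $0<s_0<1$ with $(n-1)^{s_0}<2$ (automatic for $n\le3$) and let $\kappa>1$. There is $\varepsilon_0\in(0,\tfrac12]$, depending only on $n,H_1,\Omega,\tau,s_0,\kappa$, such that the following holds for all $0<\varepsilon\le\varepsilon_0$ and all $0<s\le s_0$ with $M^s\ge\kappa$. Let $\hat z\in\mathcal K(s)$, let $\omega\in\Omega\setminus(\Omega_M^\tau\cup\Omega_2)$ and let $r\ge0$ be an integer. Suppose that for every integer $N$ with $M_0\le N\le M^r$, every off-side box of size $N$ that satisfies (Inv) satisfies (Loc$_\pm$). Then for every integer $N$ with $M^r<N\le M^{r+1}$, every off-side box of size $N$ that satisfies (Inv) satisfies (Loc). -/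

import Mathlib

open MeasureTheory

noncomputable section

namespace DimEnlargedNewton

/-! ### The lattice -/

/-- Fourier indices `k ∈ ℤⁿ`. -/
abbrev Lattice (n : ℕ) := Fin n → ℤ

/-- Frequencies, and values of Fourier coefficients, in `ℝⁿ` with its Euclidean norm. -/
abbrev Vec (n : ℕ) := EuclideanSpace ℝ (Fin n)

/-- The `ℓ¹` length `|k|`. -/
def len {n : ℕ} (k : Lattice n) : ℝ := ∑ i, |(k i : ℝ)|

/-- `k ∈ Λ_R`, that is `max_i |k_i| ≤ R`. -/
def InBox {n : ℕ} (R : ℝ) (k : Lattice n) : Prop := ∀ i, |(k i : ℝ)| ≤ R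

/-- `⟨k, x⟩ = ∑ k_i x_i`. -/
def pair {n : ℕ} (k : Lattice n) (x : Fin n → ℝ) : ℝ := ∑ i, (k i : ℝ) * x i

/-- The standard basis vector `e_j`. -/
def basisVec {n : ℕ} (j : Fin n) : Lattice n := Pi.single j 1

/-- The translated box `k₀ + Λ_N`. -/
def box {n : ℕ} (k₀ : Lattice n) (N : ℕ) : Finset (Lattice n) :=
  Finset.Icc (fun i => k₀ i - (N : ℤ)) (fun i => k₀ i + (N : ℤ))

/-- The box `k₀ + Λ_N` is off-side: its center lies outside `Λ_{2N}`. -/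
def OffSide {n : ℕ} (k₀ : Lattice n) (N : ℕ) : Prop := ¬ InBox (2 * (N : ℝ)) k₀

/-- An off-side box contains none of the resonant indices `e_j`, so that all the modes `(j, k)` with
`k` in the box are non-resonant. -/
theorem OffSide.ne_basisVec {n : ℕ} {k₀ k : Lattice n} {N : ℕ} (hN : 1 ≤ N)
    (h : OffSide k₀ N) (hk : k ∈ box k₀ N) (j : Fin n) : k ≠ basisVec j := by
  rintro rfl
  obtain ⟨h1, h2⟩ := Finset.mem_Icc.1 hk
  apply h
  intro i
  have a : k₀ i - (N : ℤ) ≤ basisVec j i := h1 i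
  have b : basisVec j i ≤ k₀ i + (N : ℤ) := h2 i
  have c : (0 : ℤ) ≤ basisVec j i ∧ basisVec j i ≤ 1 := by
    unfold basisVec
    by_cases hij : i = j
    · subst hij; simp
    · simp [hij]
  have d : |k₀ i| ≤ 2 * (N : ℤ) := by
    rw [abs_le]
    constructor <;> omega
  exact_mod_cast d

/-! ### The perturbation and its Fourier coefficients -/

/-- The real coefficients `h_{αβ}` (finitely many non-zero) of the perturbation. -/
abbrev Coeffs (n : ℕ) := ((Fin n →₀ ℕ) × (Fin n →₀ ℕ)) →₀ ℝ

/-- `z^α z̄^β` as a polynomial; `Sum.inl j` is the variable `z_j` and `Sum.inr j` is `z̄_j`. -/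
def mono {n : ℕ} (α β : Fin n →₀ ℕ) : MvPolynomial (Fin n ⊕ Fin n) ℂ :=
  (∏ j, MvPolynomial.X (Sum.inl j) ^ α j) * ∏ j, MvPolynomial.X (Sum.inr j) ^ β j

/-- `H₁(z, z̄) = ∑ h_{αβ} (z^α z̄^β + z^β z̄^α)`. -/
def perturbation {n : ℕ} (h : Coeffs n) : MvPolynomial (Fin n ⊕ Fin n) ℂ :=
  h.sum fun p c => MvPolynomial.C (c : ℂ) * (mono p.1 p.2 + mono p.2 p.1)

/-- The vector field `X_j = ∂H₁/∂z̄_j`. -/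
def field {n : ℕ} (h : Coeffs n) (j : Fin n) : MvPolynomial (Fin n ⊕ Fin n) ℂ :=
  MvPolynomial.pderiv (Sum.inr j) (perturbation h)

/-- `z_j(θ) = ∑_k ẑ_j(k) e^{i⟨k,θ⟩}`. -/
def torusFun {n : ℕ} (z : Lattice n → Vec n) (θ : Fin n → ℝ) (j : Fin n) : ℂ :=
  ∑' k : Lattice n, ((z k j : ℝ) : ℂ) * Complex.exp (Complex.I * (pair k θ : ℂ))

/-- The value at `(z(θ), z̄(θ))` of a polynomial in `z` and `z̄`. -/
def evalTorus {n : ℕ} (z : Lattice n → Vec n) (P : MvPolynomial (Fin n ⊕ Fin n) ℂ)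
    (θ : Fin n → ℝ) : ℂ :=
  MvPolynomial.eval
    (Sum.elim (torusFun z θ) (fun j => (starRingEnd ℂ) (torusFun z θ j))) P

/-- The Fourier coefficient `(2π)^{-n} ∫_{[0,2π]^n} f(θ) e^{-i⟨k,θ⟩} dθ`. -/
def fourierCoef {n : ℕ} (f : (Fin n → ℝ) → ℂ) (k : Lattice n) : ℂ :=
  (1 / (2 * (Real.pi : ℂ)) ^ n) *
    ∫ θ in Set.Icc (0 : Fin n → ℝ) (fun _ => 2 * Real.pi),
      f θ * Complex.exp (-(Complex.I * (pair k θ : ℂ)))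

/-- `X̂_j(k)`. -/
def fieldCoef {n : ℕ} (h : Coeffs n) (z : Lattice n → Vec n) (j : Fin n) (k : Lattice n) : ℂ :=
  fourierCoef (evalTorus z (field h j)) k

/-- The Toeplitz kernel: the Fourier coefficient at `m` of `∂X_i/∂z_j`. -/
def kernelT {n : ℕ} (h : Coeffs n) (z : Lattice n → Vec n) (m : Lattice n) (i j : Fin n) : ℂ :=
  fourierCoef (evalTorus z (MvPolynomial.pderiv (Sum.inl j) (field h i))) m

/-- The Hankel kernel: the Fourier coefficient at `m` of `∂X_i/∂z̄_j`. -/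
def kernelH {n : ℕ} (h : Coeffs n) (z : Lattice n → Vec n) (m : Lattice n) (i j : Fin n) : ℂ :=
  fourierCoef (evalTorus z (MvPolynomial.pderiv (Sum.inr j) (field h i))) m

/-- The entry `∂X̂_i(k)/∂ẑ_j(k')` of the tangent operator. As `ẑ` is real, the Fourier coefficient of
`z̄_j` at `m` is `ẑ_j(-m)`, whence the Hankel term. -/
def tangent {n : ℕ} (h : Coeffs n) (z : Lattice n → Vec n)
    (k : Lattice n) (i : Fin n) (k' : Lattice n) (j : Fin n) : ℂ :=
  kernelT h z (k - k') i j + kernelH h z (k + k') i j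

/-! ### The linearized operator -/

/-- The amplitudes `a_j = e^{-1}`. -/
def amplitude : ℝ := Real.exp (-1)

/-- The drifted frequency `ω'` solving `(-ω' + ω) ⊙ a + ε X̂_q = 0`, where `X̂_q = (X̂_j(e_j))_j`
(these coefficients are real because `ẑ` and `h` are). -/
def drift {n : ℕ} (h : Coeffs n) (ε : ℝ) (z : Lattice n → Vec n) (ω : Vec n) (j : Fin n) : ℝ :=
  ω j + ε * (fieldCoef h z j (basisVec j)).re / amplitude

/-- The entry of the rank-one type operator `B = -e⁻¹ (∂⟨k, X̂_q⟩/∂ẑ_p) ẑ_pᵀ`: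
`B((k,i),(k',j)) = -e⁻¹ ẑ_i(k) ∑_l k_l ∂X̂_l(e_l)/∂ẑ_j(k')`. -/
def opB {n : ℕ} (h : Coeffs n) (z : Lattice n → Vec n)
    (k : Lattice n) (i : Fin n) (k' : Lattice n) (j : Fin n) : ℂ :=
  -((Real.exp (-1) * z k i : ℝ) : ℂ) * ∑ l, (k l : ℂ) * tangent h z (basisVec l) l k' j

/-- The restriction `(T + εB)_{k₀,N}` of `T + εB = D + εS + εB` to the box `k₀ + Λ_N`, with
`D_{i,k} = -⟨k, ω'⟩ + ω_i`; rows and columns are indexed by pairs `(k, i)`. It is used for off-side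
boxes with `N ≥ 1` only, where every mode is non-resonant. -/
def opMatrix {n : ℕ} (h : Coeffs n) (ε : ℝ) (z : Lattice n → Vec n) (ω : Vec n)
    (k₀ : Lattice n) (N : ℕ) :
    Matrix (box k₀ N × Fin n) (box k₀ N × Fin n) ℂ :=
  Matrix.of fun p q =>
    (if p = q then ((-(pair p.1.1 (drift h ε z ω)) + ω p.2 : ℝ) : ℂ) else 0)
      + (ε : ℂ) * tangent h z p.1.1 p.2 q.1.1 q.2
      + (ε : ℂ) * opB h z p.1.1 p.2 q.1.1 q.2

/-- The spectral norm (largest singular value) of a square matrix. -/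
def specNorm {ι : Type*} [Fintype ι] [DecidableEq ι] (A : Matrix ι ι ℂ) : ℝ :=
  ‖Matrix.toEuclideanCLM (𝕜 := ℂ) A‖

/-- The `n × n` block `(T + εB)_{k₀,N}⁻¹(k, k')` of the inverse. -/
def greenBlock {n : ℕ} (h : Coeffs n) (ε : ℝ) (z : Lattice n → Vec n) (ω : Vec n)
    (k₀ : Lattice n) (N : ℕ) (k k' : box k₀ N) : Matrix (Fin n) (Fin n) ℂ :=
  Matrix.of fun i j => (opMatrix h ε z ω k₀ N)⁻¹ (k, i) (k', j)

/-! ### Scales -/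

/-- The threshold `ε_x = exp(-(log x)^15)`. -/
def thr (x : ℝ) : ℝ := Real.exp (-(Real.log x) ^ 15)

/-- `M = exp((log 1/ε)^{1/20})`. -/
def bigM (ε : ℝ) : ℝ := Real.exp (Real.log (1 / ε) ^ ((1 : ℝ) / 20))

/-- `M₀ = exp((log M)^{1/20})`. -/
def smallM (ε : ℝ) : ℝ := Real.exp (Real.log (bigM ε) ^ ((1 : ℝ) / 20))

/-- The reduced scale `N' = exp((log N)^{1/10})`. -/
def reduced (N : ℕ) : ℝ := Real.exp (Real.log (N : ℝ) ^ ((1 : ℝ) / 10))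

/-! ### Gevrey decay and the excluded frequencies -/

/-- `ẑ ∈ 𝒦(s)` at the frequency `ω`, where `ẑ` is a family of real Fourier vectors depending on the
frequency: the composite norm `‖·‖₂ + ‖∂_ω ·‖₂` of `ẑ` is finite and
`(‖ẑ(k)‖ + ‖∂_ω ẑ(k)‖) exp(|k|^s) ≤ 1` for all `k`. -/
structure GevreyDecay {n : ℕ} (s : ℝ) (zhat : Vec n → Lattice n → Vec n) (ω : Vec n) : Prop where
  differentiableAt : ∀ k, DifferentiableAt ℝ (fun w => zhat w k) ω
  summable_sq : Summable fun k => ‖zhat ω k‖ ^ 2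
  summable_deriv_sq : Summable fun k => ‖fderiv ℝ (fun w => zhat w k) ω‖ ^ 2
  decay : ∀ k, (‖zhat ω k‖ + ‖fderiv ℝ (fun w => zhat w k) ω‖) * Real.exp (len k ^ s) ≤ 1

/-- The nearly-resonant set: `|⟨k, ω⟩| < |k|^{-τ}` for some non-zero `k ∈ Λ_{2(M+1)}`. -/
def nearlyResonant {n : ℕ} (Ω : Set (Vec n)) (τ ε : ℝ) : Set (Vec n) :=
  {ω | ω ∈ Ω ∧ ∃ k : Lattice n, k ≠ 0 ∧ InBox (2 * (bigM ε + 1)) k ∧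
    |pair k ω| < 1 / len k ^ τ}

/-- The difference nearly-resonant set at scale `N`: `|-⟨k, ω'⟩ + ω_{j₁} - ω_{j₂}| < 4 ε_{N'}` for some
`k ∈ Λ_{2N} \ Λ_{2N'}` and some `j₁, j₂`. -/
def diffResonantAt {n : ℕ} (h : Coeffs n) (Ω : Set (Vec n)) (ε : ℝ)
    (zhat : Vec n → Lattice n → Vec n) (N : ℕ) : Set (Vec n) :=
  {ω | ω ∈ Ω ∧ ∃ k : Lattice n, InBox (2 * (N : ℝ)) k ∧ ¬ InBox (2 * reduced N) k ∧
    ∃ j₁ j₂ : Fin n,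
      |-(pair k (drift h ε (zhat ω) ω)) + ω j₁ - ω j₂| < 4 * thr (reduced N)}

/-- The total difference nearly-resonant set: the union over all `N > M`. -/
def diffResonant {n : ℕ} (h : Coeffs n) (Ω : Set (Vec n)) (ε : ℝ)
    (zhat : Vec n → Lattice n → Vec n) : Set (Vec n) :=
  {ω | ∃ N : ℕ, bigM ε < (N : ℝ) ∧ ω ∈ diffResonantAt h Ω ε zhat N}

/-! ### Inversion and localization -/

/-- Inversion condition: `(T + εB)_{k₀,N}` is invertible and `‖(T + εB)_{k₀,N}⁻¹‖₂ ≤ 1/ε_N`. -/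
def Inversion {n : ℕ} (h : Coeffs n) (ε : ℝ) (z : Lattice n → Vec n) (ω : Vec n)
    (k₀ : Lattice n) (N : ℕ) : Prop :=
  IsUnit (opMatrix h ε z ω k₀ N) ∧
    specNorm (opMatrix h ε z ω k₀ N)⁻¹ ≤ 1 / thr (N : ℝ)

/-- Two-sided localization condition, for `|k - k'| > N^{1/2}` and `|k + k'| > N^{1/2}`. -/
def LocalizationTwoSided {n : ℕ} (h : Coeffs n) (ε s : ℝ) (z : Lattice n → Vec n) (ω : Vec n)
    (k₀ : Lattice n) (N : ℕ) : Prop :=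
  ∀ k k' : box k₀ N, (N : ℝ) ^ ((1 : ℝ) / 2) < len (k.1 - k'.1) →
    (N : ℝ) ^ ((1 : ℝ) / 2) < len (k.1 + k'.1) →
    specNorm (greenBlock h ε z ω k₀ N k k') ≤
      Real.exp (-(len (k.1 - k'.1) ^ s) / 2) + Real.exp (-(len (k.1 + k'.1) ^ s) / 2)

/-- One-sided localization condition, for `|k - k'| > N^{1/2}`. -/
def Localization {n : ℕ} (h : Coeffs n) (ε s : ℝ) (z : Lattice n → Vec n) (ω : Vec n)
    (k₀ : Lattice n) (N : ℕ) : Prop :=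
  ∀ k k' : box k₀ N, (N : ℝ) ^ ((1 : ℝ) / 2) < len (k.1 - k'.1) →
    specNorm (greenBlock h ε z ω k₀ N k k') ≤ Real.exp (-(len (k.1 - k'.1) ^ s) / 2)

end DimEnlargedNewton

end

open DimEnlargedNewton

/-!
The operator on an off-side box is a diagonal matrix plus `ε` times a perturbation whose entries decay.
For every `γ < 1` the Toeplitz part decays like `exp(-γ|k - k'|^s)`, the Hankel part like
`exp(-γ|k + k'|^s)`, and `B` in both `k` and `k'`. In an off-side box
`|k - k'| ≤ max(1, n - 1) |k + k'|`, and `max(1, n - 1)^s < 2`; so some rate `1/2 + Δ` in `|k - k'|^s` with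
`Δ > 0` is left for the whole perturbation (`exists_entry_bound`). The constants are at most `exp(X²)`
for `X = log M`, since `1/s = O(X)` (`eventually_kernelConst_le`).

Inverses are estimated by a resolvent identity at good sites and by the trivial bound `1/ε_N` at bad
ones. If all bad sites lie in a few clusters of small diameter, the spheres about the source that meet
a cluster have small total width, and the decay is iterated across the remaining shells; the width of
the removed spheres is the only loss (`norm_inv_apply_le_of_shells`, `norm_inv_apply_le_of_clusters`).
To have room for the loss, the distance `d^s` is replaced by a subadditive gauge that equals `d^s` at
large distances and is much smaller at short ones (`gauge`). With `Y = log N` there are three ranges.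

* If `Y ≤ X^{5/4}`, then `ε = exp(-X^20)` is smaller than a power of `ε_N = exp(-Y^15)`, and a
  weighted maximum principle passes the decay to the inverse (`localization_of_perturbative`).
* If `X^{5/4} < Y ≤ X^12`, then `ε` is smaller than `ε_L`, where `L` is the reduced scale `N'` rounded
  up. A site is bad if its unperturbed diagonal entry is below `2ε_L`. Two bad sites with the same
  component differ by `k` with `|⟨k, ω'⟩| < 4ε_L ≤ 4ε_{N'}`, which puts `k` into `Λ_{2N'}` as there are no
  difference resonances: there are at most `n` clusters (`localization_of_small_diagonal`).
* If `X^12 < Y`, every site is placed in a box of size `L`, with centre `c`, inside the large box. In it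
  the Hankel part and `B` are negligible, and the rest is the Hermitian central box of size `L` shifted
  by `-⟨c, ω'⟩`. The site is bad if the shift is within `2ε_L` of an eigenvalue of the central box; for
  each eigenvalue these sites form one cluster, again for lack of difference resonances. At a good site
  the small box satisfies the inversion condition (`inversion_of_eigenvalues_far`), so it is localized
  by hypothesis, and the resolvent identity with the small box applies: a step inside the small box
  decays at the rate `1/2` only, but the step that leaves it has the rate `1/2 + Δ` and the gauge is
  small at the distances inside the box (`gauge_step`, `localization_of_subboxes`).
-/

namespace DimEnlargedNewton

open Finset

/-! ### Decay of the inverse of a finite matrix -/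

/-- A bound that can be improved to half of itself plus `A` is at most `2A`: apply the hypothesis with
the best `F`, which is attained as `V` is finite. -/
theorem exp_weighted_max_principle {V : Type*} [Fintype V] (u ψ : V → ℝ) (A : ℝ)
    (h : ∀ F : ℝ, (∀ y, u y ≤ F * Real.exp (-ψ y)) → ∀ x, u x ≤ (A + F / 2) * Real.exp (-ψ x)) :
    ∀ x, u x ≤ 2 * A * Real.exp (-ψ x) := by
  intro x
  have : Nonempty V := ⟨x⟩
  obtain ⟨x₀, hx₀⟩ := Finite.exists_max (fun y => u y * Real.exp (ψ y))
  have e : ∀ y, Real.exp (ψ y) * Real.exp (-ψ y) = 1 := fun y => by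
    rw [← Real.exp_add]; simp
  have key : ∀ y F, u y ≤ F * Real.exp (-ψ y) ↔ u y * Real.exp (ψ y) ≤ F := fun y F => by
    rw [Real.exp_neg, ← div_eq_mul_inv, le_div_iff₀ (Real.exp_pos _)]
  have h1 := h (u x₀ * Real.exp (ψ x₀)) (fun y => (key _ _).2 (hx₀ y)) x₀
  rw [key] at h1
  exact (key _ _).2 ((hx₀ x).trans (by linarith))

/-- The distance from `t` to a non-empty finite set of radii. -/
def radiusDist (J : Finset ℕ) (hJ : J.Nonempty) (t : ℕ) : ℝ :=
  J.inf' hJ fun j => |(t : ℝ) - j|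

theorem radiusDist_nonneg (J : Finset ℕ) (hJ : J.Nonempty) (t : ℕ) : 0 ≤ radiusDist J hJ t :=
  (Finset.le_inf'_iff _ _).2 fun _ _ => abs_nonneg _

theorem radiusDist_of_mem (J : Finset ℕ) (hJ : J.Nonempty) {t : ℕ} (ht : t ∈ J) :
    radiusDist J hJ t = 0 :=
  le_antisymm ((Finset.inf'_le_iff _).2 ⟨t, ht, by simp⟩) (radiusDist_nonneg _ _ _)

theorem radiusDist_le_add (J : Finset ℕ) (hJ : J.Nonempty) (t t' : ℕ) :
    radiusDist J hJ t ≤ radiusDist J hJ t' + |(t : ℝ) - t'| := by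
  obtain ⟨j, hj, e⟩ := Finset.exists_mem_eq_inf' hJ fun j => |(t' : ℝ) - j|
  rw [radiusDist, radiusDist, e]
  refine (Finset.inf'_le_iff _).2 ⟨j, hj, ?_⟩
  have := abs_sub_le (t : ℝ) t' j
  linarith

/-- The number of radii below `t` at distance more than `2p` from `J`. -/
noncomputable def farCount (J : Finset ℕ) (hJ : J.Nonempty) (p t : ℕ) : ℕ :=
  open Classical in Nat.count (fun s => 2 * (p : ℝ) < radiusDist J hJ s) t

theorem farCount_zero (J : Finset ℕ) (hJ : J.Nonempty) (p : ℕ) : farCount J hJ p 0 = 0 := by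
  simp [farCount]

theorem farCount_mono (J : Finset ℕ) (hJ : J.Nonempty) (p : ℕ) : Monotone (farCount J hJ p) :=
  fun _ _ h => Nat.count_monotone _ h

theorem farCount_sub_le (J : Finset ℕ) (hJ : J.Nonempty) (p t t' : ℕ) :
    (farCount J hJ p t : ℝ) - farCount J hJ p t' ≤ |(t : ℝ) - t'| := by
  classical
  rcases le_total t t' with h | h
  · have : (farCount J hJ p t : ℝ) ≤ farCount J hJ p t' := by
      exact_mod_cast farCount_mono J hJ p h
    linarith [abs_nonneg ((t : ℝ) - t')]
  · obtain ⟨k, rfl⟩ := Nat.exists_eq_add_of_le h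
    have h1 : farCount J hJ p (t' + k) ≤ farCount J hJ p t' + k := by
      rw [farCount, Nat.count_add]
      exact Nat.add_le_add_left (Nat.count_le _) _
    have h2 : (farCount J hJ p (t' + k) : ℝ) ≤ farCount J hJ p t' + k := by exact_mod_cast h1
    have := le_abs_self ((((t' + k : ℕ) : ℝ)) - t')
    push_cast at this ⊢
    linarith

/-- The radii that are not counted lie in `J.card` intervals of `4p + 1` integers. -/
theorem farCount_lower (J : Finset ℕ) (hJ : J.Nonempty) (p t : ℕ) :
    (t : ℝ) - (J.card : ℝ) * (4 * p + 1) ≤ farCount J hJ p t := by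
  classical
  have h1 : (Finset.range t).filter (fun s => ¬ 2 * (p : ℝ) < radiusDist J hJ s) ⊆
      J.biUnion fun j => Finset.Icc (j - 2 * p) (j + 2 * p) := by
    intro s hs
    obtain ⟨_, h2⟩ := Finset.mem_filter.1 hs
    obtain ⟨j, hj, e⟩ := (Finset.inf'_le_iff _).1 (not_lt.1 h2)
    refine Finset.mem_biUnion.2 ⟨j, hj, Finset.mem_Icc.2 ?_⟩
    obtain ⟨e1, e2⟩ := abs_le.1 e
    constructor
    · have : (j : ℝ) ≤ s + 2 * p := by linarith
      have : j ≤ s + 2 * p := by exact_mod_cast this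
      omega
    · have : (s : ℝ) ≤ j + 2 * p := by linarith
      exact_mod_cast this
  have h2 := (Finset.card_le_card h1).trans (Finset.card_biUnion_le_card_mul J _ (4 * p + 1)
    (fun j _ => by rw [Nat.card_Icc]; omega))
  have h3 := Finset.card_filter_add_card_filter_not (s := Finset.range t)
    (fun s => 2 * (p : ℝ) < radiusDist J hJ s)
  rw [Finset.card_range] at h3
  have h4 : farCount J hJ p t =
      ((Finset.range t).filter (fun s => 2 * (p : ℝ) < radiusDist J hJ s)).card := by
    rw [farCount, Nat.count_eq_card_filter_range]
  have h5 : t ≤ farCount J hJ p t + J.card * (4 * p + 1) := by omega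
  have h6 : (t : ℝ) ≤ farCount J hJ p t + J.card * (4 * p + 1) := by exact_mod_cast h5
  linarith

/-- Either no far radius lies below `t`, or there is a last one, and up to it the count of far radii
is that of `t` less one. -/
theorem farCount_last (J : Finset ℕ) (hJ : J.Nonempty) (p t : ℕ) :
    farCount J hJ p t = 0 ∨ ∃ s < t, 2 * (p : ℝ) < radiusDist J hJ s ∧
      farCount J hJ p t = farCount J hJ p s + 1 := by
  classical
  induction t with
  | zero => left; exact farCount_zero _ _ _
  | succ t ih =>
    have e : farCount J hJ p (t + 1) =
        farCount J hJ p t + if 2 * (p : ℝ) < radiusDist J hJ t then 1 else 0 := by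
      rw [farCount, Nat.count_succ]; rfl
    by_cases h : 2 * (p : ℝ) < radiusDist J hJ t
    · right
      exact ⟨t, Nat.lt_succ_self t, h, by rw [e, if_pos h]⟩
    · rw [if_neg h, add_zero] at e
      rw [e]
      rcases ih with ih | ⟨s, hs, h1, h2⟩
      · exact Or.inl ih
      · exact Or.inr ⟨s, hs.trans (Nat.lt_succ_self t), h1, h2⟩

/-- **Decay across shells.** The column of the inverse at `q` decays at a point `x` as if the shells
around the radii in `J` had been cut out of space. At a radius outside `J` the column satisfies a
local resolvent inequality with a contracting kernel. Nothing is assumed at a radius in `J`: there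
the bound `B` on the whole inverse is applied to the commutator of `T` with the cut-off to the
outside of the last sphere that is far from `J`, and the loss of the factor `B` is compensated by the
decay collected on the way from `J` to that sphere. -/
theorem norm_inv_apply_le_of_shells {V : Type*} [Fintype V] [DecidableEq V] (T : Matrix V V ℂ)
    (hT : IsUnit T) (φ : ℝ → ℝ) (hφ0 : φ 0 = 0)
    (hφm : ∀ x y, 0 ≤ x → x ≤ y → φ x ≤ φ y)
    (hφs : ∀ x y, 0 ≤ x → 0 ≤ y → φ (x + y) ≤ φ x + φ y)
    (b b' B A κ : ℝ) (hb : 0 ≤ b) (hb' : 0 ≤ b') (hB0 : 0 ≤ B) (hBA : B ≤ A) (hκ : 0 ≤ κ)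
    (hB : ∀ x y, ‖T⁻¹ x y‖ ≤ B)
    (d : V → V → ℝ) (hd0 : ∀ x y, 0 ≤ d x y) (rad : V → ℕ)
    (hrad : ∀ x y, |(rad x : ℝ) - rad y| ≤ d x y)
    (hTd : ∀ x y, x ≠ y → ‖T x y‖ ≤ κ * Real.exp (-((b + b') * φ (d x y))))
    (q : V) (hq : rad q = 0) (J : Finset ℕ) (hJ0 : 0 ∈ J) (p : ℕ)
    (hp : 2 * (Fintype.card V : ℝ) ^ 2 * (B * κ * Real.exp (b * φ 1)) ≤ Real.exp (b' * φ p))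
    (hgood : ∀ x, rad x ∉ J → ∃ Γ : V → ℝ, (∀ y, 0 ≤ Γ y) ∧
      (∀ y, Γ y * (2 * Fintype.card V) ≤ Real.exp (-((b + b') * φ (d x y)))) ∧
      ‖T⁻¹ x q‖ ≤ A * Real.exp (-((b + b') * φ (rad x))) + ∑ y, Γ y * ‖T⁻¹ y q‖)
    (x : V) (hx : 0 ≤ (rad x : ℝ) - J.card * (4 * p + 1)) :
    ‖T⁻¹ x q‖ ≤ 2 * A * Real.exp (-(b * φ ((rad x : ℝ) - J.card * (4 * p + 1)))) := by
  classical
  have hJ : J.Nonempty := ⟨0, hJ0⟩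
  have hφn : ∀ x, 0 ≤ x → 0 ≤ φ x := fun x hx => hφ0 ▸ hφm 0 x le_rfl hx
  set D := radiusDist J hJ with hD
  set g : ℕ → ℝ := fun t => (farCount J hJ p t : ℝ) with hg
  have hg0 : ∀ t, 0 ≤ g t := fun t => Nat.cast_nonneg _
  set ψ : V → ℝ := fun x => b * φ (g (rad x)) + b' * φ (D (rad x)) with hψ
  have hA0 : 0 ≤ A := hB0.trans hBA
  have hV : (0 : ℝ) < Fintype.card V := by
    have : 0 < Fintype.card V := Fintype.card_pos_iff.2 ⟨q⟩
    exact_mod_cast this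
  have hV1 : (1 : ℝ) ≤ Fintype.card V := by
    have : 0 < Fintype.card V := Fintype.card_pos_iff.2 ⟨q⟩
    exact_mod_cast this
  -- `φ ∘ g` and `φ ∘ D` are Lipschitz with respect to `φ ∘ d`
  have lipg : ∀ t t' : ℕ, ∀ r : ℝ, |(t : ℝ) - t'| ≤ r → φ (g t) ≤ φ (g t') + φ r := by
    intro t t' r hr
    have h1 : g t ≤ g t' + r := by
      have := farCount_sub_le J hJ p t t'
      simp only [hg]; linarith
    exact (hφm _ _ (hg0 t) h1).trans (hφs _ _ (hg0 t') ((abs_nonneg _).trans hr))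
  have lipD : ∀ t t' : ℕ, ∀ r : ℝ, |(t : ℝ) - t'| ≤ r → φ (D t) ≤ φ (D t') + φ r := by
    intro t t' r hr
    have h1 : D t ≤ D t' + r := (radiusDist_le_add J hJ t t').trans (by linarith)
    exact (hφm _ _ (radiusDist_nonneg _ _ _) h1).trans
      (hφs _ _ (radiusDist_nonneg _ _ _) ((abs_nonneg _).trans hr))
  have hψrad : ∀ y, ψ y ≤ (b + b') * φ (rad y) := by
    intro y
    have h1 := lipg (rad y) 0 (rad y) (by simp)
    have h2 := lipD (rad y) 0 (rad y) (by simp)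
    have h3 : φ (g 0) = 0 := by simp only [hg, farCount_zero]; simpa using hφ0
    have h4 : φ (D 0) = 0 := by rw [hD, radiusDist_of_mem J hJ hJ0, hφ0]
    have := mul_le_mul_of_nonneg_left h1 hb
    have := mul_le_mul_of_nonneg_left h2 hb'
    simp only [hψ]; rw [h3] at *; rw [h4] at *
    nlinarith
  have hψlip : ∀ y z, ψ y - ψ z ≤ (b + b') * φ (d y z) := by
    intro y z
    have h1 := mul_le_mul_of_nonneg_left (lipg (rad y) (rad z) _ (hrad y z)) hb
    have h2 := mul_le_mul_of_nonneg_left (lipD (rad y) (rad z) _ (hrad y z)) hb'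
    simp only [hψ]; linarith
  have main := exp_weighted_max_principle (fun x => ‖T⁻¹ x q‖) ψ A ?_ x
  · refine main.trans (mul_le_mul_of_nonneg_left (Real.exp_le_exp.2 (neg_le_neg ?_)) (by linarith))
    have h1 := hφm _ _ hx (farCount_lower J hJ p (rad x))
    have h2 := mul_le_mul_of_nonneg_left h1 hb
    have h3 := mul_nonneg hb' (hφn _ (radiusDist_nonneg J hJ (rad x)))
    simp only [hψ, hD, hg]; linarith
  intro F hF x
  have hF0 : 0 ≤ F := by
    have := (norm_nonneg _).trans (hF q)
    exact nonneg_of_mul_nonneg_left this (Real.exp_pos _)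
  by_cases hxJ : rad x ∈ J
  swap
  · obtain ⟨Γ, hΓ0, hΓ, hin⟩ := hgood x hxJ
    have h1 : A * Real.exp (-((b + b') * φ (rad x))) ≤ A * Real.exp (-ψ x) :=
      mul_le_mul_of_nonneg_left (Real.exp_le_exp.2 (neg_le_neg (hψrad x))) hA0
    have h2 : ∀ y, Γ y * ‖T⁻¹ y q‖ ≤ F / 2 * Real.exp (-ψ x) * (1 / Fintype.card V) := by
      intro y
      have h3 : Γ y ≤ Real.exp (-((b + b') * φ (d x y))) / (2 * Fintype.card V) := by
        rw [le_div_iff₀ (by positivity)]; exact hΓ y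
      calc Γ y * ‖T⁻¹ y q‖ ≤ Real.exp (-((b + b') * φ (d x y))) / (2 * Fintype.card V) *
            (F * Real.exp (-ψ y)) :=
            mul_le_mul h3 (hF y) (norm_nonneg _) (by positivity)
        _ = F / 2 * Real.exp (-((b + b') * φ (d x y)) + -ψ y) * (1 / Fintype.card V) := by
            rw [Real.exp_add]; field_simp
        _ ≤ _ := by
            refine mul_le_mul_of_nonneg_right (mul_le_mul_of_nonneg_left
              (Real.exp_le_exp.2 ?_) (by positivity)) (by positivity)
            linarith [hψlip x y]
    have h4 : ∑ y, Γ y * ‖T⁻¹ y q‖ ≤ F / 2 * Real.exp (-ψ x) := by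
      refine (Finset.sum_le_sum fun y _ => h2 y).trans ?_
      rw [Finset.sum_const, Finset.card_univ, nsmul_eq_mul]
      apply le_of_eq; field_simp
    calc _ ≤ _ := hin
      _ ≤ A * Real.exp (-ψ x) + F / 2 * Real.exp (-ψ x) := add_le_add h1 h4
      _ = _ := by ring
  have hDx : D (rad x) = 0 := radiusDist_of_mem J hJ hxJ
  rcases farCount_last J hJ p (rad x) with h0 | ⟨s, hsx, hsD, hsg⟩
  · have hψx : ψ x = 0 := by
      simp only [hψ, hDx, hg, h0, Nat.cast_zero, hφ0]; ring
    rw [hψx]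
    simp only [neg_zero, Real.exp_zero, mul_one]
    linarith [hB x q]
  have hs0 : s ≠ 0 := by
    rintro rfl
    rw [radiusDist_of_mem J hJ hJ0] at hsD
    have : (0 : ℝ) ≤ p := Nat.cast_nonneg p
    linarith
  -- the cut-off `χ` to the outside of the sphere of radius `s`
  set χ : V → ℂ := fun y => if s ≤ rad y then T⁻¹ y q else 0 with hχ
  have hTT : T * T⁻¹ = 1 := Matrix.mul_nonsing_inv T ((Matrix.isUnit_iff_isUnit_det T).1 hT)
  have hTT' : T⁻¹ * T = 1 := Matrix.nonsing_inv_mul T ((Matrix.isUnit_iff_isUnit_det T).1 hT)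
  have hxχ : T⁻¹ x q = ∑ x', T⁻¹ x x' * ∑ y, T x' y * χ y := by
    have h1 : (T⁻¹.mulVec (T.mulVec χ)) x = χ x := by
      rw [Matrix.mulVec_mulVec, hTT', Matrix.one_mulVec]
    have h2 : χ x = T⁻¹ x q := if_pos hsx.le
    rw [← h2, ← h1]; rfl
  set E : ℝ := F / 2 * Real.exp (-ψ x) * (1 / (Fintype.card V : ℝ) ^ 2) with hE
  have hE0 : 0 ≤ E := by positivity
  -- an entry of `T` across the sphere is small enough to absorb the factor `B`
  have cross : ∀ x' y, ((s ≤ rad x' ∧ rad y < s) ∨ (rad x' < s ∧ s ≤ rad y)) →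
      B * (‖T x' y‖ * ‖T⁻¹ y q‖) ≤ E := by
    intro x' y hxy
    have hne : x' ≠ y := by rintro rfl; omega
    set r := d x' y with hr
    have hsr : |(s : ℝ) - rad y| ≤ r := by
      have h1 := hrad x' y
      rcases hxy with ⟨h2, h3⟩ | ⟨h2, h3⟩
      · have h2' : (s : ℝ) ≤ rad x' := by exact_mod_cast h2
        have h3' : (rad y : ℝ) ≤ s := by exact_mod_cast h3.le
        rw [abs_of_nonneg (by linarith)] at h1 ⊢; linarith
      · have h2' : (rad x' : ℝ) ≤ s := by exact_mod_cast h2.le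
        have h3' : (s : ℝ) ≤ rad y := by exact_mod_cast h3
        rw [abs_of_nonpos (by linarith)] at h1 ⊢; linarith
    have hgx : φ (g (rad x)) ≤ φ (g (rad y)) + φ r + φ 1 := by
      have h1 : g (rad x) = g s + 1 := by simp only [hg]; exact_mod_cast hsg
      rw [h1]
      have h2 := hφs _ _ (hg0 s) zero_le_one
      linarith [lipg s (rad y) r hsr]
    have hr0 : 0 ≤ r := hd0 _ _
    -- either `y` is far from `J`, or the jump from `x'` to `y` is long
    have hfar : φ p ≤ φ (D (rad y)) + φ r := by
      have h1 := radiusDist_le_add J hJ s (rad y)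
      have hD0 : 0 ≤ D (rad y) := radiusDist_nonneg _ _ _
      have hp0 : (0 : ℝ) ≤ p := Nat.cast_nonneg p
      rcases le_total r p with h2 | h2
      · have h3 : (p : ℝ) ≤ D (rad y) := by simp only [hD] at *; linarith
        linarith [hφm _ _ hp0 h3, hφn r hr0]
      · linarith [hφm _ _ hp0 h2, hφn _ hD0]
    have hexp : -((b + b') * φ r) + -ψ y ≤ b * φ 1 - b' * φ p + -ψ x := by
      have h1 := mul_le_mul_of_nonneg_left hgx hb
      have h2 := mul_le_mul_of_nonneg_left hfar hb'
      simp only [hψ, hDx, hφ0]; linarith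
    have hpe : B * κ * Real.exp (b * φ 1 - b' * φ p) ≤ 1 / 2 * (1 / (Fintype.card V : ℝ) ^ 2) := by
      have h1 : B * κ * Real.exp (b * φ 1) ≤
          Real.exp (b' * φ p) / (2 * (Fintype.card V : ℝ) ^ 2) := by
        rw [le_div_iff₀ (by positivity)]; linarith
      rw [Real.exp_sub, ← mul_div_assoc, div_le_iff₀ (Real.exp_pos _)]
      refine h1.trans (le_of_eq ?_)
      field_simp
    calc B * (‖T x' y‖ * ‖T⁻¹ y q‖)
        ≤ B * (κ * Real.exp (-((b + b') * φ r)) * (F * Real.exp (-ψ y))) := by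
          refine mul_le_mul_of_nonneg_left (mul_le_mul (hTd x' y hne) (hF y) (norm_nonneg _)
            (by positivity)) hB0
      _ = B * κ * F * Real.exp (-((b + b') * φ r) + -ψ y) := by rw [Real.exp_add]; ring
      _ ≤ B * κ * F * Real.exp (b * φ 1 - b' * φ p + -ψ x) :=
          mul_le_mul_of_nonneg_left (Real.exp_le_exp.2 hexp) (by positivity)
      _ = (B * κ * Real.exp (b * φ 1 - b' * φ p)) * (F * Real.exp (-ψ x)) := by
          rw [Real.exp_add]; ring
      _ ≤ (1 / 2 * (1 / (Fintype.card V : ℝ) ^ 2)) * (F * Real.exp (-ψ x)) :=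
          mul_le_mul_of_nonneg_right hpe (by positivity)
      _ = E := by rw [hE]; ring
  -- the commutator of `T` with the cut-off
  have hrow : ∀ x', B * ‖∑ y, T x' y * χ y‖ ≤ Fintype.card V * E := by
    intro x'
    have hsum : ∀ f : V → ℂ, (∀ y, f y ≠ 0 → ‖f y‖ = ‖T x' y‖ * ‖T⁻¹ y q‖ ∧
        ((s ≤ rad x' ∧ rad y < s) ∨ (rad x' < s ∧ s ≤ rad y))) →
        B * ‖∑ y, f y‖ ≤ Fintype.card V * E := by
      intro f hf
      have h1 : ∀ y, B * ‖f y‖ ≤ E := by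
        intro y
        by_cases hy : f y = 0
        · simpa [hy] using hE0
        · rw [(hf y hy).1]; exact cross x' y (hf y hy).2
      calc B * ‖∑ y, f y‖ ≤ B * ∑ y, ‖f y‖ := mul_le_mul_of_nonneg_left (norm_sum_le _ _) hB0
        _ = ∑ y, B * ‖f y‖ := Finset.mul_sum _ _ _
        _ ≤ ∑ _y : V, E := Finset.sum_le_sum fun y _ => h1 y
        _ = _ := by simp [Finset.card_univ]
    by_cases hx' : s ≤ rad x'
    · have hne : x' ≠ q := by rintro rfl; omega
      have h1 : ∑ y, T x' y * T⁻¹ y q = 0 := by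
        have := congrFun (congrFun hTT x') q
        rw [Matrix.mul_apply, Matrix.one_apply_ne hne] at this
        exact this
      have h2 : ∑ y, T x' y * χ y =
          ∑ y, -(if s ≤ rad y then 0 else T x' y * T⁻¹ y q) := by
        have h3 : ∑ y, T x' y * χ y - ∑ y, T x' y * T⁻¹ y q =
            ∑ y, -(if s ≤ rad y then 0 else T x' y * T⁻¹ y q) := by
          rw [← Finset.sum_sub_distrib]
          refine Finset.sum_congr rfl fun y _ => ?_
          simp only [hχ]; split_ifs <;> ring
        rwa [h1, sub_zero] at h3
      rw [h2]
      refine hsum _ fun y hy => ?_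
      by_cases hy' : s ≤ rad y
      · simp [hy'] at hy
      · exact ⟨by simp [hy'], Or.inl ⟨hx', not_le.1 hy'⟩⟩
    · refine hsum _ fun y hy => ?_
      by_cases hy' : s ≤ rad y
      · exact ⟨by simp [hχ, hy'], Or.inr ⟨not_le.1 hx', hy'⟩⟩
      · simp [hχ, hy'] at hy
  have hfin : ‖T⁻¹ x q‖ ≤ F / 2 * Real.exp (-ψ x) := by
    rw [hxχ]
    calc ‖∑ x', T⁻¹ x x' * ∑ y, T x' y * χ y‖
        ≤ ∑ x', ‖T⁻¹ x x' * ∑ y, T x' y * χ y‖ := norm_sum_le _ _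
      _ ≤ ∑ x' : V, Fintype.card V * E := by
          refine Finset.sum_le_sum fun x' _ => ?_
          rw [norm_mul]
          exact (mul_le_mul_of_nonneg_right (hB x x') (norm_nonneg _)).trans (hrow x')
      _ = F / 2 * Real.exp (-ψ x) := by
          rw [Finset.sum_const, Finset.card_univ, nsmul_eq_mul, hE]
          field_simp
  have : 0 ≤ A * Real.exp (-ψ x) := by positivity
  calc ‖T⁻¹ x q‖ ≤ F / 2 * Real.exp (-ψ x) := hfin
    _ ≤ (A + F / 2) * Real.exp (-ψ x) := by linarith

/-- If the off-diagonal entries are small against `1 / B`, where `B` bounds the inverse, then no diagonal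
entry is: in the row of `T⁻¹ T = 1` at `x` only the diagonal term can be large. -/
theorem half_le_mul_norm_diag {V : Type*} [Fintype V] [DecidableEq V] (T : Matrix V V ℂ)
    (hT : IsUnit T) (B κ : ℝ) (hB0 : 0 ≤ B) (hκ : 0 ≤ κ) (hB : ∀ x y, ‖T⁻¹ x y‖ ≤ B)
    (hTd : ∀ x y, x ≠ y → ‖T x y‖ ≤ κ) (hs : 2 * (B * κ * Fintype.card V) ≤ 1) (x : V) :
    1 ≤ 2 * (B * ‖T x x‖) := by
  have hTT : T⁻¹ * T = 1 := Matrix.nonsing_inv_mul T ((Matrix.isUnit_iff_isUnit_det T).1 hT)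
  have h1 : ∑ y, T⁻¹ x y * T y x = 1 := by
    have := congrFun (congrFun hTT x) x
    rwa [Matrix.mul_apply, Matrix.one_apply_eq] at this
  rw [← Finset.add_sum_erase _ _ (Finset.mem_univ x)] at h1
  have h2 : ‖∑ y ∈ Finset.univ.erase x, T⁻¹ x y * T y x‖ ≤ B * κ * Fintype.card V := by
    refine (norm_sum_le _ _).trans ?_
    have h3 : ∀ y ∈ Finset.univ.erase x, ‖T⁻¹ x y * T y x‖ ≤ B * κ := fun y hy => by
      rw [norm_mul]
      exact mul_le_mul (hB x y) (hTd y x (Finset.ne_of_mem_erase hy)) (norm_nonneg _) hB0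
    refine (Finset.sum_le_card_nsmul _ _ _ h3).trans ?_
    rw [nsmul_eq_mul, mul_comm]
    refine mul_le_mul_of_nonneg_left ?_ (mul_nonneg hB0 hκ)
    exact_mod_cast Finset.card_le_univ _
  have h4 : (1 : ℝ) ≤ ‖T⁻¹ x x * T x x‖ + ‖∑ y ∈ Finset.univ.erase x, T⁻¹ x y * T y x‖ := by
    have := norm_add_le (T⁻¹ x x * T x x) (∑ y ∈ Finset.univ.erase x, T⁻¹ x y * T y x)
    rwa [h1, norm_one] at this
  rw [norm_mul] at h4
  have := mul_le_mul_of_nonneg_right (hB x x) (norm_nonneg (T x x))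
  linarith

/-- The row of `T T⁻¹ = 1` at `x`, solved for the diagonal term. -/
theorem norm_diag_mul_norm_inv_apply_le {V : Type*} [Fintype V] [DecidableEq V] (T : Matrix V V ℂ)
    (hT : IsUnit T) (q x : V) :
    ‖T x x‖ * ‖T⁻¹ x q‖ ≤
      (if x = q then 1 else 0) + ∑ y ∈ Finset.univ.erase x, ‖T x y‖ * ‖T⁻¹ y q‖ := by
  have hTT : T * T⁻¹ = 1 := Matrix.mul_nonsing_inv T ((Matrix.isUnit_iff_isUnit_det T).1 hT)
  have h1 := congrFun (congrFun hTT x) q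
  rw [Matrix.mul_apply, Matrix.one_apply, ← Finset.add_sum_erase _ _ (Finset.mem_univ x)] at h1
  rw [← norm_mul, eq_sub_of_add_eq h1]
  refine (norm_sub_le _ _).trans (add_le_add ?_ ?_)
  · split_ifs <;> simp
  · exact (norm_sum_le _ _).trans (Finset.sum_le_sum fun y _ => (norm_mul _ _).le)

/-- If the off-diagonal entries of `T` are small against `1 / B`, where `B` bounds the inverse of `T`, their
decay passes to the inverse. -/
theorem norm_inv_apply_le_of_small_coupling {V : Type*} [Fintype V] [DecidableEq V]
    (T : Matrix V V ℂ) (hT : IsUnit T) (B κ : ℝ) (hB0 : 0 < B) (hκ : 0 ≤ κ)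
    (hB : ∀ x y, ‖T⁻¹ x y‖ ≤ B) (D : V → V → ℝ) (hD0 : ∀ x y, 0 ≤ D x y)
    (hD : ∀ x y z, D x z ≤ D x y + D y z)
    (hTd : ∀ x y, x ≠ y → ‖T x y‖ ≤ κ * Real.exp (-D x y))
    (hs : 4 * (B * κ * Fintype.card V) ≤ 1) (q : V) (hq : D q q = 0) (x : V) (hx : x ≠ q) :
    ‖T⁻¹ x q‖ ≤ 4 * B ^ 2 * κ * Fintype.card V * Real.exp (-D x q) := by
  have hdiag := half_le_mul_norm_diag T hT B κ hB0.le hκ hB (fun x y h => (hTd x y h).trans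
    (mul_le_of_le_one_right hκ (Real.exp_le_one_iff.2 (neg_nonpos.2 (hD0 x y)))))
    (by nlinarith [mul_nonneg (mul_nonneg hB0.le hκ) (Nat.cast_nonneg (α := ℝ) (Fintype.card V))])
  have step : ∀ F : ℝ, (∀ y, ‖T⁻¹ y q‖ ≤ F * Real.exp (-D y q)) → ∀ x, x ≠ q →
      ‖T⁻¹ x q‖ ≤ 2 * B * κ * Fintype.card V * F * Real.exp (-D x q) := by
    intro F hF x hx
    have hF0 : 0 ≤ F := nonneg_of_mul_nonneg_left ((norm_nonneg _).trans (hF q)) (Real.exp_pos _)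
    have h1 := norm_diag_mul_norm_inv_apply_le T hT q x
    rw [if_neg hx, zero_add] at h1
    have h2 : ∑ y ∈ Finset.univ.erase x, ‖T x y‖ * ‖T⁻¹ y q‖ ≤
        Fintype.card V * (κ * F * Real.exp (-D x q)) := by
      refine (Finset.sum_le_card_nsmul _ _ (κ * F * Real.exp (-D x q)) fun y hy => ?_).trans ?_
      · calc ‖T x y‖ * ‖T⁻¹ y q‖ ≤ κ * Real.exp (-D x y) * (F * Real.exp (-D y q)) :=
              mul_le_mul (hTd x y (Finset.ne_of_mem_erase hy).symm) (hF y) (norm_nonneg _)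
                (by positivity)
          _ = κ * F * Real.exp (-D x y + -D y q) := by rw [Real.exp_add]; ring
          _ ≤ _ := mul_le_mul_of_nonneg_left (Real.exp_le_exp.2 (by linarith [hD x y q]))
              (by positivity)
      · rw [nsmul_eq_mul]
        refine mul_le_mul_of_nonneg_right ?_ (by positivity)
        exact_mod_cast Finset.card_le_univ _
    have h3 := hdiag x
    have h4 : ‖T⁻¹ x q‖ ≤ 2 * B * (‖T x x‖ * ‖T⁻¹ x q‖) := by
      nlinarith [norm_nonneg (T⁻¹ x q)]
    calc _ ≤ 2 * B * (‖T x x‖ * ‖T⁻¹ x q‖) := h4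
      _ ≤ 2 * B * (Fintype.card V * (κ * F * Real.exp (-D x q))) :=
          mul_le_mul_of_nonneg_left (h1.trans h2) (by positivity)
      _ = _ := by ring
  have h1 := exp_weighted_max_principle (fun y => ‖T⁻¹ y q‖) (fun y => D y q) B ?_
  · have := step _ h1 x hx
    refine this.trans (le_of_eq (by ring))
  intro F hF y
  have hF0 : 0 ≤ F := nonneg_of_mul_nonneg_left ((norm_nonneg _).trans (hF q)) (Real.exp_pos _)
  by_cases hy : y = q
  · subst hy
    simp only [hq, neg_zero, Real.exp_zero, mul_one]
    linarith [hB y y]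
  · refine (step F hF y hy).trans (mul_le_mul_of_nonneg_right ?_ (Real.exp_nonneg _))
    nlinarith [mul_le_mul_of_nonneg_right hs hF0]

end DimEnlargedNewton

namespace DimEnlargedNewton

/-! ### The length on the lattice -/

theorem len_nonneg {n : ℕ} (k : Lattice n) : 0 ≤ len k :=
  Finset.sum_nonneg fun _ _ => abs_nonneg _

theorem len_zero {n : ℕ} : len (0 : Lattice n) = 0 := by simp [len]

theorem len_neg {n : ℕ} (k : Lattice n) : len (-k) = len k := by simp [len]

theorem len_add_le {n : ℕ} (k l : Lattice n) : len (k + l) ≤ len k + len l := by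
  rw [len, len, len, ← Finset.sum_add_distrib]
  refine Finset.sum_le_sum fun i _ => ?_
  rw [Pi.add_apply, Int.cast_add]
  exact abs_add_le _ _

theorem len_basisVec {n : ℕ} (j : Fin n) : len (basisVec j) = 1 := by
  rw [len, Finset.sum_eq_single j]
  · simp [basisVec]
  · intro i _ hi; simp [basisVec, hi]
  · simp

theorem abs_le_len {n : ℕ} (k : Lattice n) (i : Fin n) : |(k i : ℝ)| ≤ len k :=
  Finset.single_le_sum (f := fun i => |(k i : ℝ)|) (fun _ _ => abs_nonneg _) (Finset.mem_univ i)

theorem rpow_add_le {x y s : ℝ} (hx : 0 ≤ x) (hy : 0 ≤ y) (hs0 : 0 ≤ s) (hs1 : s ≤ 1) :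
    (x + y) ^ s ≤ x ^ s + y ^ s :=
  Real.rpow_add_le_add_rpow hx hy hs0 hs1

theorem pair_add {n : ℕ} (k l : Lattice n) (x : Fin n → ℝ) : pair (k + l) x = pair k x + pair l x := by
  simp only [pair, Pi.add_apply, Int.cast_add, add_mul, Finset.sum_add_distrib]

theorem pair_neg {n : ℕ} (k : Lattice n) (x : Fin n → ℝ) : pair (-k) x = -pair k x := by
  simp [pair]

theorem pair_sub {n : ℕ} (k l : Lattice n) (x : Fin n → ℝ) : pair (k - l) x = pair k x - pair l x := by
  rw [sub_eq_add_neg, pair_add, pair_neg, sub_eq_add_neg]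

/-! ### Absolutely convergent Fourier series with a weight -/

/-- The Gevrey weight `exp(γ |k|^s)`. -/
noncomputable def gevreyWeight {n : ℕ} (γ s : ℝ) (k : Lattice n) : ℝ := Real.exp (γ * len k ^ s)

theorem gevreyWeight_pos {n : ℕ} (γ s : ℝ) (k : Lattice n) : 0 < gevreyWeight γ s k :=
  Real.exp_pos _

theorem one_le_gevreyWeight {n : ℕ} {γ : ℝ} (hγ : 0 ≤ γ) (s : ℝ) (k : Lattice n) :
    1 ≤ gevreyWeight γ s k :=
  Real.one_le_exp (mul_nonneg hγ (Real.rpow_nonneg (len_nonneg k) s))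

theorem gevreyWeight_add_le {n : ℕ} {γ s : ℝ} (hγ : 0 ≤ γ) (hs0 : 0 ≤ s) (hs1 : s ≤ 1)
    (k l : Lattice n) : gevreyWeight γ s (k + l) ≤ gevreyWeight γ s k * gevreyWeight γ s l := by
  rw [gevreyWeight, gevreyWeight, gevreyWeight, ← Real.exp_add, ← mul_add]
  refine Real.exp_le_exp.2 (mul_le_mul_of_nonneg_left ?_ hγ)
  exact (Real.rpow_le_rpow (len_nonneg _) (len_add_le k l) hs0).trans
    (rpow_add_le (len_nonneg _) (len_nonneg _) hs0 hs1)

/-- The character `exp(i⟨k, θ⟩)`. -/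
noncomputable def character {n : ℕ} (k : Lattice n) (θ : Fin n → ℝ) : ℂ :=
  Complex.exp (Complex.I * (pair k θ : ℂ))

theorem norm_character {n : ℕ} (k : Lattice n) (θ : Fin n → ℝ) : ‖character k θ‖ = 1 := by
  rw [character, mul_comm]; exact Complex.norm_exp_ofReal_mul_I _

theorem character_add {n : ℕ} (k l : Lattice n) (θ : Fin n → ℝ) :
    character (k + l) θ = character k θ * character l θ := by
  rw [character, character, character, ← Complex.exp_add, pair_add]; push_cast; ring_nf

theorem conj_character {n : ℕ} (k : Lattice n) (θ : Fin n → ℝ) :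
    (starRingEnd ℂ) (character k θ) = character (-k) θ := by
  rw [character, character, ← Complex.exp_conj, pair_neg]; simp

/-- `f` is the sum of an absolutely convergent trigonometric series, possibly with repeated
frequencies, of norm at most `A` in the `ℓ¹` space weighted by `exp(γ |k|^s)`. The free index type
makes a product of two series a series without collecting equal frequencies. -/
def HasExpansion {n : ℕ} (γ s : ℝ) (f : (Fin n → ℝ) → ℂ) (A : ℝ) : Prop :=
  ∃ (ι : Type) (_ : Countable ι) (c : ι → ℂ) (k : ι → Lattice n),
    Summable (fun i => ‖c i‖ * gevreyWeight γ s (k i)) ∧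
      ∑' i, ‖c i‖ * gevreyWeight γ s (k i) ≤ A ∧ ∀ θ, f θ = ∑' i, c i * character (k i) θ

theorem summable_norm_of_weighted {n : ℕ} {γ s : ℝ} (hγ : 0 ≤ γ) {ι : Type} {c : ι → ℂ}
    {k : ι → Lattice n} (h : Summable fun i => ‖c i‖ * gevreyWeight γ s (k i)) :
    Summable fun i => ‖c i‖ :=
  h.of_nonneg_of_le (fun _ => norm_nonneg _) fun _ =>
    le_mul_of_one_le_right (norm_nonneg _) (one_le_gevreyWeight hγ s _)

theorem summable_norm_mul_character {n : ℕ} {γ s : ℝ} (hγ : 0 ≤ γ) {ι : Type} {c : ι → ℂ}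
    {k : ι → Lattice n} (h : Summable fun i => ‖c i‖ * gevreyWeight γ s (k i)) (θ : Fin n → ℝ) :
    Summable fun i => ‖c i * character (k i) θ‖ := by
  simpa [norm_character] using summable_norm_of_weighted hγ h

theorem HasExpansion.const {n : ℕ} {γ s : ℝ} (hs : 0 < s) (a : ℂ) :
    HasExpansion (n := n) γ s (fun _ => a) ‖a‖ := by
  refine ⟨Unit, inferInstance, fun _ => a, fun _ => 0, .of_finite, ?_, fun θ => ?_⟩
  · simp [gevreyWeight, len_zero, Real.zero_rpow hs.ne']
  · simp [character, pair]

theorem HasExpansion.add {n : ℕ} {γ s : ℝ} (hγ : 0 ≤ γ) {f g : (Fin n → ℝ) → ℂ} {A B : ℝ}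
    (hf : HasExpansion γ s f A) (hg : HasExpansion γ s g B) :
    HasExpansion γ s (fun θ => f θ + g θ) (A + B) := by
  obtain ⟨ι, _, c, k, h1, h2, h3⟩ := hf
  obtain ⟨ι', _, c', k', h1', h2', h3'⟩ := hg
  refine ⟨ι ⊕ ι', inferInstance, Sum.elim c c', Sum.elim k k', Summable.sum _ h1 h1', ?_,
    fun θ => ?_⟩
  · rw [Summable.tsum_sum (f := fun i => ‖Sum.elim c c' i‖ * gevreyWeight γ s (Sum.elim k k' i))
      h1 h1']
    exact add_le_add h2 h2'
  · beta_reduce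
    rw [h3, h3', Summable.tsum_sum (f := fun i => Sum.elim c c' i * character (Sum.elim k k' i) θ)
      (summable_norm_mul_character hγ h1 θ).of_norm (summable_norm_mul_character hγ h1' θ).of_norm]
    rfl

theorem HasExpansion.mul {n : ℕ} {γ s : ℝ} (hγ : 0 ≤ γ) (hs0 : 0 ≤ s) (hs1 : s ≤ 1)
    {f g : (Fin n → ℝ) → ℂ} {A B : ℝ} (hf : HasExpansion γ s f A) (hg : HasExpansion γ s g B) :
    HasExpansion γ s (fun θ => f θ * g θ) (A * B) := by
  obtain ⟨ι, _, c, k, h1, h2, h3⟩ := hf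
  obtain ⟨ι', _, c', k', h1', h2', h3'⟩ := hg
  have n1 : 0 ≤ fun i => ‖c i‖ * gevreyWeight γ s (k i) :=
    fun i => mul_nonneg (norm_nonneg _) (gevreyWeight_pos _ _ _).le
  have n2 : 0 ≤ fun i => ‖c' i‖ * gevreyWeight γ s (k' i) :=
    fun i => mul_nonneg (norm_nonneg _) (gevreyWeight_pos _ _ _).le
  have hp := h1.mul_of_nonneg h1' n1 n2
  have hle : ∀ x : ι × ι', ‖c x.1 * c' x.2‖ * gevreyWeight γ s (k x.1 + k' x.2) ≤
      ‖c x.1‖ * gevreyWeight γ s (k x.1) * (‖c' x.2‖ * gevreyWeight γ s (k' x.2)) := fun x => by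
    rw [norm_mul]
    calc _ ≤ ‖c x.1‖ * ‖c' x.2‖ * (gevreyWeight γ s (k x.1) * gevreyWeight γ s (k' x.2)) :=
          mul_le_mul_of_nonneg_left (gevreyWeight_add_le hγ hs0 hs1 _ _) (by positivity)
      _ = _ := by ring
  have hs := hp.of_nonneg_of_le
    (fun x => mul_nonneg (norm_nonneg _) (gevreyWeight_pos _ _ _).le) hle
  refine ⟨ι × ι', inferInstance, fun x => c x.1 * c' x.2, fun x => k x.1 + k' x.2, hs, ?_,
    fun θ => ?_⟩
  · refine (hs.tsum_le_tsum hle hp).trans ?_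
    rw [← h1.tsum_mul_tsum h1' hp]
    exact mul_le_mul h2 h2' (tsum_nonneg n2) ((tsum_nonneg n1).trans h2)
  · beta_reduce
    rw [h3, h3', tsum_mul_tsum_of_summable_norm (summable_norm_mul_character hγ h1 θ)
      (summable_norm_mul_character hγ h1' θ)]
    refine tsum_congr fun x => ?_
    rw [character_add]; ring

theorem HasExpansion.conj {n : ℕ} {γ s : ℝ} {f : (Fin n → ℝ) → ℂ} {A : ℝ}
    (hf : HasExpansion γ s f A) : HasExpansion γ s (fun θ => (starRingEnd ℂ) (f θ)) A := by
  obtain ⟨ι, hι, c, k, h1, h2, h3⟩ := hf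
  have e : ∀ i, ‖(starRingEnd ℂ) (c i)‖ * gevreyWeight γ s (-k i) =
      ‖c i‖ * gevreyWeight γ s (k i) := fun i => by
    simp [gevreyWeight, len_neg]
  refine ⟨ι, hι, fun i => (starRingEnd ℂ) (c i), fun i => -k i, ?_, ?_, fun θ => ?_⟩
  · simpa only [e] using h1
  · simpa only [e] using h2
  · beta_reduce
    rw [h3, Complex.conj_tsum]
    simp only [map_mul, conj_character]

theorem HasExpansion.mono {n : ℕ} {γ s : ℝ} {f : (Fin n → ℝ) → ℂ} {A B : ℝ}
    (hf : HasExpansion γ s f A) (h : A ≤ B) : HasExpansion γ s f B := by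
  obtain ⟨ι, hι, c, k, h1, h2, h3⟩ := hf
  exact ⟨ι, hι, c, k, h1, h2.trans h, h3⟩

/-! ### Fourier coefficients -/

theorem integrable_character {n : ℕ} (k : Lattice n) :
    IntegrableOn (character k) (Set.Icc (0 : Fin n → ℝ) fun _ => 2 * Real.pi) := by
  apply ContinuousOn.integrableOn_Icc
  apply Continuous.continuousOn
  unfold character pair
  fun_prop

theorem integral_character {n : ℕ} (k : Lattice n) :
    ∫ θ in Set.Icc (0 : Fin n → ℝ) (fun _ => 2 * Real.pi), character k θ =
      if k = 0 then (2 * (Real.pi : ℂ)) ^ n else 0 := by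
  have h1 : ∀ θ : Fin n → ℝ, character k θ = ∏ i, Complex.exp (Complex.I * (k i : ℂ) * (θ i : ℂ)) := by
    intro θ
    rw [← Complex.exp_sum, character, pair]
    congr 1
    push_cast
    rw [Finset.mul_sum]
    exact Finset.sum_congr rfl fun i _ => by ring
  have h2 : Set.Icc (0 : Fin n → ℝ) (fun _ => 2 * Real.pi) =
      Set.univ.pi fun _ => Set.Icc (0 : ℝ) (2 * Real.pi) := (Set.pi_univ_Icc _ _).symm
  simp only [h1]
  rw [h2, volume_pi, Measure.restrict_pi_pi]
  rw [integral_fintype_prod_eq_prod (𝕜 := ℂ)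
    (fun i (t : ℝ) => Complex.exp (Complex.I * (k i : ℂ) * (t : ℂ)))]
  have h3 : ∀ m : ℤ, ∫ t in Set.Icc (0 : ℝ) (2 * Real.pi), Complex.exp (Complex.I * (m : ℂ) * (t : ℂ)) =
      if m = 0 then 2 * (Real.pi : ℂ) else 0 := by
    intro m
    rw [integral_Icc_eq_integral_Ioc, ← intervalIntegral.integral_of_le Real.two_pi_pos.le]
    by_cases hm : m = 0
    · simp [hm]
    · have hc : Complex.I * (m : ℂ) ≠ 0 := mul_ne_zero Complex.I_ne_zero (by exact_mod_cast hm)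
      rw [integral_exp_mul_complex hc, if_neg hm]
      have : Complex.exp (Complex.I * (m : ℂ) * ((2 * Real.pi : ℝ) : ℂ)) = 1 := by
        rw [Complex.exp_eq_one_iff]
        exact ⟨m, by push_cast; ring⟩
      rw [this]; simp
  simp only [h3]
  by_cases hk : k = 0
  · simp [hk]
  · obtain ⟨i, hi⟩ := Function.ne_iff.1 hk
    rw [if_neg hk]
    exact Finset.prod_eq_zero (Finset.mem_univ i) (if_neg hi)

/-- Only the terms of frequency `m` contribute to the Fourier coefficient at `m`, whatever their
number. -/
theorem norm_fourierCoef_le {n : ℕ} {γ s : ℝ} (hγ : 0 ≤ γ) {f : (Fin n → ℝ) → ℂ} {A : ℝ}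
    (hf : HasExpansion γ s f A) (m : Lattice n) :
    ‖fourierCoef f m‖ ≤ A * Real.exp (-(γ * len m ^ s)) := by
  obtain ⟨ι, hι, c, k, h1, h2, h3⟩ := hf
  have hpi : (2 * (Real.pi : ℂ)) ^ n ≠ 0 := pow_ne_zero _ (by simp [Real.pi_ne_zero])
  set S := Set.Icc (0 : Fin n → ℝ) (fun _ => 2 * Real.pi) with hS
  have hint : ∀ i, Integrable (fun θ => c i * character (k i - m) θ) (volume.restrict S) :=
    fun i => (integrable_character (k i - m)).const_mul (c i)
  have hnorm : ∀ i, ∫ θ in S, ‖c i * character (k i - m) θ‖ = ‖c i‖ * (volume.real S) := by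
    intro i
    simp [norm_character, mul_comm]
  have hsum : Summable fun i => ∫ θ in S, ‖c i * character (k i - m) θ‖ := by
    simp only [hnorm]
    exact (summable_norm_of_weighted hγ h1).mul_right _
  have h4 : ∫ θ in S, f θ * Complex.exp (-(Complex.I * (pair m θ : ℂ))) =
      ∑' i, if k i = m then c i * (2 * (Real.pi : ℂ)) ^ n else 0 := by
    have h5 : ∀ θ, f θ * Complex.exp (-(Complex.I * (pair m θ : ℂ))) =
        ∑' i, c i * character (k i - m) θ := by
      intro θ
      have : Complex.exp (-(Complex.I * (pair m θ : ℂ))) = character (-m) θ := by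
        rw [character, pair_neg]; simp
      rw [h3, this, ← tsum_mul_right]
      refine tsum_congr fun i => ?_
      rw [sub_eq_add_neg, character_add]; ring
    simp only [h5]
    rw [← integral_tsum_of_summable_integral_norm hint hsum]
    refine tsum_congr fun i => ?_
    rw [integral_const_mul, integral_character]
    simp only [sub_eq_zero]
    split_ifs <;> simp
  have h6 : fourierCoef f m = ∑' i, if k i = m then c i else 0 := by
    rw [fourierCoef, h4, ← tsum_mul_left]
    refine tsum_congr fun i => ?_
    split_ifs
    · field_simp
    · simp
  have h7 : ∀ i, ‖(if k i = m then c i else 0 : ℂ)‖ ≤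
      ‖c i‖ * gevreyWeight γ s (k i) * Real.exp (-(γ * len m ^ s)) := by
    intro i
    by_cases hi : k i = m
    · rw [if_pos hi, hi, mul_assoc, gevreyWeight, ← Real.exp_add]; simp
    · rw [if_neg hi, norm_zero]
      exact mul_nonneg (mul_nonneg (norm_nonneg _) (gevreyWeight_pos _ _ _).le) (Real.exp_nonneg _)
  have h8 := h1.mul_right (Real.exp (-(γ * len m ^ s)))
  rw [h6]
  refine (tsum_of_norm_bounded h8.hasSum h7).trans ?_
  rw [tsum_mul_right]
  exact mul_le_mul_of_nonneg_right h2 (Real.exp_nonneg _)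

theorem fourierCoef_conj {n : ℕ} (f : (Fin n → ℝ) → ℂ) (m : Lattice n) :
    fourierCoef (fun θ => (starRingEnd ℂ) (f θ)) m = (starRingEnd ℂ) (fourierCoef f (-m)) := by
  rw [fourierCoef, fourierCoef, map_mul, ← integral_conj]
  congr 1
  · simp [Complex.conj_ofNat]
  · congr 1
    funext θ
    rw [map_mul, ← Complex.exp_conj, pair_neg]
    simp

/-! ### Polynomials along a torus -/

/-- Series of finite weighted norm form a Banach algebra that is closed under conjugation, so it
contains all polynomials in `z` and `z̄`; the constants do not depend on the weight. -/
theorem exists_evalTorus_expansion {n : ℕ} (P : MvPolynomial (Fin n ⊕ Fin n) ℂ) :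
    ∃ C : ℝ, ∃ d : ℕ, 0 ≤ C ∧ ∀ (γ s W : ℝ) (z : Lattice n → Vec n), 0 ≤ γ → 0 < s → s ≤ 1 → 1 ≤ W →
      (∀ j, HasExpansion γ s (fun θ => torusFun z θ j) W) →
        HasExpansion γ s (evalTorus z P) (C * W ^ d) := by
  induction P using MvPolynomial.induction_on with
  | C a =>
    refine ⟨‖a‖, 0, norm_nonneg _, fun γ s W z _ hs _ _ _ => ?_⟩
    have : evalTorus z (MvPolynomial.C a) = fun _ => a := by
      funext θ; simp [evalTorus]
    rw [this, pow_zero, mul_one]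
    exact HasExpansion.const hs a
  | add P Q hP hQ =>
    obtain ⟨C, d, hC, h⟩ := hP
    obtain ⟨C', d', hC', h'⟩ := hQ
    refine ⟨C + C', max d d', add_nonneg hC hC', fun γ s W z hγ hs hs1 hW hz => ?_⟩
    have e : evalTorus z (P + Q) = fun θ => evalTorus z P θ + evalTorus z Q θ := by
      funext θ; simp [evalTorus]
    rw [e]
    refine ((h γ s W z hγ hs hs1 hW hz).add hγ (h' γ s W z hγ hs hs1 hW hz)).mono ?_
    rw [add_mul]
    exact add_le_add (mul_le_mul_of_nonneg_left (pow_le_pow_right₀ hW (le_max_left _ _)) hC)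
      (mul_le_mul_of_nonneg_left (pow_le_pow_right₀ hW (le_max_right _ _)) hC')
  | mul_X P a hP =>
    obtain ⟨C, d, hC, h⟩ := hP
    refine ⟨C, d + 1, hC, fun γ s W z hγ hs hs1 hW hz => ?_⟩
    rw [pow_succ, ← mul_assoc]
    cases a with
    | inl j =>
      have e : evalTorus z (P * MvPolynomial.X (Sum.inl j)) =
          fun θ => evalTorus z P θ * torusFun z θ j := by
        funext θ; simp [evalTorus]
      rw [e]
      exact (h γ s W z hγ hs hs1 hW hz).mul hγ hs.le hs1 (hz j)
    | inr j =>
      have e : evalTorus z (P * MvPolynomial.X (Sum.inr j)) =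
          fun θ => evalTorus z P θ * (starRingEnd ℂ) (torusFun z θ j) := by
        funext θ; simp [evalTorus]
      rw [e]
      exact (h γ s W z hγ hs hs1 hW hz).mul hγ hs.le hs1 (hz j).conj

/-! ### The lattice sum that controls the constants -/

/-- `∑_k (1 + |k|) exp(-(1-γ)|k|^s)`. -/
noncomputable def latticeSum (n : ℕ) (γ s : ℝ) : ℝ :=
  ∑' k : Lattice n, (1 + len k) * Real.exp (-((1 - γ) * len k ^ s))

theorem summable_one_add_len_inv (n : ℕ) :
    Summable fun k : Lattice n => ((1 + len k) ^ (2 * n))⁻¹ := by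
  have h1 : Summable fun m : ℤ => ((1 + |(m : ℝ)|) ^ 2)⁻¹ := by
    have h0 : Summable fun m : ℕ => ((1 + (m : ℝ)) ^ 2)⁻¹ := by
      have := (summable_nat_add_iff 1).2 (Real.summable_nat_pow_inv.2 (one_lt_two))
      refine this.congr fun m => ?_
      push_cast; rw [add_comm]
    refine Summable.of_nat_of_neg ?_ ?_
    · simpa using h0
    · simpa using h0
  set S := ∑' m : ℤ, ((1 + |(m : ℝ)|) ^ 2)⁻¹ with hS
  have hS0 : 0 ≤ S := tsum_nonneg fun _ => by positivity
  refine summable_of_sum_le (c := S ^ n) (fun k => inv_nonneg.2 (pow_nonneg (by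
    linarith [len_nonneg k]) _)) fun u => ?_
  have hle : ∀ k : Lattice n, ((1 + len k) ^ (2 * n))⁻¹ ≤ ∏ i, ((1 + |(k i : ℝ)|) ^ 2)⁻¹ := by
    intro k
    rw [Finset.prod_inv_distrib]
    refine inv_anti₀ (Finset.prod_pos fun i _ => by positivity) ?_
    calc ∏ i, (1 + |(k i : ℝ)|) ^ 2 ≤ ∏ _i : Fin n, (1 + len k) ^ 2 :=
          Finset.prod_le_prod (fun i _ => by positivity) fun i _ =>
            pow_le_pow_left₀ (by positivity) (by linarith [abs_le_len k i]) 2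
      _ = _ := by rw [Finset.prod_const, Finset.card_univ, Fintype.card_fin, ← pow_mul]
  classical
  set t : Fin n → Finset ℤ := fun i => u.image fun k => k i with ht
  have hsub : u ⊆ Fintype.piFinset t := fun k hk =>
    Fintype.mem_piFinset.2 fun i => Finset.mem_image_of_mem _ hk
  calc ∑ k ∈ u, ((1 + len k) ^ (2 * n))⁻¹ ≤ ∑ k ∈ u, ∏ i, ((1 + |(k i : ℝ)|) ^ 2)⁻¹ :=
        Finset.sum_le_sum fun k _ => hle k
    _ ≤ ∑ k ∈ Fintype.piFinset t, ∏ i, ((1 + |(k i : ℝ)|) ^ 2)⁻¹ :=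
        Finset.sum_le_sum_of_subset_of_nonneg hsub fun k _ _ =>
          Finset.prod_nonneg fun i _ => by positivity
    _ = ∏ i, ∑ m ∈ t i, ((1 + |(m : ℝ)|) ^ 2)⁻¹ :=
        (Finset.prod_univ_sum t fun _ m => ((1 + |(m : ℝ)|) ^ 2)⁻¹).symm
    _ ≤ ∏ _i : Fin n, S := Finset.prod_le_prod
        (fun i _ => Finset.sum_nonneg fun _ _ => by positivity)
        fun i _ => h1.sum_le_tsum _ fun _ _ => by positivity
    _ = S ^ n := by simp

/-- Each term of the lattice sum is small against a power of `1 + |k|`; the power `q` of the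
exponential series that gives this has to exceed `(2n + 1)/s`. -/
theorem latticeSum_term_le {n : ℕ} {γ s : ℝ} (hγ1 : γ < 1) (hs : 0 < s) (hs1 : s ≤ 1)
    (q : ℕ) (hq : 2 * (n : ℝ) + 1 ≤ s * q) (k : Lattice n) :
    (1 + len k) * Real.exp (-((1 - γ) * len k ^ s)) ≤
      Real.exp (1 - γ) * (q.factorial / (1 - γ) ^ q) * ((1 + len k) ^ (2 * n))⁻¹ := by
  set g := 1 - γ with hg
  have hg0 : 0 < g := by rw [hg]; linarith
  set x := 1 + len k with hx
  have hx1 : 1 ≤ x := by rw [hx]; linarith [len_nonneg k]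
  have hx0 : 0 < x := by linarith
  have h1 : x ^ s ≤ 1 + len k ^ s := by
    have := rpow_add_le zero_le_one (len_nonneg k) hs.le hs1
    rwa [Real.one_rpow] at this
  have h2 : (g * x ^ s) ^ q / q.factorial ≤ Real.exp (g * x ^ s) :=
    Real.pow_div_factorial_le_exp _ (by positivity) q
  have h3 : x * x ^ (2 * n) ≤ (x ^ s) ^ q := by
    rw [← pow_succ', ← Real.rpow_natCast, ← Real.rpow_natCast (x ^ s), ← Real.rpow_mul hx0.le]
    refine Real.rpow_le_rpow_of_exponent_le hx1 ?_
    push_cast; exact hq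
  have h4 : Real.exp (-(g * len k ^ s)) ≤ Real.exp g * (Real.exp (g * x ^ s))⁻¹ := by
    rw [← Real.exp_neg, ← Real.exp_add]
    refine Real.exp_le_exp.2 ?_
    nlinarith
  have h5 : (Real.exp (g * x ^ s))⁻¹ ≤ q.factorial / g ^ q * (x * x ^ (2 * n))⁻¹ := by
    have hpos : 0 < (g * x ^ s) ^ q / (q.factorial : ℝ) := by positivity
    refine (inv_anti₀ hpos h2).trans ?_
    rw [inv_div, mul_pow, div_mul_eq_div_div, div_eq_mul_inv (_ / _)]
    exact mul_le_mul_of_nonneg_left (inv_anti₀ (by positivity) h3) (by positivity)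
  calc x * Real.exp (-(g * len k ^ s))
      ≤ x * (Real.exp g * (q.factorial / g ^ q * (x * x ^ (2 * n))⁻¹)) :=
        mul_le_mul_of_nonneg_left (h4.trans (mul_le_mul_of_nonneg_left h5 (Real.exp_nonneg _)))
          hx0.le
    _ = _ := by rw [mul_inv]; field_simp

theorem summable_latticeSum (n : ℕ) {γ s : ℝ} (hγ1 : γ < 1) (hs : 0 < s) (hs1 : s ≤ 1) :
    Summable fun k : Lattice n => (1 + len k) * Real.exp (-((1 - γ) * len k ^ s)) := by
  obtain ⟨q, hq⟩ := exists_nat_ge ((2 * (n : ℝ) + 1) / s)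
  rw [div_le_iff₀ hs, mul_comm _ s] at hq
  exact ((summable_one_add_len_inv n).mul_left _).of_nonneg_of_le
    (fun k => mul_nonneg (by linarith [len_nonneg k]) (Real.exp_nonneg _))
    (latticeSum_term_le hγ1 hs hs1 q hq)

theorem latticeSum_le (n : ℕ) {γ s : ℝ} (hγ1 : γ < 1) (hs : 0 < s) (hs1 : s ≤ 1)
    (q : ℕ) (hq : 2 * (n : ℝ) + 1 ≤ s * q) :
    latticeSum n γ s ≤ Real.exp (1 - γ) * (q.factorial / (1 - γ) ^ q) *
      ∑' k : Lattice n, ((1 + len k) ^ (2 * n))⁻¹ := by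
  rw [latticeSum, ← tsum_mul_left]
  exact (summable_latticeSum n hγ1 hs hs1).tsum_le_tsum (latticeSum_term_le hγ1 hs hs1 q hq)
    ((summable_one_add_len_inv n).mul_left _)

theorem le_latticeSum {n : ℕ} {γ s : ℝ} (hγ1 : γ < 1) (hs : 0 < s) (hs1 : s ≤ 1) (k : Lattice n) :
    (1 + len k) * Real.exp (-((1 - γ) * len k ^ s)) ≤ latticeSum n γ s :=
  (summable_latticeSum n hγ1 hs hs1).le_tsum k fun l _ =>
    mul_nonneg (by linarith [len_nonneg l]) (Real.exp_nonneg _)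

theorem one_le_latticeSum {n : ℕ} {γ s : ℝ} (hγ1 : γ < 1) (hs : 0 < s) (hs1 : s ≤ 1) :
    1 ≤ latticeSum n γ s := by
  have := le_latticeSum hγ1 hs hs1 (0 : Lattice n)
  simpa [len_zero, Real.zero_rpow hs.ne'] using this

/-- Giving up a part `1 - γ` of the decay rate makes the Fourier series of `z_j` summable with the
weight `exp(γ |k|^s)`. -/
theorem torusFun_expansion {n : ℕ} {γ s : ℝ} (hγ1 : γ < 1) (hs : 0 < s) (hs1 : s ≤ 1)
    (z : Lattice n → Vec n) (hz : ∀ k, ‖z k‖ ≤ Real.exp (-(len k ^ s))) (j : Fin n) :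
    HasExpansion γ s (fun θ => torusFun z θ j) (latticeSum n γ s) := by
  have hle : ∀ k, ‖((z k j : ℝ) : ℂ)‖ * gevreyWeight γ s k ≤
      (1 + len k) * Real.exp (-((1 - γ) * len k ^ s)) := by
    intro k
    have h1 : ‖((z k j : ℝ) : ℂ)‖ ≤ Real.exp (-(len k ^ s)) := by
      rw [Complex.norm_real]
      exact (PiLp.norm_apply_le (z k) j).trans (hz k)
    calc _ ≤ Real.exp (-(len k ^ s)) * gevreyWeight γ s k :=
          mul_le_mul_of_nonneg_right h1 (gevreyWeight_pos _ _ _).le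
      _ = 1 * Real.exp (-((1 - γ) * len k ^ s)) := by
          rw [gevreyWeight, ← Real.exp_add, one_mul]; ring_nf
      _ ≤ _ := mul_le_mul_of_nonneg_right (by linarith [len_nonneg k]) (Real.exp_nonneg _)
  have hsum := (summable_latticeSum n hγ1 hs hs1).of_nonneg_of_le
    (fun k => mul_nonneg (norm_nonneg _) (gevreyWeight_pos _ _ _).le) hle
  exact ⟨Lattice n, inferInstance, fun k => ((z k j : ℝ) : ℂ), id, hsum,
    hsum.tsum_le_tsum hle (summable_latticeSum n hγ1 hs hs1), fun θ => rfl⟩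

/-! ### Off-side boxes -/

theorem mem_box_iff {n : ℕ} {k₀ k : Lattice n} {N : ℕ} :
    k ∈ box k₀ N ↔ ∀ i, |k i - k₀ i| ≤ (N : ℤ) := by
  rw [box, Finset.mem_Icc, Pi.le_def, Pi.le_def, ← forall_and]
  refine forall_congr' fun i => ?_
  rw [abs_le]; constructor <;> intro h <;> constructor <;> linarith [h.1, h.2]

/-- Two points of an off-side box share a coordinate in which they are far from zero, on the same
side of it. -/
theorem OffSide.exists_coord {n : ℕ} {k₀ : Lattice n} {N : ℕ} (h : OffSide k₀ N) :
    ∃ i, ∀ k ∈ box k₀ N, ∀ l ∈ box k₀ N,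
      (N : ℝ) ≤ |(k i : ℝ)| ∧ 2 * (N : ℝ) + |(k i : ℝ) - l i| ≤ |(k i : ℝ) + l i| := by
  unfold OffSide InBox at h
  push Not at h
  obtain ⟨i, hi⟩ := h
  refine ⟨i, fun k hk l hl => ?_⟩
  have a1 : |(k i : ℝ) - k₀ i| ≤ N := by exact_mod_cast mem_box_iff.1 hk i
  have a2 : |(l i : ℝ) - k₀ i| ≤ N := by exact_mod_cast mem_box_iff.1 hl i
  rw [abs_le] at a1 a2
  rcases lt_abs.1 hi with h1 | h1
  · rw [abs_of_nonneg (a := (k i : ℝ)) (by linarith),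
      abs_of_nonneg (a := (k i : ℝ) + l i) (by linarith)]
    refine ⟨by linarith, ?_⟩
    have : |(k i : ℝ) - l i| ≤ (k i : ℝ) + l i - 2 * N := abs_le.2 ⟨by linarith, by linarith⟩
    linarith
  · rw [abs_of_nonpos (a := (k i : ℝ)) (by linarith),
      abs_of_nonpos (a := (k i : ℝ) + l i) (by linarith)]
    refine ⟨by linarith, ?_⟩
    have : |(k i : ℝ) - l i| ≤ -((k i : ℝ) + l i) - 2 * N := abs_le.2 ⟨by linarith, by linarith⟩
    linarith

theorem OffSide.le_len {n : ℕ} {k₀ : Lattice n} {N : ℕ} (h : OffSide k₀ N) {k : Lattice n}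
    (hk : k ∈ box k₀ N) : (N : ℝ) ≤ len k := by
  obtain ⟨i, hi⟩ := h.exists_coord
  exact (hi k hk k hk).1.trans (abs_le_len k i)

theorem OffSide.two_mul_le_len_add {n : ℕ} {k₀ : Lattice n} {N : ℕ} (h : OffSide k₀ N)
    {k l : Lattice n} (hk : k ∈ box k₀ N) (hl : l ∈ box k₀ N) : 2 * (N : ℝ) ≤ len (k + l) := by
  obtain ⟨i, hi⟩ := h.exists_coord
  have h1 := (hi k hk l hl).2
  have h2 := abs_le_len (k + l) i
  rw [Pi.add_apply, Int.cast_add] at h2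
  linarith [abs_nonneg ((k i : ℝ) - l i)]

/-- One coordinate of `k + k'` exceeds that of `k - k'` by `2N`, while the other `n - 1` coordinates of
`k - k'` are at most `2N` each. -/
theorem OffSide.len_sub_le {n : ℕ} {k₀ : Lattice n} {N : ℕ} (h : OffSide k₀ N)
    {k l : Lattice n} (hk : k ∈ box k₀ N) (hl : l ∈ box k₀ N) :
    len (k - l) ≤ max 1 ((n : ℝ) - 1) * len (k + l) := by
  obtain ⟨i, hi⟩ := h.exists_coord
  have h1 := (hi k hk l hl).2
  have h2 := abs_le_len (k + l) i
  rw [Pi.add_apply, Int.cast_add] at h2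
  have h3 : len (k - l) ≤ |(k i : ℝ) - l i| + ((n : ℝ) - 1) * (2 * N) := by
    rw [len, ← Finset.add_sum_erase _ _ (Finset.mem_univ i)]
    refine add_le_add (by simp) ?_
    have h4 : ∀ j ∈ Finset.univ.erase i, |(((k - l) j : ℤ) : ℝ)| ≤ 2 * N := by
      intro j _
      have a1 : |(k j : ℝ) - k₀ j| ≤ N := by exact_mod_cast mem_box_iff.1 hk j
      have a2 : |(l j : ℝ) - k₀ j| ≤ N := by exact_mod_cast mem_box_iff.1 hl j
      rw [abs_le] at a1 a2
      rw [Pi.sub_apply, Int.cast_sub]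
      exact abs_le.2 ⟨by linarith, by linarith⟩
    refine (Finset.sum_le_card_nsmul _ _ _ h4).trans (le_of_eq ?_)
    have hn : 1 ≤ n := Nat.one_le_iff_ne_zero.2 (by rintro rfl; exact i.elim0)
    rw [Finset.card_erase_of_mem (Finset.mem_univ i), Finset.card_univ, Fintype.card_fin,
      nsmul_eq_mul, Nat.cast_sub hn, Nat.cast_one]
  set m := max 1 ((n : ℝ) - 1) with hm
  have hm1 : 1 ≤ m := le_max_left _ _
  have hm2 : (n : ℝ) - 1 ≤ m := le_max_right _ _
  have hN : (0 : ℝ) ≤ 2 * N := by positivity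
  calc len (k - l) ≤ |(k i : ℝ) - l i| + ((n : ℝ) - 1) * (2 * N) := h3
    _ ≤ m * |(k i : ℝ) - l i| + m * (2 * N) :=
        add_le_add (le_mul_of_one_le_left (abs_nonneg _) hm1) (mul_le_mul_of_nonneg_right hm2 hN)
    _ = m * (2 * N + |(k i : ℝ) - l i|) := by ring
    _ ≤ m * len (k + l) := mul_le_mul_of_nonneg_left (h1.trans h2) (by linarith)

/-! ### Decay of the entries of the operator -/

/-- The kernels are Fourier coefficients of polynomials along the torus, hence inherit the weight. -/
theorem exists_kernel_bound {n : ℕ} (h : Coeffs n) :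
    ∃ C : ℝ, ∃ d : ℕ, 0 ≤ C ∧ ∀ (γ s : ℝ) (z : Lattice n → Vec n), 0 ≤ γ → γ < 1 → 0 < s → s ≤ 1 →
      (∀ k, ‖z k‖ ≤ Real.exp (-(len k ^ s))) → ∀ m i j,
        ‖kernelT h z m i j‖ ≤ C * latticeSum n γ s ^ d * Real.exp (-(γ * len m ^ s)) ∧
        ‖kernelH h z m i j‖ ≤ C * latticeSum n γ s ^ d * Real.exp (-(γ * len m ^ s)) := by
  choose C d hC hP using fun x : (Fin n ⊕ Fin n) × Fin n =>
    exists_evalTorus_expansion (MvPolynomial.pderiv x.1 (field h x.2))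
  refine ⟨∑ x, C x, ∑ x, d x, Finset.sum_nonneg fun x _ => hC x,
    fun γ s z hγ hγ1 hs hs1 hz m i j => ?_⟩
  have hW := one_le_latticeSum (n := n) hγ1 hs hs1
  have key : ∀ x : (Fin n ⊕ Fin n) × Fin n,
      ‖fourierCoef (evalTorus z (MvPolynomial.pderiv x.1 (field h x.2))) m‖ ≤
        (∑ x, C x) * latticeSum n γ s ^ (∑ x, d x) * Real.exp (-(γ * len m ^ s)) := by
    intro x
    refine (norm_fourierCoef_le hγ (hP x γ s _ z hγ hs hs1 hW
      fun j => torusFun_expansion hγ1 hs hs1 z hz j) m).trans ?_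
    refine mul_le_mul_of_nonneg_right (mul_le_mul ?_ ?_ (by positivity) ?_) (Real.exp_nonneg _)
    · exact Finset.single_le_sum (f := C) (fun y _ => hC y) (Finset.mem_univ x)
    · exact pow_le_pow_right₀ hW
        (Finset.single_le_sum (f := d) (fun y _ => Nat.zero_le _) (Finset.mem_univ x))
    · exact Finset.sum_nonneg fun x _ => hC x
  exact ⟨key (Sum.inl j, i), key (Sum.inr j, i)⟩

/-- The factor `ẑ(k)` gives the decay in `k`, and the derivative of `X̂_l(e_l)` at `ẑ(k')` the decay in
`k'`, as `|e_l| = 1`. -/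
theorem norm_opB_le {n : ℕ} (h : Coeffs n) {γ s K : ℝ} (z : Lattice n → Vec n) (hγ : 0 ≤ γ)
    (hγ1 : γ < 1) (hs : 0 < s) (hs1 : s ≤ 1) (hK0 : 0 ≤ K)
    (hz : ∀ k, ‖z k‖ ≤ Real.exp (-(len k ^ s)))
    (hK : ∀ m i j, ‖kernelT h z m i j‖ ≤ K * Real.exp (-(γ * len m ^ s)) ∧
        ‖kernelH h z m i j‖ ≤ K * Real.exp (-(γ * len m ^ s)))
    (k : Lattice n) (i : Fin n) (k' : Lattice n) (j : Fin n) :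
    ‖opB h z k i k' j‖ ≤
      6 * K * latticeSum n γ s * Real.exp (-(γ * (len k ^ s + len k' ^ s))) := by
  have hexp : ∀ m : Lattice n, len k' ≤ 1 + len m →
      Real.exp (-(γ * len m ^ s)) ≤ 3 * Real.exp (-(γ * len k' ^ s)) := by
    intro m hm
    have h1 : len k' ^ s ≤ 1 + len m ^ s := by
      have := (Real.rpow_le_rpow (len_nonneg _) hm hs.le).trans
        (rpow_add_le zero_le_one (len_nonneg m) hs.le hs1)
      rwa [Real.one_rpow] at this
    have h2 : Real.exp 1 ≤ 3 := by linarith [Real.exp_one_lt_d9]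
    calc _ ≤ Real.exp (1 + -(γ * len k' ^ s)) := Real.exp_le_exp.2 (by nlinarith)
      _ = Real.exp 1 * Real.exp (-(γ * len k' ^ s)) := Real.exp_add _ _
      _ ≤ _ := mul_le_mul_of_nonneg_right h2 (Real.exp_nonneg _)
  have htan : ∀ l, ‖tangent h z (basisVec l) l k' j‖ ≤ 6 * K * Real.exp (-(γ * len k' ^ s)) := by
    intro l
    have h1 : len k' ≤ 1 + len (basisVec l - k') := by
      have := len_add_le (basisVec l) (-(basisVec l - k'))
      rw [len_neg, len_basisVec] at this
      simpa using this
    have h2 : len k' ≤ 1 + len (basisVec l + k') := by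
      have := len_add_le (-basisVec l) (basisVec l + k')
      rw [len_neg, len_basisVec] at this
      simpa using this
    have h3 := (hK (basisVec l - k') l j).1.trans (mul_le_mul_of_nonneg_left (hexp _ h1) hK0)
    have h4 := (hK (basisVec l + k') l j).2.trans (mul_le_mul_of_nonneg_left (hexp _ h2) hK0)
    rw [tangent]
    refine (norm_add_le _ _).trans ?_
    linarith
  have hz' : ‖((Real.exp (-1) * z k i : ℝ) : ℂ)‖ ≤ Real.exp (-(len k ^ s)) := by
    rw [Complex.norm_real, norm_mul, Real.norm_eq_abs, Real.abs_exp]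
    calc _ ≤ 1 * ‖z k i‖ := mul_le_mul_of_nonneg_right
          (Real.exp_le_one_iff.2 (by norm_num)) (norm_nonneg _)
      _ ≤ _ := by rw [one_mul]; exact (PiLp.norm_apply_le (z k) i).trans (hz k)
  have hsum : ‖∑ l, (k l : ℂ) * tangent h z (basisVec l) l k' j‖ ≤
      len k * (6 * K * Real.exp (-(γ * len k' ^ s))) := by
    refine (norm_sum_le _ _).trans ?_
    rw [len, Finset.sum_mul]
    refine Finset.sum_le_sum fun l _ => ?_
    rw [norm_mul, Complex.norm_intCast]
    exact mul_le_mul_of_nonneg_left (htan l) (abs_nonneg _)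
  rw [opB, norm_mul, norm_neg]
  have hW : len k * Real.exp (-(len k ^ s)) ≤ latticeSum n γ s * Real.exp (-(γ * len k ^ s)) := by
    have h1 : len k * Real.exp (-((1 - γ) * len k ^ s)) ≤ latticeSum n γ s :=
      (mul_le_mul_of_nonneg_right (by linarith) (Real.exp_nonneg _)).trans
        (le_latticeSum hγ1 hs hs1 k)
    calc _ = len k * Real.exp (-((1 - γ) * len k ^ s)) * Real.exp (-(γ * len k ^ s)) := by
          rw [mul_assoc, ← Real.exp_add]; ring_nf
      _ ≤ _ := mul_le_mul_of_nonneg_right h1 (Real.exp_nonneg _)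
  calc _ ≤ Real.exp (-(len k ^ s)) * (len k * (6 * K * Real.exp (-(γ * len k' ^ s)))) :=
        mul_le_mul hz' hsum (norm_nonneg _) (Real.exp_nonneg _)
    _ = (len k * Real.exp (-(len k ^ s))) * (6 * K * Real.exp (-(γ * len k' ^ s))) := by ring
    _ ≤ (latticeSum n γ s * Real.exp (-(γ * len k ^ s))) *
          (6 * K * Real.exp (-(γ * len k' ^ s))) :=
        mul_le_mul_of_nonneg_right hW (by positivity)
    _ = 6 * K * latticeSum n γ s *
          (Real.exp (-(γ * len k ^ s)) * Real.exp (-(γ * len k' ^ s))) := by ring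
    _ = _ := by rw [← Real.exp_add]; ring_nf

/-- In an off-side box the perturbation `S + B` decays off the diagonal at the rate `γ/ρ`, the loss
`ρ` being due to the Hankel part, and all of it except the Toeplitz part is small. -/
theorem exists_entry_bound {n : ℕ} (h : Coeffs n) :
    ∃ C : ℝ, ∃ d : ℕ, 0 ≤ C ∧ ∀ (γ s ρ : ℝ) (z : Lattice n → Vec n), 0 ≤ γ → γ < 1 → 0 < s → s ≤ 1 →
      1 ≤ ρ → max 1 ((n : ℝ) - 1) ^ s ≤ ρ → (∀ k, ‖z k‖ ≤ Real.exp (-(len k ^ s))) →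
      ∀ (k₀ : Lattice n) (N : ℕ), OffSide k₀ N → ∀ k ∈ box k₀ N, ∀ k' ∈ box k₀ N, ∀ i j,
        ‖tangent h z k i k' j + opB h z k i k' j‖ ≤
          C * latticeSum n γ s ^ d * Real.exp (-(γ / ρ * len (k - k') ^ s)) ∧
        ‖kernelH h z (k + k') i j + opB h z k i k' j‖ ≤
          C * latticeSum n γ s ^ d * Real.exp (-(γ * (N : ℝ) ^ s)) := by
  obtain ⟨C, d, hC, hK⟩ := exists_kernel_bound h
  refine ⟨8 * C, d + 1, by positivity, fun γ s ρ z hγ hγ1 hs hs1 hρ hρm hz k₀ N hoff k hk k' hk' i j =>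
    ?_⟩
  have hW := one_le_latticeSum (n := n) hγ1 hs hs1
  set W := latticeSum n γ s with hWdef
  have hK' := hK γ s z hγ hγ1 hs hs1 hz
  have hK0 : 0 ≤ C * W ^ d := by positivity
  have hB := norm_opB_le h z hγ hγ1 hs hs1 hK0 hz hK' k i k' j
  have hT := (hK' (k - k') i j).1
  have hH := (hK' (k + k') i j).2
  have hd0 := len_nonneg (k - k')
  have hs0 := len_nonneg (k + k')
  have hgρ : γ / ρ ≤ γ := div_le_self hγ hρ
  have hsub : len (k - k') ^ s ≤ len k ^ s + len k' ^ s := by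
    refine (Real.rpow_le_rpow hd0 ?_ hs.le).trans (rpow_add_le (len_nonneg _) (len_nonneg _) hs.le hs1)
    have := len_add_le k (-k')
    rwa [len_neg, ← sub_eq_add_neg] at this
  have hhank : len (k - k') ^ s ≤ ρ * len (k + k') ^ s := by
    calc _ ≤ (max 1 ((n : ℝ) - 1) * len (k + k')) ^ s :=
          Real.rpow_le_rpow hd0 (hoff.len_sub_le hk hk') hs.le
      _ = max 1 ((n : ℝ) - 1) ^ s * len (k + k') ^ s :=
          Real.mul_rpow (le_trans zero_le_one (le_max_left _ _)) hs0
      _ ≤ _ := mul_le_mul_of_nonneg_right hρm (Real.rpow_nonneg hs0 s)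
  have hhank' : γ / ρ * len (k - k') ^ s ≤ γ * len (k + k') ^ s := by
    rw [div_mul_eq_mul_div, div_le_iff₀ (by linarith)]
    nlinarith
  have hds0 : 0 ≤ len (k - k') ^ s := Real.rpow_nonneg hd0 s
  have hNs : (N : ℝ) ^ s ≤ len (k + k') ^ s := by
    refine Real.rpow_le_rpow (Nat.cast_nonneg _) ?_ hs.le
    linarith [hoff.two_mul_le_len_add hk hk', Nat.cast_nonneg (α := ℝ) N]
  have hNk : (N : ℝ) ^ s ≤ len k ^ s + len k' ^ s := by
    have := Real.rpow_le_rpow (Nat.cast_nonneg _) (hoff.le_len hk) hs.le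
    linarith [Real.rpow_nonneg (len_nonneg k') s]
  have combine : ∀ E : ℝ, 0 ≤ E → C * W ^ d * E + C * W ^ d * E + 6 * (C * W ^ d) * W * E ≤
      8 * C * W ^ (d + 1) * E := by
    intro E hE
    have : C * W ^ d * E ≤ C * W ^ d * E * W := le_mul_of_one_le_right (by positivity) hW
    rw [pow_succ]; nlinarith
  constructor
  · set E := Real.exp (-(γ / ρ * len (k - k') ^ s)) with hE
    refine le_trans ?_ (combine E (Real.exp_nonneg _))
    rw [tangent]
    refine (norm_add_le _ _).trans (add_le_add ((norm_add_le _ _).trans (add_le_add ?_ ?_)) ?_)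
    · refine hT.trans (mul_le_mul_of_nonneg_left (Real.exp_le_exp.2 ?_) hK0)
      have := mul_le_mul_of_nonneg_right hgρ hds0
      linarith
    · refine hH.trans (mul_le_mul_of_nonneg_left (Real.exp_le_exp.2 ?_) hK0)
      linarith
    · refine hB.trans (mul_le_mul_of_nonneg_left (Real.exp_le_exp.2 ?_) (by positivity))
      have h1 := mul_le_mul_of_nonneg_right hgρ hds0
      have h2 := mul_le_mul_of_nonneg_left hsub hγ
      linarith
  · set E := Real.exp (-(γ * (N : ℝ) ^ s)) with hE
    have hE0 : 0 ≤ E := Real.exp_nonneg _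
    refine le_trans ?_ (combine E hE0)
    refine (norm_add_le _ _).trans (add_le_add ?_ ?_)
    · refine (hH.trans (mul_le_mul_of_nonneg_left (Real.exp_le_exp.2 ?_) hK0)).trans
        (le_add_of_nonneg_left (by positivity))
      have := mul_le_mul_of_nonneg_left hNs hγ
      linarith
    · refine hB.trans (mul_le_mul_of_nonneg_left (Real.exp_le_exp.2 ?_) (by positivity))
      have := mul_le_mul_of_nonneg_left hNk hγ
      linarith

/-! ### Spectral norms -/

theorem norm_entry_le_specNorm {ι : Type*} [Fintype ι] [DecidableEq ι] (A : Matrix ι ι ℂ) (i j : ι) :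
    ‖A i j‖ ≤ specNorm A := by
  have h1 := (Matrix.toEuclideanCLM (𝕜 := ℂ) A).le_opNorm (EuclideanSpace.single j 1)
  rw [PiLp.norm_single, norm_one, mul_one] at h1
  refine le_trans ?_ ((PiLp.norm_apply_le _ i).trans h1)
  rw [Matrix.ofLp_toEuclideanCLM]
  simp

theorem specNorm_le_of_norm_entry_le {ι : Type*} [Fintype ι] [DecidableEq ι] (A : Matrix ι ι ℂ)
    {r : ℝ} (hr : 0 ≤ r) (hA : ∀ i j, ‖A i j‖ ≤ r) : specNorm A ≤ (Fintype.card ι : ℝ) ^ 2 * r := by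
  refine ContinuousLinearMap.opNorm_le_bound _ (by positivity) fun v => ?_
  set w := Matrix.toEuclideanCLM (𝕜 := ℂ) A v with hw
  have h1 : ∀ i, ‖w i‖ ≤ Fintype.card ι * r * ‖v‖ := by
    intro i
    have e : w i = ∑ j, A i j * v j := by
      rw [hw, Matrix.ofLp_toEuclideanCLM]; rfl
    rw [e]
    refine (norm_sum_le _ _).trans ?_
    have : ∀ j ∈ Finset.univ, ‖A i j * v j‖ ≤ r * ‖v‖ := fun j _ => by
      rw [norm_mul]
      exact mul_le_mul (hA i j) (PiLp.norm_apply_le v j) (norm_nonneg _) hr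
    refine (Finset.sum_le_card_nsmul _ _ _ this).trans (le_of_eq ?_)
    rw [nsmul_eq_mul, Finset.card_univ, mul_assoc]
  have h2 : ‖w‖ ≤ ∑ i, ‖w i‖ := by
    rw [EuclideanSpace.norm_eq]
    refine Real.sqrt_le_iff.2 ⟨Finset.sum_nonneg fun _ _ => norm_nonneg _, ?_⟩
    exact Finset.sum_sq_le_sq_sum_of_nonneg fun _ _ => norm_nonneg _
  refine h2.trans ((Finset.sum_le_card_nsmul _ _ _ fun i _ => h1 i).trans (le_of_eq ?_))
  rw [nsmul_eq_mul, Finset.card_univ]; ring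

/-- A matrix bounded below by `δ` is invertible, with inverse bounded by `1/δ`. -/
theorem isUnit_and_specNorm_inv_le {ι : Type*} [Fintype ι] [DecidableEq ι] (A : Matrix ι ι ℂ)
    {δ : ℝ} (hδ : 0 < δ)
    (h : ∀ v : EuclideanSpace ℂ ι, δ * ‖v‖ ≤ ‖Matrix.toEuclideanCLM (𝕜 := ℂ) A v‖) :
    IsUnit A ∧ specNorm A⁻¹ ≤ 1 / δ := by
  have hu : IsUnit A := by
    rw [← Matrix.mulVec_injective_iff_isUnit]
    intro v w hvw
    have h1 := h (WithLp.toLp 2 (v - w))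
    rw [Matrix.toEuclideanCLM_toLp, Matrix.mulVec_sub] at h1
    have h2 : A.mulVec v - A.mulVec w = 0 := sub_eq_zero.2 hvw
    rw [h2, WithLp.toLp_zero, norm_zero] at h1
    have h3 : ‖WithLp.toLp 2 (v - w)‖ = 0 :=
      le_antisymm (nonpos_of_mul_nonpos_right h1 hδ) (norm_nonneg _)
    exact sub_eq_zero.1 (congrArg WithLp.ofLp (norm_eq_zero.1 h3))
  refine ⟨hu, ContinuousLinearMap.opNorm_le_bound _ (by positivity) fun v => ?_⟩
  have h1 := h (Matrix.toEuclideanCLM (𝕜 := ℂ) A⁻¹ v)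
  have h2 : Matrix.toEuclideanCLM (𝕜 := ℂ) A (Matrix.toEuclideanCLM (𝕜 := ℂ) A⁻¹ v) = v := by
    rw [← mul_apply_eq_comp, ← map_mul,
      Matrix.mul_nonsing_inv A ((Matrix.isUnit_iff_isUnit_det A).1 hu), map_one]
    rfl
  rw [h2] at h1
  rw [one_div, inv_mul_eq_div, le_div_iff₀ hδ]
  linarith

/-- A Hermitian matrix minus a scalar is bounded below by the distance of the scalar from the
spectrum. -/
theorem isHermitian_sub_lower_bound {ι : Type*} [Fintype ι] [DecidableEq ι] {A : Matrix ι ι ℂ}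
    (hA : A.IsHermitian) {σ δ : ℝ} (hδ : 0 ≤ δ) (h : ∀ i, δ ≤ |hA.eigenvalues i - σ|)
    (v : EuclideanSpace ℂ ι) :
    δ * ‖v‖ ≤ ‖Matrix.toEuclideanCLM (𝕜 := ℂ) (A - (σ : ℂ) • (1 : Matrix ι ι ℂ)) v‖ := by
  set b := hA.eigenvectorBasis with hb
  set F := Matrix.toEuclideanCLM (𝕜 := ℂ) (A - (σ : ℂ) • (1 : Matrix ι ι ℂ)) with hF
  have heig : ∀ i, F (b i) = ((hA.eigenvalues i - σ : ℝ) : ℂ) • b i := by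
    intro i
    have h1 := hA.mulVec_eigenvectorBasis i
    have h2 : Matrix.toEuclideanCLM (𝕜 := ℂ) A (b i) = ((hA.eigenvalues i : ℝ) : ℂ) • b i := by
      apply PiLp.ext
      intro j
      rw [Matrix.ofLp_toEuclideanCLM, h1]
      simp [hb]
    rw [hF, map_sub, map_smul, map_one, sub_apply, h2, smul_apply]
    rw [Complex.ofReal_sub, sub_smul]
    rfl
  have hexp : F v = ∑ i, (inner ℂ (b i) v * ((hA.eigenvalues i - σ : ℝ) : ℂ)) • b i := by
    conv_lhs => rw [← b.sum_repr' v]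
    rw [map_sum]
    refine Finset.sum_congr rfl fun i _ => ?_
    rw [map_smul, heig, smul_smul]
  have hinner : ∀ i, inner ℂ (b i) (F v) = inner ℂ (b i) v * ((hA.eigenvalues i - σ : ℝ) : ℂ) := by
    intro i
    rw [hexp, b.orthonormal.inner_right_fintype]
  refine (sq_le_sq₀ (by positivity) (norm_nonneg _)).1 ?_
  rw [mul_pow, ← b.sum_sq_norm_inner_right, ← b.sum_sq_norm_inner_right, Finset.mul_sum]
  refine Finset.sum_le_sum fun i _ => ?_
  rw [hinner, norm_mul, mul_pow, mul_comm, Complex.norm_real, Real.norm_eq_abs]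
  exact mul_le_mul_of_nonneg_left (pow_le_pow_left₀ hδ (h i) 2) (by positivity)

/-- A relabelling of the indices preserves lower bounds. -/
theorem lower_bound_of_submatrix {ι κ : Type*} [Fintype ι] [DecidableEq ι] [Fintype κ]
    [DecidableEq κ] (e : ι ≃ κ) (A : Matrix κ κ ℂ) {δ : ℝ}
    (h : ∀ v : EuclideanSpace ℂ ι,
      δ * ‖v‖ ≤ ‖Matrix.toEuclideanCLM (𝕜 := ℂ) (A.submatrix e e) v‖)
    (v : EuclideanSpace ℂ κ) : δ * ‖v‖ ≤ ‖Matrix.toEuclideanCLM (𝕜 := ℂ) A v‖ := by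
  have h1 := h (WithLp.toLp 2 (fun i => v (e i)))
  have h2 : ‖WithLp.toLp 2 (fun i => v (e i))‖ = ‖v‖ := by
    rw [EuclideanSpace.norm_eq, EuclideanSpace.norm_eq]
    congr 1
    exact e.sum_comp fun i => ‖v i‖ ^ 2
  have h3 : ‖Matrix.toEuclideanCLM (𝕜 := ℂ) (A.submatrix e e) (WithLp.toLp 2 (fun i => v (e i)))‖ =
      ‖Matrix.toEuclideanCLM (𝕜 := ℂ) A v‖ := by
    rw [EuclideanSpace.norm_eq, EuclideanSpace.norm_eq]
    congr 1
    rw [← e.sum_comp]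
    refine Finset.sum_congr rfl fun i _ => ?_
    rw [Matrix.ofLp_toEuclideanCLM, Matrix.ofLp_toEuclideanCLM]
    congr 2
    simp only [Matrix.mulVec, dotProduct, Matrix.submatrix_apply]
    exact e.sum_comp fun j => A (e i) j * v j
  rwa [h2, h3] at h1

/-! ### Symmetry of the Toeplitz part -/

theorem pderiv_comm {R σ : Type*} [CommRing R] (i j : σ) (P : MvPolynomial σ R) :
    MvPolynomial.pderiv i (MvPolynomial.pderiv j P) =
      MvPolynomial.pderiv j (MvPolynomial.pderiv i P) := by
  have h : ⁅(MvPolynomial.pderiv i : Derivation R (MvPolynomial σ R) (MvPolynomial σ R)),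
      (MvPolynomial.pderiv j : Derivation R (MvPolynomial σ R) (MvPolynomial σ R))⁆ = 0 := by
    classical
    refine MvPolynomial.derivation_ext (R := R) fun k => ?_
    rw [Derivation.commutator_apply, MvPolynomial.pderiv_X, MvPolynomial.pderiv_X]
    simp only [Pi.single_apply]
    split_ifs <;> simp
  have := congrArg (fun D : Derivation R (MvPolynomial σ R) (MvPolynomial σ R) => D P) h
  rw [Derivation.commutator_apply] at this
  exact sub_eq_zero.1 this

/-- Complex conjugation of polynomials in `z` and `z̄`: the coefficients are conjugated and the
variables `z_j` and `z̄_j` exchanged. -/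
noncomputable def conjPoly {n : ℕ} (P : MvPolynomial (Fin n ⊕ Fin n) ℂ) :
    MvPolynomial (Fin n ⊕ Fin n) ℂ :=
  MvPolynomial.rename Sum.swap (MvPolynomial.map (starRingEnd ℂ) P)

theorem conj_evalTorus {n : ℕ} (z : Lattice n → Vec n) (P : MvPolynomial (Fin n ⊕ Fin n) ℂ)
    (θ : Fin n → ℝ) : (starRingEnd ℂ) (evalTorus z P θ) = evalTorus z (conjPoly P) θ := by
  rw [evalTorus, evalTorus, conjPoly, MvPolynomial.map_eval, MvPolynomial.eval_rename]
  congr 2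
  funext x
  cases x <;> simp

theorem conjPoly_mono {n : ℕ} (α β : Fin n →₀ ℕ) : conjPoly (mono α β) = mono β α := by
  simp only [conjPoly, mono, map_mul, map_prod, map_pow, MvPolynomial.map_X,
    MvPolynomial.rename_X, Sum.swap_inl, Sum.swap_inr]
  exact mul_comm _ _

theorem conjPoly_perturbation {n : ℕ} (h : Coeffs n) :
    conjPoly (perturbation h) = perturbation h := by
  have hadd : ∀ P Q : MvPolynomial (Fin n ⊕ Fin n) ℂ, conjPoly (P + Q) = conjPoly P + conjPoly Q :=
    fun P Q => by simp [conjPoly]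
  rw [perturbation, Finsupp.sum]
  have hsum : conjPoly (∑ p ∈ h.support, MvPolynomial.C ((h p : ℝ) : ℂ) * (mono p.1 p.2 + mono p.2 p.1)) =
      ∑ p ∈ h.support, conjPoly (MvPolynomial.C ((h p : ℝ) : ℂ) * (mono p.1 p.2 + mono p.2 p.1)) := by
    simp only [conjPoly, map_sum]
  rw [hsum]
  refine Finset.sum_congr rfl fun p _ => ?_
  have hC : conjPoly (MvPolynomial.C ((h p : ℝ) : ℂ) * (mono p.1 p.2 + mono p.2 p.1)) =
      MvPolynomial.C ((h p : ℝ) : ℂ) * conjPoly (mono p.1 p.2 + mono p.2 p.1) := by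
    simp [conjPoly]
  rw [hC, hadd, conjPoly_mono, conjPoly_mono, add_comm (mono p.2 p.1)]

theorem conjPoly_pderiv {n : ℕ} (x : Fin n ⊕ Fin n) (P : MvPolynomial (Fin n ⊕ Fin n) ℂ) :
    conjPoly (MvPolynomial.pderiv x P) = MvPolynomial.pderiv x.swap (conjPoly P) := by
  rw [conjPoly, conjPoly, MvPolynomial.pderiv_rename Sum.swap_leftInverse.injective,
    MvPolynomial.pderiv_map]

/-- The Toeplitz kernel is Hermitian because `∂X_i/∂z_j = ∂²H₁/∂z̄_i∂z_j` and `H₁` is real. -/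
theorem kernelT_symm {n : ℕ} (h : Coeffs n) (z : Lattice n → Vec n) (m : Lattice n) (i j : Fin n) :
    kernelT h z m j i = (starRingEnd ℂ) (kernelT h z (-m) i j) := by
  have key : conjPoly (MvPolynomial.pderiv (Sum.inl j) (field h i)) =
      MvPolynomial.pderiv (Sum.inl i) (field h j) := by
    rw [field, conjPoly_pderiv, conjPoly_pderiv, conjPoly_perturbation, pderiv_comm, field,
      Sum.swap_inl, Sum.swap_inr]
  have key' : (fun θ => (starRingEnd ℂ) (evalTorus z (MvPolynomial.pderiv (Sum.inl j) (field h i)) θ)) =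
      evalTorus z (MvPolynomial.pderiv (Sum.inl i) (field h j)) := by
    funext θ
    rw [conj_evalTorus, key]
  rw [kernelT, kernelT, ← fourierCoef_conj, key']

/-! ### Inversion of small boxes -/

/-- The Hermitian part `D + ε (Toeplitz part of S)` of the operator, on the box `Λ_L` centred at the
origin. -/
noncomputable def centralMatrix {n : ℕ} (h : Coeffs n) (ε : ℝ) (z : Lattice n → Vec n) (ω : Vec n) (L : ℕ) :
    Matrix (box (0 : Lattice n) L × Fin n) (box (0 : Lattice n) L × Fin n) ℂ :=
  Matrix.of fun p q =>
    (if p = q then ((-(pair p.1.1 (drift h ε z ω)) + ω p.2 : ℝ) : ℂ) else 0)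
      + (ε : ℂ) * kernelT h z (p.1.1 - q.1.1) p.2 q.2

theorem centralMatrix_isHermitian {n : ℕ} (h : Coeffs n) (ε : ℝ) (z : Lattice n → Vec n)
    (ω : Vec n) (L : ℕ) : (centralMatrix h ε z ω L).IsHermitian := by
  refine Matrix.IsHermitian.ext fun p q => ?_
  simp only [centralMatrix, Matrix.of_apply, star_add, star_mul']
  have e1 : star (kernelT h z (q.1.1 - p.1.1) q.2 p.2) = kernelT h z (p.1.1 - q.1.1) p.2 q.2 := by
    rw [kernelT_symm h z (p.1.1 - q.1.1), neg_sub]; rfl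
  have e2 : star (ε : ℂ) = (ε : ℂ) := Complex.conj_ofReal ε
  rw [e1, e2]
  congr 1
  by_cases hpq : p = q
  · subst hpq
    rw [if_pos rfl]; exact Complex.conj_ofReal _
  · rw [if_neg hpq, if_neg (Ne.symm hpq), star_zero]

/-- Translation of the central box. -/
def boxShift {n : ℕ} (c : Lattice n) (L : ℕ) : box (0 : Lattice n) L ≃ box c L where
  toFun k := ⟨k.1 + c, mem_box_iff.2 fun i => by simpa using mem_box_iff.1 k.2 i⟩
  invFun k := ⟨k.1 - c, mem_box_iff.2 fun i => by simpa using mem_box_iff.1 k.2 i⟩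
  left_inv k := by ext; simp
  right_inv k := by ext; simp

/-- A translate of the central box inherits invertibility from it as long as the shift `⟨c, ω'⟩` of
the diagonal avoids the finitely many eigenvalues of the central Hermitian matrix. -/
theorem inversion_of_eigenvalues_far {n : ℕ} (h : Coeffs n) (ε : ℝ) (z : Lattice n → Vec n)
    (ω : Vec n) (c : Lattice n) (L : ℕ) {r : ℝ} (hε : 0 ≤ ε) (hr : 0 ≤ r)
    (hR : ∀ k ∈ box c L, ∀ k' ∈ box c L, ∀ i j,
      ‖kernelH h z (k + k') i j + opB h z k i k' j‖ ≤ r)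
    (hrδ : (Fintype.card (box (0 : Lattice n) L × Fin n) : ℝ) ^ 2 * (ε * r) ≤ thr L)
    (hfar : ∀ i, 2 * thr L ≤
      |(centralMatrix_isHermitian h ε z ω L).eigenvalues i - pair c (drift h ε z ω)|) :
    Inversion h ε z ω c L := by
  set e : (box (0 : Lattice n) L × Fin n) ≃ (box c L × Fin n) :=
    (boxShift c L).prodCongr (Equiv.refl _) with he
  set σ := pair c (drift h ε z ω) with hσ
  have hδ : 0 < thr L := Real.exp_pos _
  set R := (opMatrix h ε z ω c L).submatrix e e -
    (centralMatrix h ε z ω L - (σ : ℂ) • (1 : Matrix _ _ ℂ)) with hRdef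
  have hentry : ∀ p q, ‖R p q‖ ≤ ε * r := by
    intro p q
    have e1 : R p q = (ε : ℂ) * (kernelH h z ((e p).1.1 + (e q).1.1) p.2 q.2 +
        opB h z (e p).1.1 p.2 (e q).1.1 q.2) := by
      have s1 : (e p).1.1 = p.1.1 + c := rfl
      have s2 : (e q).1.1 = q.1.1 + c := rfl
      have s3 : (e p).2 = p.2 := rfl
      have s4 : (e q).2 = q.2 := rfl
      simp only [hRdef, Matrix.sub_apply, Matrix.submatrix_apply, opMatrix, centralMatrix,
        Matrix.of_apply, Matrix.smul_apply, Matrix.one_apply, e.apply_eq_iff_eq, tangent, s1, s2, s3,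
        s4, add_sub_add_right_eq_sub, smul_eq_mul]
      by_cases hpq : p = q
      · simp only [hpq, if_true, pair_add, ← hσ]
        push_cast; ring
      · simp only [if_neg hpq]; ring
    rw [e1, norm_mul, Complex.norm_real, Real.norm_of_nonneg hε]
    exact mul_le_mul_of_nonneg_left (hR _ (e p).1.2 _ (e q).1.2 _ _) hε
  have hRn : specNorm R ≤ thr L :=
    (specNorm_le_of_norm_entry_le R (mul_nonneg hε hr) hentry).trans hrδ
  refine isUnit_and_specNorm_inv_le _ hδ (lower_bound_of_submatrix e _ fun v => ?_)
  have h1 := isHermitian_sub_lower_bound (centralMatrix_isHermitian h ε z ω L) (by linarith) hfar v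
  have h2 : ‖Matrix.toEuclideanCLM (𝕜 := ℂ) R v‖ ≤ thr L * ‖v‖ :=
    ((Matrix.toEuclideanCLM (𝕜 := ℂ) R).le_opNorm v).trans
      (mul_le_mul_of_nonneg_right hRn (norm_nonneg v))
  have h3 : (opMatrix h ε z ω c L).submatrix e e =
      (centralMatrix h ε z ω L - (σ : ℂ) • (1 : Matrix _ _ ℂ)) + R := by
    rw [hRdef]; abel
  rw [h3, map_add, add_apply]
  have h4 := norm_sub_le_norm_add (Matrix.toEuclideanCLM (𝕜 := ℂ)
    (centralMatrix h ε z ω L - (σ : ℂ) • (1 : Matrix _ _ ℂ)) v) (Matrix.toEuclideanCLM (𝕜 := ℂ) R v)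
  linarith

/-! ### The gauge of distances -/

/-- The gauge `d · max(d, ℓ)^{s-1}`: it is `d^s` beyond the length `ℓ` and linear, hence much smaller
than `d^s`, at distances small against `ℓ`. Being a multiple of `d` by a nonincreasing factor it is
subadditive. -/
noncomputable def gauge (s ℓ d : ℝ) : ℝ := d * max d ℓ ^ (s - 1)

theorem gauge_zero (s ℓ : ℝ) : gauge s ℓ 0 = 0 := by simp [gauge]

theorem gauge_of_le {s ℓ d : ℝ} (hℓ : 0 < ℓ) (h : ℓ ≤ d) : gauge s ℓ d = d ^ s := by
  rw [gauge, max_eq_left h, mul_comm, ← Real.rpow_add_one (by linarith), sub_add_cancel]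

theorem gauge_le_rpow {s ℓ d : ℝ} (hs1 : s ≤ 1) (hd : 0 ≤ d) : gauge s ℓ d ≤ d ^ s := by
  rcases hd.eq_or_lt with rfl | hd
  · rw [gauge_zero]; exact Real.rpow_nonneg le_rfl s
  · have h1 : max d ℓ ^ (s - 1) ≤ d ^ (s - 1) :=
      Real.rpow_le_rpow_of_nonpos hd (le_max_left _ _) (by linarith)
    calc _ ≤ d * d ^ (s - 1) := mul_le_mul_of_nonneg_left h1 hd.le
      _ = d ^ s := by rw [mul_comm, ← Real.rpow_add_one hd.ne', sub_add_cancel]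

theorem gauge_nonneg {s ℓ d : ℝ} (hd : 0 ≤ d) : 0 ≤ gauge s ℓ d :=
  mul_nonneg hd (Real.rpow_nonneg (hd.trans (le_max_left _ _)) _)

theorem gauge_mono {s ℓ : ℝ} (hs0 : 0 ≤ s) (hℓ : 0 < ℓ) (x y : ℝ) (hx : 0 ≤ x) (hxy : x ≤ y) :
    gauge s ℓ x ≤ gauge s ℓ y := by
  rcases le_total y ℓ with h | h
  · rw [gauge, gauge, max_eq_right h, max_eq_right (hxy.trans h)]
    exact mul_le_mul_of_nonneg_right hxy (Real.rpow_nonneg hℓ.le _)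
  · rw [gauge_of_le hℓ h]
    rcases le_total x ℓ with h' | h'
    · rw [gauge, max_eq_right h']
      calc x * ℓ ^ (s - 1) ≤ ℓ * ℓ ^ (s - 1) :=
            mul_le_mul_of_nonneg_right h' (Real.rpow_nonneg hℓ.le _)
        _ = ℓ ^ s := by rw [mul_comm, ← Real.rpow_add_one hℓ.ne', sub_add_cancel]
        _ ≤ y ^ s := Real.rpow_le_rpow hℓ.le h hs0
    · rw [gauge_of_le hℓ h']
      exact Real.rpow_le_rpow hx hxy hs0

theorem gauge_add_le {s ℓ : ℝ} (hs1 : s ≤ 1) (hℓ : 0 < ℓ) (x y : ℝ) (hx : 0 ≤ x) (hy : 0 ≤ y) :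
    gauge s ℓ (x + y) ≤ gauge s ℓ x + gauge s ℓ y := by
  have key : ∀ u, 0 ≤ u → u ≤ x + y → u * max (x + y) ℓ ^ (s - 1) ≤ gauge s ℓ u := fun u hu h =>
    mul_le_mul_of_nonneg_left (Real.rpow_le_rpow_of_nonpos (lt_of_lt_of_le hℓ (le_max_right _ _))
      (max_le_max_right _ h) (by linarith)) hu
  rw [gauge, add_mul]
  exact add_le_add (key x hx (by linarith)) (key y hy (by linarith))

theorem gauge_le_of_small {s s₀ ℓ d θ : ℝ} (hs : s ≤ s₀) (hs₀ : s₀ < 1) (hd : 0 ≤ d) (hθ : 0 < θ)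
    (hθ1 : θ ≤ 1) (h : d ≤ θ * ℓ) : gauge s ℓ d ≤ θ ^ (1 - s₀) * d ^ s := by
  rcases hd.eq_or_lt with rfl | hd
  · rw [gauge_zero]; exact mul_nonneg (Real.rpow_nonneg hθ.le _) (Real.rpow_nonneg le_rfl s)
  have h1 : d / θ ≤ max d ℓ := by
    rw [div_le_iff₀ hθ]
    exact h.trans ((mul_comm θ ℓ).le.trans (mul_le_mul_of_nonneg_right (le_max_right _ _) hθ.le))
  have h2 : max d ℓ ^ (s - 1) ≤ (d / θ) ^ (s - 1) :=
    Real.rpow_le_rpow_of_nonpos (by positivity) h1 (by linarith)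
  have h3 : (θ ^ (s - 1))⁻¹ ≤ θ ^ (1 - s₀) := by
    rw [← Real.rpow_neg hθ.le]
    exact Real.rpow_le_rpow_of_exponent_ge hθ hθ1 (by linarith)
  calc gauge s ℓ d ≤ d * (d / θ) ^ (s - 1) := mul_le_mul_of_nonneg_left h2 hd.le
    _ = (θ ^ (s - 1))⁻¹ * (d ^ (s - 1) * d) := by
        rw [Real.div_rpow hd.le hθ.le]; field_simp
    _ = (θ ^ (s - 1))⁻¹ * d ^ s := by rw [← Real.rpow_add_one hd.ne', sub_add_cancel]
    _ ≤ _ := mul_le_mul_of_nonneg_right h3 (Real.rpow_nonneg hd.le s)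

/-- A step of length `a` in a small box at the rate `1/2`, followed by a jump of length `b` at a rate
beyond `1/2`, wins over the gauge: a long step is mostly jump, and at a short one the gauge is small. -/
theorem gauge_step {s s₀ ℓ a b d θ Δ R : ℝ} (hs0 : 0 < s) (hs : s ≤ s₀) (hs₀ : s₀ < 1) (hθ : 0 < θ)
    (hθ1 : θ ≤ 1) (hθs : θ ^ (1 - s₀) ≤ 1 / 2) (hΔ : 0 < Δ) (hΔ1 : Δ ≤ 1 / 2)
    (ha : 0 ≤ a) (hb : 0 ≤ b) (hd : 0 ≤ d) (haR : a ≤ R) (hR : R ≤ Δ / 4 * (θ * ℓ))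
    (hdab : d ≤ a + b) :
    (1 / 2 + Δ / 2) * gauge s ℓ d + Δ / 4 * d ^ s ≤ a ^ s / 2 + (1 / 2 + Δ) * b ^ s := by
  have hds : 0 ≤ d ^ s := Real.rpow_nonneg hd s
  have has : 0 ≤ a ^ s := Real.rpow_nonneg ha s
  have hbs : 0 ≤ b ^ s := Real.rpow_nonneg hb s
  rcases le_total d (θ * ℓ) with h | h
  · have h1 : gauge s ℓ d ≤ 1 / 2 * d ^ s := (gauge_le_of_small hs hs₀ hd hθ hθ1 h).trans
      (mul_le_mul_of_nonneg_right hθs hds)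
    have h2 : d ^ s ≤ a ^ s + b ^ s := (Real.rpow_le_rpow hd hdab hs0.le).trans
      (rpow_add_le ha hb hs0.le (by linarith))
    have h3 := mul_le_mul_of_nonneg_left h1 (show 0 ≤ 1 / 2 + Δ / 2 by linarith)
    nlinarith
  · have h1 : gauge s ℓ d ≤ d ^ s := gauge_le_rpow (by linarith) hd
    have h2 : (1 - Δ / 4) * d ≤ b := by
      have := mul_le_mul_of_nonneg_left h (show 0 ≤ Δ / 4 by linarith)
      linarith
    have h3 : (1 - Δ / 4) * d ^ s ≤ b ^ s := by
      calc (1 - Δ / 4) * d ^ s ≤ (1 - Δ / 4) ^ s * d ^ s := by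
            refine mul_le_mul_of_nonneg_right ?_ hds
            exact Real.self_le_rpow_of_le_one (by linarith) (by linarith) (by linarith)
        _ = ((1 - Δ / 4) * d) ^ s := (Real.mul_rpow (by linarith) hd).symm
        _ ≤ b ^ s := Real.rpow_le_rpow (mul_nonneg (by linarith) hd) h2 hs0.le
    have h4 := mul_le_mul_of_nonneg_left h1 (show 0 ≤ 1 / 2 + Δ / 2 by linarith)
    have h5 := mul_le_mul_of_nonneg_left h3 (show 0 ≤ 1 / 2 + Δ by linarith)
    have h6 : (1 / 2 + Δ / 2 + Δ / 4) * d ^ s ≤ (1 / 2 + Δ) * ((1 - Δ / 4) * d ^ s) := by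
      rw [← mul_assoc]
      refine mul_le_mul_of_nonneg_right ?_ hds
      nlinarith
    linarith

/-! ### Clusters of bad sites -/

/-- The length `|k|` as a natural number. -/
def lenNat {n : ℕ} (k : Lattice n) : ℕ := ∑ i, (k i).natAbs

theorem cast_lenNat {n : ℕ} (k : Lattice n) : (lenNat k : ℝ) = len k := by
  rw [lenNat, len, Nat.cast_sum]
  refine Finset.sum_congr rfl fun i _ => ?_
  rw [Nat.cast_natAbs, Int.cast_abs]

theorem abs_len_sub_len_le {n : ℕ} (k l q : Lattice n) :
    |len (k - q) - len (l - q)| ≤ len (k - l) := by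
  have h1 : len (k - q) ≤ len (k - l) + len (l - q) := by
    have := len_add_le (k - l) (l - q)
    rwa [sub_add_sub_cancel] at this
  have h2 : len (l - q) ≤ len (k - l) + len (k - q) := by
    have := len_add_le (-(k - l)) (k - q)
    rw [len_neg] at this
    simpa using this
  exact abs_le.2 ⟨by linarith, by linarith⟩

theorem len_sub_le_len_sub_add {n : ℕ} (k l q : Lattice n) :
    len (k - q) ≤ len (k - l) + len (l - q) := by
  have := len_add_le (k - l) (l - q)
  rwa [sub_add_sub_cancel] at this

/-- The decay of the inverse when the bad sites lie in at most `m` clusters of diameter at most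
`D`. -/
theorem norm_inv_apply_le_of_clusters {n : ℕ} {k₀ : Lattice n} {N : ℕ}
    (T : Matrix (box k₀ N × Fin n) (box k₀ N × Fin n) ℂ)
    (hT : IsUnit T) {s ℓ b b' B A κ : ℝ} (hs0 : 0 ≤ s) (hs1 : s ≤ 1) (hℓ : 0 < ℓ) (hb : 0 ≤ b)
    (hb' : 0 ≤ b') (hB0 : 0 ≤ B) (hBA : B ≤ A) (hκ : 0 ≤ κ) (hB : ∀ x y, ‖T⁻¹ x y‖ ≤ B)
    (hTd : ∀ x y, x ≠ y →
      ‖T x y‖ ≤ κ * Real.exp (-((b + b') * gauge s ℓ (len (x.1.1 - y.1.1)))))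
    (p : ℕ)
    (hp : 2 * (Fintype.card (box k₀ N × Fin n) : ℝ) ^ 2 * (B * κ * Real.exp (b * gauge s ℓ 1)) ≤
      Real.exp (b' * gauge s ℓ p))
    (q : box k₀ N × Fin n) (bad : box k₀ N × Fin n → Prop)
    (hgood : ∀ x, ¬ bad x → ∃ Γ : box k₀ N × Fin n → ℝ, (∀ y, 0 ≤ Γ y) ∧
      (∀ y, Γ y * (2 * Fintype.card (box k₀ N × Fin n)) ≤
        Real.exp (-((b + b') * gauge s ℓ (len (x.1.1 - y.1.1))))) ∧
      ‖T⁻¹ x q‖ ≤ A * Real.exp (-((b + b') * gauge s ℓ (len (x.1.1 - q.1.1)))) +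
        ∑ y, Γ y * ‖T⁻¹ y q‖)
    {ι : Type*} [Fintype ι] (cl : ι → box k₀ N × Fin n → Prop) (hcl : ∀ x, bad x → ∃ i, cl i x)
    (D m : ℕ) (hm : Fintype.card ι ≤ m)
    (hD : ∀ i x y, cl i x → cl i y → len (x.1.1 - y.1.1) ≤ D)
    (x : box k₀ N × Fin n)
    (hx : 0 ≤ len (x.1.1 - q.1.1) - (1 + m * (2 * D + 1)) * (4 * p + 1)) :
    ‖T⁻¹ x q‖ ≤ 2 * A * Real.exp
      (-(b * gauge s ℓ (len (x.1.1 - q.1.1) - (1 + m * (2 * D + 1)) * (4 * p + 1)))) := by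
  classical
  set rad : box k₀ N × Fin n → ℕ := fun x => lenNat (x.1.1 - q.1.1) with hrad
  have hradc : ∀ x, (rad x : ℝ) = len (x.1.1 - q.1.1) := fun x => cast_lenNat _
  set J : Finset ℕ := insert 0
    (Finset.univ.biUnion fun i => (Finset.univ.filter (cl i)).image rad) with hJ
  have hcard1 : ∀ i, ((Finset.univ.filter (cl i)).image rad).card ≤ 2 * D + 1 := by
    intro i
    rcases (Finset.univ.filter (cl i)).eq_empty_or_nonempty with h | ⟨x₀, hx₀⟩
    · simp [h]
    · have hsub : (Finset.univ.filter (cl i)).image rad ⊆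
          Finset.Icc (rad x₀ - D) (rad x₀ + D) := by
        intro t ht
        obtain ⟨y, hy, rfl⟩ := Finset.mem_image.1 ht
        have h1 := hD i y x₀ (Finset.mem_filter.1 hy).2 (Finset.mem_filter.1 hx₀).2
        have h2 := (abs_len_sub_len_le y.1.1 x₀.1.1 q.1.1).trans h1
        rw [← hradc, ← hradc, abs_le] at h2
        have h3 : (rad y : ℝ) ≤ rad x₀ + D := by linarith [h2.2]
        have h4 : (rad x₀ : ℝ) ≤ rad y + D := by linarith [h2.1]
        have h3' : rad y ≤ rad x₀ + D := by exact_mod_cast h3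
        have h4' : rad x₀ ≤ rad y + D := by exact_mod_cast h4
        exact Finset.mem_Icc.2 ⟨by omega, h3'⟩
      refine (Finset.card_le_card hsub).trans ?_
      rw [Nat.card_Icc]; omega
  have hJcard : J.card ≤ 1 + m * (2 * D + 1) := by
    refine (Finset.card_insert_le _ _).trans ?_
    have := Finset.card_biUnion_le_card_mul Finset.univ
      (fun i => (Finset.univ.filter (cl i)).image rad) (2 * D + 1) (fun i _ => hcard1 i)
    rw [Finset.card_univ] at this
    have := this.trans (Nat.mul_le_mul_right _ hm)
    omega
  have hJc : (J.card : ℝ) * (4 * p + 1) ≤ (1 + m * (2 * D + 1)) * (4 * p + 1) := by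
    refine mul_le_mul_of_nonneg_right ?_ (by positivity)
    exact_mod_cast hJcard
  have hx' : 0 ≤ (rad x : ℝ) - J.card * (4 * p + 1) := by rw [hradc]; linarith
  have main := norm_inv_apply_le_of_shells T hT (gauge s ℓ) (gauge_zero s ℓ) (gauge_mono hs0 hℓ)
    (gauge_add_le hs1 hℓ) b b' B A κ hb hb' hB0 hBA hκ hB (fun x y => len (x.1.1 - y.1.1))
    (fun x y => len_nonneg _) rad (fun x y => by
      rw [hradc, hradc]; exact abs_len_sub_len_le _ _ _) hTd q (by simp [hrad, lenNat]) J
    (Finset.mem_insert_self _ _) p hp (fun y hy => ?_) x hx'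
  · refine main.trans (mul_le_mul_of_nonneg_left (Real.exp_le_exp.2 (neg_le_neg ?_)) (by linarith))
    refine mul_le_mul_of_nonneg_left (gauge_mono hs0 hℓ _ _ hx ?_) hb
    rw [hradc]; linarith
  · rw [hradc]
    refine hgood y fun hbad => hy ?_
    obtain ⟨i, hi⟩ := hcl y hbad
    exact Finset.mem_insert_of_mem (Finset.mem_biUnion.2 ⟨i, Finset.mem_univ i,
      Finset.mem_image_of_mem _ (Finset.mem_filter.2 ⟨Finset.mem_univ y, hi⟩)⟩)

/-! ### Local resolvent inequalities -/

/-- The resolvent identity for a principal submatrix. -/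
theorem norm_inv_apply_le_of_submatrix {V U : Type*} [Fintype V] [DecidableEq V] [Fintype U]
    [DecidableEq U] (T : Matrix V V ℂ) (hT : IsUnit T) (f : U → V) (hf : Function.Injective f)
    (hS : IsUnit (T.submatrix f f)) (x : U) (q : V) :
    ‖T⁻¹ (f x) q‖ ≤ (∑ x', ‖(T.submatrix f f)⁻¹ x x'‖ * if f x' = q then 1 else 0) +
      ∑ y, (∑ x', ‖(T.submatrix f f)⁻¹ x x'‖ *
        (if y ∈ Set.range f then 0 else ‖T (f x') y‖)) * ‖T⁻¹ y q‖ := by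
  classical
  set S := T.submatrix f f with hSdef
  have hTT : T * T⁻¹ = 1 := Matrix.mul_nonsing_inv T ((Matrix.isUnit_iff_isUnit_det T).1 hT)
  have hSS : S⁻¹ * S = 1 := Matrix.nonsing_inv_mul S ((Matrix.isUnit_iff_isUnit_det S).1 hS)
  set v : U → ℂ := fun u => T⁻¹ (f u) q with hv
  set e : V → V → ℂ := fun x y => if y ∈ Set.range f then 0 else T x y with he
  have h1 : ∀ x', S.mulVec v x' = (if f x' = q then 1 else 0) - ∑ y, e (f x') y * T⁻¹ y q := by
    intro x'
    have h2 := congrFun (congrFun hTT (f x')) q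
    rw [Matrix.mul_apply, Matrix.one_apply] at h2
    rw [← h2, eq_sub_iff_add_eq]
    have h3 : S.mulVec v x' = ∑ y, if y ∈ Set.range f then T (f x') y * T⁻¹ y q else 0 := by
      rw [← Finset.sum_filter]
      have h4 : (Finset.univ.filter fun y => y ∈ Set.range f) = Finset.univ.image f := by
        ext y; simp
      rw [h4, Finset.sum_image fun a _ b _ hab => hf hab]
      rfl
    rw [h3, ← Finset.sum_add_distrib]
    refine Finset.sum_congr rfl fun y _ => ?_
    simp only [he]; split_ifs <;> ring
  have h2 : T⁻¹ (f x) q = ∑ x', S⁻¹ x x' *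
      ((if f x' = q then 1 else 0) - ∑ y, e (f x') y * T⁻¹ y q) := by
    have h3 : S⁻¹.mulVec (S.mulVec v) x = v x := by
      rw [Matrix.mulVec_mulVec, hSS, Matrix.one_mulVec]
    rw [show T⁻¹ (f x) q = v x from rfl, ← h3]
    simp only [Matrix.mulVec, dotProduct]
    refine Finset.sum_congr rfl fun x' _ => ?_
    rw [← h1 x']; rfl
  rw [h2]
  have h4 : ∑ y, (∑ x', ‖S⁻¹ x x'‖ * (if y ∈ Set.range f then 0 else ‖T (f x') y‖)) * ‖T⁻¹ y q‖ =
      ∑ x', ‖S⁻¹ x x'‖ * ∑ y, ‖e (f x') y‖ * ‖T⁻¹ y q‖ := by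
    simp only [Finset.sum_mul, Finset.mul_sum]
    rw [Finset.sum_comm]
    refine Finset.sum_congr rfl fun x' _ => Finset.sum_congr rfl fun y _ => ?_
    simp only [he]; split_ifs <;> simp [mul_assoc]
  rw [h4, ← Finset.sum_add_distrib]
  refine (norm_sum_le _ _).trans (Finset.sum_le_sum fun x' _ => ?_)
  rw [norm_mul, ← mul_add]
  refine mul_le_mul_of_nonneg_left ((norm_sub_le _ _).trans (add_le_add ?_ ?_)) (norm_nonneg _)
  · split_ifs <;> simp
  · exact (norm_sum_le _ _).trans (Finset.sum_le_sum fun y _ => (norm_mul _ _).le)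

/-- Every point of a box lies in a sub-box of size `L` whose complement is at distance at least `L`
from the point. -/
theorem exists_subbox {n : ℕ} {k₀ k : Lattice n} {N L : ℕ} (hL : L ≤ N) (hk : k ∈ box k₀ N) :
    ∃ c, box c L ⊆ box k₀ N ∧ k ∈ box c L ∧ c ∈ box k₀ N ∧
      ∀ y ∈ box k₀ N, y ∉ box c L → (L : ℝ) ≤ len (k - y) := by
  have hk' := fun i => abs_le.1 (mem_box_iff.1 hk i)
  refine ⟨fun i => max (k₀ i - N + L) (min (k i) (k₀ i + N - L)), ?_, ?_, ?_, ?_⟩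
  · intro y hy
    refine mem_box_iff.2 fun i => ?_
    have h1 := abs_le.1 (mem_box_iff.1 hy i)
    have h2 := hk' i
    rw [abs_le]; omega
  · refine mem_box_iff.2 fun i => ?_
    have h2 := hk' i
    rw [abs_le]; omega
  · refine mem_box_iff.2 fun i => ?_
    have h2 := hk' i
    rw [abs_le]; omega
  · intro y hy hyc
    rw [mem_box_iff] at hyc
    push Not at hyc
    obtain ⟨i, hi⟩ := hyc
    have h1 := abs_le.1 (mem_box_iff.1 hy i)
    have h2 := hk' i
    have h3 : (L : ℤ) ≤ |k i - y i| := by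
      rcases lt_abs.1 hi with h | h <;> rw [le_abs] <;> omega
    have h4 : (L : ℝ) ≤ |((k - y) i : ℝ)| := by
      rw [Pi.sub_apply]; exact_mod_cast h3
    exact h4.trans (abs_le_len (k - y) i)

theorem len_sub_le_of_mem_box {n : ℕ} {c k l : Lattice n} {L : ℕ} (hk : k ∈ box c L)
    (hl : l ∈ box c L) : len (k - l) ≤ 2 * n * L := by
  have h1 : ∀ i ∈ Finset.univ, |(((k - l) i : ℤ) : ℝ)| ≤ 2 * L := by
    intro i _
    have a1 := abs_le.1 (mem_box_iff.1 hk i)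
    have a2 := abs_le.1 (mem_box_iff.1 hl i)
    have : |(k - l) i| ≤ 2 * (L : ℤ) := by rw [Pi.sub_apply, abs_le]; omega
    exact_mod_cast this
  refine (Finset.sum_le_card_nsmul _ _ _ h1).trans (le_of_eq ?_)
  rw [Finset.card_univ, Fintype.card_fin, nsmul_eq_mul]; ring

theorem card_box {n : ℕ} (k₀ : Lattice n) (N : ℕ) :
    Fintype.card (box k₀ N × Fin n) = (2 * N + 1) ^ n * n := by
  rw [Fintype.card_prod, Fintype.card_fin, Fintype.card_coe, box, Pi.card_Icc]
  congr 1
  rw [Finset.prod_congr rfl (g := fun _ => 2 * N + 1) fun i _ => by rw [Int.card_Icc]; omega]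
  simp

end DimEnlargedNewton

namespace DimEnlargedNewton

open Filter

/-! ### Comparison of the scales -/

theorem eventually_pow_le_exp_rpow (C c a : ℝ) (hc : 0 < c) (ha : 0 < a) :
    ∀ᶠ Y : ℝ in atTop, C * Y ^ 15 ≤ c * Real.exp (a * Y ^ ((1 : ℝ) / 60)) := by
  have h1 := (isLittleO_pow_exp_pos_mul_atTop 900 ha).comp_tendsto
    (tendsto_rpow_atTop (show (0 : ℝ) < 1 / 60 by norm_num))
  have h2 := h1.def (show (0 : ℝ) < c / (|C| + 1) by positivity)
  filter_upwards [h2, eventually_ge_atTop 0] with Y hY hY0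
  simp only [Function.comp_apply, Real.norm_eq_abs, Real.abs_exp] at hY
  have e : (Y ^ ((1 : ℝ) / 60)) ^ 900 = Y ^ 15 := by
    rw [← Real.rpow_natCast, ← Real.rpow_mul hY0, ← Real.rpow_natCast]
    norm_num
  rw [e, abs_of_nonneg (by positivity)] at hY
  calc C * Y ^ 15 ≤ (|C| + 1) * Y ^ 15 :=
        mul_le_mul_of_nonneg_right (by linarith [le_abs_self C]) (by positivity)
    _ ≤ (|C| + 1) * (c / (|C| + 1) * Real.exp (a * Y ^ ((1 : ℝ) / 60))) :=
        mul_le_mul_of_nonneg_left hY (by positivity)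
    _ = _ := by field_simp

theorem eventually_rpow_tenth_le (C : ℝ) :
    ∀ᶠ Y : ℝ in atTop, C * (1 + Y ^ ((1 : ℝ) / 10)) ≤ Y / 8 := by
  have h1 := (tendsto_rpow_atTop (show (0 : ℝ) < 9 / 10 by norm_num)).eventually_ge_atTop (16 * |C|)
  filter_upwards [h1, eventually_ge_atTop 1] with Y hY hY1
  have h2 : 1 ≤ Y ^ ((1 : ℝ) / 10) := Real.one_le_rpow hY1 (by norm_num)
  have h3 : Y = Y ^ ((9 : ℝ) / 10) * Y ^ ((1 : ℝ) / 10) := by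
    rw [← Real.rpow_add (by linarith)]; norm_num
  have h4 : 16 * |C| * Y ^ ((1 : ℝ) / 10) ≤ Y := by
    conv_rhs => rw [h3]
    exact mul_le_mul_of_nonneg_right hY (by linarith)
  have h5 := mul_le_mul_of_nonneg_right (le_abs_self C) (show 0 ≤ 1 + Y ^ ((1 : ℝ) / 10) by linarith)
  nlinarith [abs_nonneg C]

/-- The constant that multiplies `(log N)^15` in the comparison of scales. -/
def polyConst (n : ℕ) : ℝ := 8 * n + 2 ^ 15 + 20

/-- The requirements on `Y = log N` that make `N` large: a power of `Y` is small against the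
exponential of `Y^{1/60}`, and `Y^{1/10}` is small against `Y`. -/
structure LargeScale (n : ℕ) (lam Δ γ A₀ Y : ℝ) : Prop where
  exp_large : polyConst n * Y ^ 15 ≤ min (Δ / 8) γ * Real.exp (lam / 8 * Y ^ ((1 : ℝ) / 60))
  tenth_small : (8 * n + 20 + A₀ + 8 / Δ) * (1 + Y ^ ((1 : ℝ) / 10)) ≤ Y / 8
  one_le : 1 ≤ Y

theorem eventually_largeScale (n : ℕ) {lam Δ γ : ℝ} (A₀ : ℝ) (hlam : 0 < lam) (hΔ : 0 < Δ)
    (hγ : 0 < γ) : ∀ᶠ Y : ℝ in atTop, LargeScale n lam Δ γ A₀ Y := by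
  filter_upwards [eventually_pow_le_exp_rpow (polyConst n) (min (Δ / 8) γ) (lam / 8)
    (lt_min (by positivity) hγ) (by positivity),
    eventually_rpow_tenth_le (8 * n + 20 + A₀ + 8 / Δ), eventually_ge_atTop 1] with Y h1 h2 h3
  exact ⟨h1, h2, h3⟩

section Scale

variable {n N : ℕ} {X Y s lam Δ γ A₀ : ℝ}

theorem LargeScale.one_le_tenth (h : LargeScale n lam Δ γ A₀ Y) : 1 ≤ Y ^ ((1 : ℝ) / 10) :=
  Real.one_le_rpow h.one_le (by norm_num)

theorem LargeScale.poly_le (h : LargeScale n lam Δ γ A₀ Y) {u : ℝ} (hΔ : 0 < Δ)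
    (hu : Real.exp (lam / 8 * Y ^ ((1 : ℝ) / 60)) ≤ u) : polyConst n * Y ^ 15 ≤ Δ / 8 * u := by
  refine h.exp_large.trans ?_
  calc _ ≤ Δ / 8 * Real.exp (lam / 8 * Y ^ ((1 : ℝ) / 60)) :=
        mul_le_mul_of_nonneg_right (min_le_left _ _) (Real.exp_nonneg _)
    _ ≤ _ := mul_le_mul_of_nonneg_left hu (by positivity)

theorem LargeScale.poly_le' (h : LargeScale n lam Δ γ A₀ Y) {u : ℝ} (hγ : 0 < γ)
    (hu : Real.exp (lam / 8 * Y ^ ((1 : ℝ) / 60)) ≤ u) : polyConst n * Y ^ 15 ≤ γ * u := by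
  refine h.exp_large.trans ?_
  calc _ ≤ γ * Real.exp (lam / 8 * Y ^ ((1 : ℝ) / 60)) :=
        mul_le_mul_of_nonneg_right (min_le_right _ _) (Real.exp_nonneg _)
    _ ≤ _ := mul_le_mul_of_nonneg_left hu hγ.le

theorem LargeScale.pow_le (h : LargeScale n lam Δ γ A₀ Y) {j : ℕ} (hj : j ≤ 15) : Y ^ j ≤ Y ^ 15 :=
  pow_le_pow_right₀ h.one_le hj

theorem LargeScale.tenth_add_le (h : LargeScale n lam Δ γ A₀ Y) (hΔ : 0 < Δ) (hA : 0 ≤ A₀) :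
    8 * n + 20 + A₀ + 8 / Δ + (8 * n + 20) * Y ^ ((1 : ℝ) / 10) ≤ Y / 8 := by
  have h1 := h.one_le_tenth
  have h2 : 0 ≤ 8 / Δ := by positivity
  refine le_trans ?_ h.tenth_small
  nlinarith

theorem card_le_exp (hn : 1 ≤ n) (hN : (N : ℝ) = Real.exp Y) (hY : 1 ≤ Y) :
    (((2 * N + 1) ^ n * n : ℕ) : ℝ) ≤ Real.exp (4 * n * Y) := by
  have h1 : (1 : ℝ) ≤ N := hN ▸ Real.one_le_exp (by linarith)
  have h2 : 2 * (N : ℝ) + 1 ≤ Real.exp (2 + Y) := by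
    rw [Real.exp_add, ← hN]
    nlinarith [Real.add_one_le_exp (2 : ℝ)]
  have h3 : (n : ℝ) ≤ Real.exp n := by linarith [Real.add_one_le_exp (n : ℝ)]
  have hn' : (1 : ℝ) ≤ n := by exact_mod_cast hn
  push_cast
  calc (2 * (N : ℝ) + 1) ^ n * n ≤ Real.exp (2 + Y) ^ n * Real.exp n := by gcongr
    _ = Real.exp (n * (2 + Y) + n) := by rw [← Real.exp_nat_mul, ← Real.exp_add]
    _ ≤ _ := Real.exp_le_exp.2 (by nlinarith)

theorem thr_of_eq_exp (hN : (N : ℝ) = Real.exp Y) : 1 / thr N = Real.exp (Y ^ 15) := by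
  rw [thr, hN, Real.log_exp, one_div, ← Real.exp_neg, neg_neg]

/-- The size of the sub-boxes, the reduced scale rounded up. -/
noncomputable def subSize (Y : ℝ) : ℕ := ⌈Real.exp (Y ^ ((1 : ℝ) / 10))⌉₊

theorem exp_le_subSize (Y : ℝ) : Real.exp (Y ^ ((1 : ℝ) / 10)) ≤ subSize Y := Nat.le_ceil _

theorem one_le_subSize (Y : ℝ) : 1 ≤ subSize Y := Nat.one_le_ceil_iff.2 (Real.exp_pos _)

theorem LargeScale.subSize_le (h : LargeScale n lam Δ γ A₀ Y) :
    (subSize Y : ℝ) ≤ Real.exp (2 * Y ^ ((1 : ℝ) / 10)) := by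
  have h1 := h.one_le_tenth
  set a := Y ^ ((1 : ℝ) / 10)
  refine (Nat.ceil_lt_add_one (Real.exp_nonneg _)).le.trans ?_
  rw [two_mul, Real.exp_add]
  nlinarith [Real.add_one_le_exp a]

theorem LargeScale.log_subSize_le (h : LargeScale n lam Δ γ A₀ Y) :
    Real.log (subSize Y) ≤ 2 * Y ^ ((1 : ℝ) / 10) := by
  rw [Real.log_le_iff_le_exp (by exact_mod_cast one_le_subSize Y)]
  exact h.subSize_le

theorem LargeScale.log_subSize_pow_le (h : LargeScale n lam Δ γ A₀ Y) :
    Real.log (subSize Y) ^ 15 ≤ 2 ^ 15 * Y ^ ((3 : ℝ) / 2) := by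
  have h0 : 0 ≤ Y := by linarith [h.one_le]
  have h1 : 0 ≤ Real.log (subSize Y) := Real.log_nonneg (by exact_mod_cast one_le_subSize Y)
  refine (pow_le_pow_left₀ h1 h.log_subSize_le 15).trans (le_of_eq ?_)
  rw [mul_pow, ← Real.rpow_natCast (Y ^ ((1 : ℝ) / 10)), ← Real.rpow_mul h0]
  norm_num

theorem LargeScale.log_subSize_pow_le' (h : LargeScale n lam Δ γ A₀ Y) :
    Real.log (subSize Y) ^ 15 ≤ 2 ^ 15 * Y ^ 15 := by
  refine h.log_subSize_pow_le.trans (mul_le_mul_of_nonneg_left ?_ (by positivity))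
  rw [← Real.rpow_natCast]
  exact Real.rpow_le_rpow_of_exponent_le h.one_le (by norm_num)

theorem LargeScale.mul_subSize_le (h : LargeScale n lam Δ γ A₀ Y) (hΔ : 0 < Δ) (hA : 0 ≤ A₀) :
    A₀ * subSize Y ≤ Real.exp (Y / 8) := by
  have h1 := h.tenth_add_le hΔ hA
  have h2 : A₀ ≤ Real.exp A₀ := by linarith [Real.add_one_le_exp A₀]
  have h3 : 0 ≤ 8 / Δ := by positivity
  have h4 := h.one_le_tenth
  have h5 : (0 : ℝ) ≤ n := Nat.cast_nonneg n
  calc A₀ * subSize Y ≤ Real.exp A₀ * Real.exp (2 * Y ^ ((1 : ℝ) / 10)) :=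
        mul_le_mul h2 h.subSize_le (Nat.cast_nonneg _) (Real.exp_nonneg _)
    _ = Real.exp (A₀ + 2 * Y ^ ((1 : ℝ) / 10)) := (Real.exp_add _ _).symm
    _ ≤ _ := Real.exp_le_exp.2 (by nlinarith)

theorem LargeScale.two_mul_subSize_le (h : LargeScale n lam Δ γ A₀ Y) (hΔ : 0 < Δ) (hA : 0 ≤ A₀) :
    2 * n * (subSize Y : ℝ) ≤ Real.exp (Y / 8) := by
  have h1 := h.tenth_add_le hΔ hA
  have h2 : 2 * (n : ℝ) ≤ Real.exp (2 * n) := by linarith [Real.add_one_le_exp (2 * (n : ℝ))]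
  have h3 : 0 ≤ 8 / Δ := by positivity
  have h4 := h.one_le_tenth
  have h5 : (0 : ℝ) ≤ n := Nat.cast_nonneg n
  calc 2 * n * (subSize Y : ℝ) ≤ Real.exp (2 * n) * Real.exp (2 * Y ^ ((1 : ℝ) / 10)) :=
        mul_le_mul h2 h.subSize_le (Nat.cast_nonneg _) (Real.exp_nonneg _)
    _ = Real.exp (2 * n + 2 * Y ^ ((1 : ℝ) / 10)) := (Real.exp_add _ _).symm
    _ ≤ _ := Real.exp_le_exp.2 (by nlinarith)

theorem LargeScale.exp_le_rpow (h : LargeScale n lam Δ γ A₀ Y) (hlam : 0 < lam) (hX : 1 ≤ X)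
    (hXY : X ^ ((5 : ℝ) / 4) ≤ Y) (hs : lam ≤ s * X) :
    Real.exp (lam / 8 * Y ^ ((1 : ℝ) / 60)) ≤ Real.exp (s * Y / 8) := by
  have hY0 : 0 < Y := by linarith [h.one_le]
  have hX0 : 0 < X := by linarith
  refine Real.exp_le_exp.2 ?_
  have h1 : X ≤ Y ^ ((4 : ℝ) / 5) := by
    have := Real.rpow_le_rpow (by positivity) hXY (show (0 : ℝ) ≤ 4 / 5 by norm_num)
    rwa [← Real.rpow_mul hX0.le, show (5 : ℝ) / 4 * (4 / 5) = 1 by norm_num, Real.rpow_one] at this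
  have h2 : Y ^ ((1 : ℝ) / 60) * X ≤ Y := by
    calc _ ≤ Y ^ ((1 : ℝ) / 60) * Y ^ ((4 : ℝ) / 5) :=
          mul_le_mul_of_nonneg_left h1 (by positivity)
      _ = Y ^ ((1 : ℝ) / 60 + 4 / 5) := (Real.rpow_add hY0 _ _).symm
      _ ≤ Y ^ (1 : ℝ) := Real.rpow_le_rpow_of_exponent_le h.one_le (by norm_num)
      _ = Y := Real.rpow_one Y
  have hspos : 0 < s := pos_of_mul_pos_left (hlam.trans_le hs) hX0.le
  have h3 : lam * Y ^ ((1 : ℝ) / 60) ≤ s * Y := by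
    calc _ ≤ s * X * Y ^ ((1 : ℝ) / 60) := mul_le_mul_of_nonneg_right hs (by positivity)
      _ = s * (Y ^ ((1 : ℝ) / 60) * X) := by ring
      _ ≤ s * Y := mul_le_mul_of_nonneg_left h2 hspos.le
  linarith

/-- The decay over the cut-off width beats the bound on the inverse of the whole box. -/
theorem LargeScale.cutoff_bound (h : LargeScale n lam Δ γ A₀ Y) (hn : 1 ≤ n) (hlam : 0 < lam)
    (hΔ : 0 < Δ) (hΔ1 : Δ ≤ 1 / 2) (hA : 0 < A₀) (hX : 1 ≤ X) (hXY : X ^ ((5 : ℝ) / 4) ≤ Y)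
    (hs0 : 0 < s) (hs1 : s ≤ 1) (hs : lam ≤ s * X) (hN : (N : ℝ) = Real.exp Y) {κ : ℝ}
    (hκ0 : 0 ≤ κ) (hκ : κ ≤ Real.exp (X ^ 2)) (hXY' : X ≤ Y) :
    2 * (((2 * N + 1) ^ n * n : ℕ) : ℝ) ^ 2 *
      (1 / thr N * κ * Real.exp ((1 / 2 + Δ / 4) * gauge s (A₀ * subSize Y) 1)) ≤
        Real.exp (Δ / 4 * gauge s (A₀ * subSize Y) (⌈Real.exp (Y / 8)⌉₊ : ℕ)) := by
  have hL : (0 : ℝ) < subSize Y := by exact_mod_cast one_le_subSize Y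
  have hp : Real.exp (Y / 8) ≤ (⌈Real.exp (Y / 8)⌉₊ : ℕ) := Nat.le_ceil _
  rw [gauge_of_le (mul_pos hA hL) ((h.mul_subSize_le hΔ hA.le).trans hp), thr_of_eq_exp hN]
  have h1 : Real.exp (s * Y / 8) ≤ ((⌈Real.exp (Y / 8)⌉₊ : ℕ) : ℝ) ^ s := by
    calc _ = Real.exp (Y / 8) ^ s := by rw [← Real.exp_mul]; ring_nf
      _ ≤ _ := Real.rpow_le_rpow (Real.exp_nonneg _) hp hs0.le
  have h2 := h.poly_le hΔ ((h.exp_le_rpow hlam hX hXY hs).trans h1)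
  have hg : gauge s (A₀ * subSize Y) 1 ≤ 1 := by
    have := gauge_le_rpow (ℓ := A₀ * subSize Y) hs1 zero_le_one
    rwa [Real.one_rpow] at this
  have h3 : (1 / 2 + Δ / 4) * gauge s (A₀ * subSize Y) 1 ≤ 1 := by
    have := gauge_nonneg (s := s) (ℓ := A₀ * subSize Y) zero_le_one
    nlinarith
  have hV := card_le_exp hn hN h.one_le
  have hX2 : X ^ 2 ≤ Y ^ 2 := pow_le_pow_left₀ (by linarith) hXY' 2
  have e1 := h.pow_le (j := 0) (by norm_num)
  have e2 := h.pow_le (j := 1) (by norm_num)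
  have e3 := h.pow_le (j := 2) (by norm_num)
  rw [pow_zero] at e1
  rw [pow_one] at e2
  have two : (2 : ℝ) ≤ Real.exp 1 := by linarith [Real.add_one_le_exp (1 : ℝ)]
  calc _ ≤ Real.exp 1 * Real.exp (4 * n * Y) ^ 2 *
        (Real.exp (Y ^ 15) * Real.exp (Y ^ 2) * Real.exp 1) := by
        gcongr
        exact hκ.trans (Real.exp_le_exp.2 hX2)
    _ = Real.exp (1 + 2 * (4 * n * Y) + (Y ^ 15 + Y ^ 2 + 1)) := by
        rw [← Real.exp_nat_mul]
        simp only [← Real.exp_add]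
        norm_num
    _ ≤ _ := Real.exp_le_exp.2 ?_
  have hnY : (n : ℝ) * Y ≤ n * Y ^ 15 := mul_le_mul_of_nonneg_left e2 (Nat.cast_nonneg n)
  have : 1 + 2 * (4 * n * Y) + (Y ^ 15 + Y ^ 2 + 1) ≤ polyConst n * Y ^ 15 := by
    rw [polyConst]; nlinarith
  have h4 : 0 ≤ ((⌈Real.exp (Y / 8)⌉₊ : ℕ) : ℝ) ^ s := Real.rpow_nonneg (Nat.cast_nonneg _) _
  nlinarith

/-- The total width of the spheres that meet one of the `(2L+1)^n n` clusters of diameter `4nL`, thickened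
by the cut-off width, is a small power of `N`. -/
theorem LargeScale.removed_le (h : LargeScale n lam Δ γ A₀ Y) (hn : 1 ≤ n) (hΔ : 0 < Δ)
    (hA : 0 ≤ A₀) :
    (1 + (((2 * subSize Y + 1) ^ n * n : ℕ) : ℝ) * (2 * ((4 * n * subSize Y : ℕ) : ℝ) + 1)) *
      (4 * ((⌈Real.exp (Y / 8)⌉₊ : ℕ) : ℝ) + 1) ≤ Real.exp (Y / 4) := by
  have hn' : (1 : ℝ) ≤ n := by exact_mod_cast hn
  have hL : (1 : ℝ) ≤ subSize Y := by exact_mod_cast one_le_subSize Y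
  have hLe := h.subSize_le
  have h0 := h.tenth_add_le hΔ hA
  have ha := h.one_le_tenth
  have h8 : 0 ≤ 8 / Δ := by positivity
  set a := Y ^ ((1 : ℝ) / 10) with hadef
  have hn3 : (n : ℝ) ≤ Real.exp n := by linarith [Real.add_one_le_exp (n : ℝ)]
  have b1 : (((2 * subSize Y + 1) ^ n * n : ℕ) : ℝ) ≤ Real.exp (n * (2 + 2 * a) + n) := by
    have : 2 * (subSize Y : ℝ) + 1 ≤ Real.exp (2 + 2 * a) := by
      rw [Real.exp_add]
      nlinarith [Real.add_one_le_exp (2 : ℝ)]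
    push_cast
    calc _ ≤ Real.exp (2 + 2 * a) ^ n * Real.exp n := by gcongr
      _ = _ := by rw [← Real.exp_nat_mul, ← Real.exp_add]
  have b2 : 2 * ((4 * n * subSize Y : ℕ) : ℝ) + 1 ≤ Real.exp (8 + n + 2 * a) := by
    rw [Real.exp_add, Real.exp_add]
    push_cast
    have e1 : (1 : ℝ) ≤ n * subSize Y := by nlinarith
    have e2 : (n : ℝ) * subSize Y ≤ Real.exp n * Real.exp (2 * a) := by gcongr
    have e3 := Real.add_one_le_exp (8 : ℝ)
    nlinarith
  have hE : (1 : ℝ) ≤ Real.exp (Y / 8) := Real.one_le_exp (by linarith [h.one_le])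
  have b3 : 4 * ((⌈Real.exp (Y / 8)⌉₊ : ℕ) : ℝ) + 1 ≤ Real.exp (8 + Y / 8) := by
    have e1 := (Nat.ceil_lt_add_one (Real.exp_nonneg (Y / 8))).le
    rw [Real.exp_add]
    nlinarith [Real.add_one_le_exp (8 : ℝ)]
  have b4 : 1 + (((2 * subSize Y + 1) ^ n * n : ℕ) : ℝ) * (2 * ((4 * n * subSize Y : ℕ) : ℝ) + 1) ≤
      Real.exp (1 + (n * (2 + 2 * a) + n + (8 + n + 2 * a))) := by
    have e1 : (((2 * subSize Y + 1) ^ n * n : ℕ) : ℝ) * (2 * ((4 * n * subSize Y : ℕ) : ℝ) + 1) ≤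
        Real.exp (n * (2 + 2 * a) + n + (8 + n + 2 * a)) := by
      rw [Real.exp_add (n * (2 + 2 * a) + n)]
      exact mul_le_mul b1 b2 (by positivity) (Real.exp_nonneg _)
    have e2 : (1 : ℝ) ≤ Real.exp (n * (2 + 2 * a) + n + (8 + n + 2 * a)) :=
      Real.one_le_exp (by positivity)
    rw [Real.exp_add 1]
    nlinarith [Real.add_one_le_exp (1 : ℝ)]
  calc _ ≤ Real.exp (1 + (n * (2 + 2 * a) + n + (8 + n + 2 * a))) * Real.exp (8 + Y / 8) :=
        mul_le_mul b4 b3 (by positivity) (Real.exp_nonneg _)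
    _ = Real.exp (1 + (n * (2 + 2 * a) + n + (8 + n + 2 * a)) + (8 + Y / 8)) :=
        (Real.exp_add _ _).symm
    _ ≤ _ := Real.exp_le_exp.2 (by nlinarith)

/-- Beyond the distance `N^{1/2}` the part removed on account of the bad sites, and the norm of the
inverse of the whole box, use up only a fraction of the surplus of the rate over `1/2`. -/
theorem LargeScale.final_bound (h : LargeScale n lam Δ γ A₀ Y) (hn : 1 ≤ n) (hlam : 0 < lam)
    (hΔ : 0 < Δ) (hΔ1 : Δ ≤ 1 / 2) (hA : 0 < A₀) (hX : 1 ≤ X) (hXY : X ^ ((5 : ℝ) / 4) ≤ Y)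
    (hs0 : 0 < s) (hs1 : s ≤ 1) (hs : lam ≤ s * X) (hN : (N : ℝ) = Real.exp Y) {d R : ℝ}
    (hR : R ≤ Real.exp (Y / 4)) (hd : (N : ℝ) ^ ((1 : ℝ) / 2) < d) :
    0 ≤ d - R ∧ (n : ℝ) ^ 2 * (2 * (1 / thr N * Real.exp ((2 * n * (subSize Y : ℝ)) ^ s)) *
      Real.exp (-((1 / 2 + Δ / 4) * gauge s (A₀ * subSize Y) (d - R)))) ≤
        Real.exp (-(d ^ s) / 2) := by
  have hL : (0 : ℝ) < subSize Y := by exact_mod_cast one_le_subSize Y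
  have hn' : (1 : ℝ) ≤ n := by exact_mod_cast hn
  have h0 := h.tenth_add_le hΔ hA.le
  have ha := h.one_le_tenth
  have h8 : 0 ≤ 8 / Δ := by positivity
  have hna : 0 ≤ (8 * (n : ℝ) + 20) * Y ^ ((1 : ℝ) / 10) := by positivity
  have hY20 : 160 ≤ Y := by linarith
  have hY8 : 8 / Δ ≤ Y / 8 := by linarith
  have hsY : 0 < s * Y := mul_pos hs0 (by linarith)
  have hd1 : Real.exp (Y / 2) < d := by
    rw [hN, ← Real.exp_mul] at hd
    rwa [show Y * (1 / 2) = Y / 2 by ring] at hd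
  have hd0 : 0 < d := (Real.exp_pos _).trans hd1
  have hR' : R ≤ Δ / 8 * d := by
    have e1 : 8 / Δ ≤ Real.exp (Y / 4) := by linarith [Real.add_one_le_exp (Y / 4)]
    have e2 : 1 ≤ Δ / 8 * Real.exp (Y / 4) := by
      rw [div_le_iff₀ hΔ] at e1; linarith
    have e3 : Real.exp (Y / 2) = Real.exp (Y / 4) * Real.exp (Y / 4) := by
      rw [← Real.exp_add]; ring_nf
    have e4 : 0 < Real.exp (Y / 4) := Real.exp_pos _
    calc R ≤ Real.exp (Y / 4) := hR
      _ ≤ Δ / 8 * Real.exp (Y / 4) * Real.exp (Y / 4) := le_mul_of_one_le_left e4.le e2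
      _ = Δ / 8 * Real.exp (Y / 2) := by rw [e3]; ring
      _ ≤ _ := mul_le_mul_of_nonneg_left hd1.le (by positivity)
  have ht : (1 - Δ / 8) * d ≤ d - R := by linarith
  have ht0 : 0 ≤ (1 - Δ / 8) * d := mul_nonneg (by linarith) hd0.le
  refine ⟨ht0.trans ht, ?_⟩
  have htℓ : A₀ * subSize Y ≤ d - R := by
    refine (h.mul_subSize_le hΔ hA.le).trans (le_trans ?_ ht)
    have e1 : Real.exp (1 + Y / 8) ≤ Real.exp (Y / 2) := Real.exp_le_exp.2 (by linarith)
    rw [Real.exp_add] at e1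
    have e2 : 0 < Real.exp (Y / 8) := Real.exp_pos _
    have e3 : 2 * Real.exp (Y / 8) ≤ Real.exp 1 * Real.exp (Y / 8) :=
      mul_le_mul_of_nonneg_right (by linarith [Real.add_one_le_exp (1 : ℝ)]) e2.le
    have e4 : Δ / 8 * d ≤ 1 / 2 * d := mul_le_mul_of_nonneg_right (by linarith) hd0.le
    linarith
  rw [gauge_of_le (mul_pos hA hL) htℓ, thr_of_eq_exp hN]
  have hts : (1 - Δ / 8) * d ^ s ≤ (d - R) ^ s := by
    calc (1 - Δ / 8) * d ^ s ≤ (1 - Δ / 8) ^ s * d ^ s := by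
          refine mul_le_mul_of_nonneg_right ?_ (Real.rpow_nonneg hd0.le s)
          exact Real.self_le_rpow_of_le_one (by linarith) (by linarith) hs1
      _ = ((1 - Δ / 8) * d) ^ s := (Real.mul_rpow (by linarith) hd0.le).symm
      _ ≤ _ := Real.rpow_le_rpow ht0 ht hs0.le
  set u := Real.exp (s * Y / 4) with hu
  have hu2 : u ^ 2 ≤ d ^ s := by
    calc u ^ 2 = Real.exp (Y / 2) ^ s := by
          rw [hu, ← Real.exp_nat_mul, ← Real.exp_mul]; push_cast; ring_nf
      _ ≤ d ^ s := Real.rpow_le_rpow (Real.exp_nonneg _) hd1.le hs0.le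
  have hLs : (2 * n * (subSize Y : ℝ)) ^ s ≤ u := by
    calc _ ≤ Real.exp (Y / 8) ^ s :=
          Real.rpow_le_rpow (by positivity) (h.two_mul_subSize_le hΔ hA.le) hs0.le
      _ = Real.exp (Y / 8 * s) := by rw [Real.exp_mul]
      _ ≤ u := Real.exp_le_exp.2 (by linarith)
  have hpoly : polyConst n * Y ^ 15 ≤ Δ / 8 * u := by
    refine h.poly_le hΔ ((h.exp_le_rpow hlam hX hXY hs).trans (Real.exp_le_exp.2 ?_))
    linarith
  have e1 := h.pow_le (j := 0) (by norm_num)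
  rw [pow_zero] at e1
  have hu0 : 0 < u := Real.exp_pos _
  have h20 : 1 + 2 * n + Y ^ 15 ≤ polyConst n * Y ^ 15 := by
    have : (8 * (n : ℝ) + 2 ^ 15 + 19) * 1 ≤ (8 * (n : ℝ) + 2 ^ 15 + 19) * Y ^ 15 :=
      mul_le_mul_of_nonneg_left e1 (by positivity)
    rw [polyConst]; linarith
  have hΔu1 : 2 ≤ Δ / 8 * u := by
    linarith
  have hsq : 2 * u ≤ Δ / 8 * d ^ s := by
    calc 2 * u ≤ Δ / 8 * u * u := mul_le_mul_of_nonneg_right hΔu1 hu0.le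
      _ = Δ / 8 * u ^ 2 := by ring
      _ ≤ _ := mul_le_mul_of_nonneg_left hu2 (by positivity)
  have hfin : 1 + 2 * n + Y ^ 15 + u ≤ Δ / 8 * d ^ s := by
    have : Δ / 8 * u ≤ 1 * u := mul_le_mul_of_nonneg_right (by linarith) hu0.le
    linarith
  have hn3 : (n : ℝ) ≤ Real.exp n := by linarith [Real.add_one_le_exp (n : ℝ)]
  have two : (2 : ℝ) ≤ Real.exp 1 := by linarith [Real.add_one_le_exp (1 : ℝ)]
  calc _ ≤ Real.exp n ^ 2 * (Real.exp 1 * (Real.exp (Y ^ 15) * Real.exp u) *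
        Real.exp (-((1 / 2 + Δ / 4) * ((1 - Δ / 8) * d ^ s)))) := by
        gcongr
    _ = Real.exp (2 * n + (1 + (Y ^ 15 + u) + -((1 / 2 + Δ / 4) * ((1 - Δ / 8) * d ^ s)))) := by
        rw [← Real.exp_nat_mul]
        simp only [← Real.exp_add]
        norm_num
    _ ≤ _ := Real.exp_le_exp.2 ?_
  have hds : 0 ≤ d ^ s := Real.rpow_nonneg hd0.le s
  have hco : 1 / 2 + Δ / 8 ≤ (1 / 2 + Δ / 4) * (1 - Δ / 8) := by
    have := mul_nonneg hΔ.le (show 0 ≤ 2 - Δ by linarith)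
    linarith
  have := mul_le_mul_of_nonneg_right hco hds
  linarith

/-- At moderately large scales the perturbation is still smaller than the threshold of the reduced
scale. -/
theorem LargeScale.intermediate_bound (h : LargeScale n lam Δ γ A₀ Y) (hn : 1 ≤ n)
    (hN : (N : ℝ) = Real.exp Y) (hX : 4 * (n : ℝ) + 2 ^ 15 + 2 ≤ X) (hYX : Y ≤ X ^ 12) :
    2 * (((2 * N + 1) ^ n * n : ℕ) : ℝ) * (Real.exp (-(X ^ 20)) * Real.exp (X ^ 2)) ≤
      thr (subSize Y) := by
  have hn' : (1 : ℝ) ≤ n := by exact_mod_cast hn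
  have hX1 : 1 ≤ X := by linarith
  have hY0 : 0 ≤ Y := by linarith [h.one_le]
  have hV := card_le_exp hn hN h.one_le
  have two : (2 : ℝ) ≤ Real.exp 1 := by linarith [Real.add_one_le_exp (1 : ℝ)]
  have hY32 : Y ^ ((3 : ℝ) / 2) ≤ X ^ 18 := by
    calc _ ≤ (X ^ 12) ^ ((3 : ℝ) / 2) := Real.rpow_le_rpow hY0 hYX (by norm_num)
      _ = X ^ 18 := by
        rw [← Real.rpow_natCast, ← Real.rpow_natCast, ← Real.rpow_mul (by linarith)]
        norm_num
  have hlog := h.log_subSize_pow_le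
  calc _ ≤ Real.exp 1 * Real.exp (4 * n * Y) * (Real.exp (-(X ^ 20)) * Real.exp (X ^ 2)) := by
        gcongr
    _ = Real.exp (1 + 4 * n * Y + (-(X ^ 20) + X ^ 2)) := by simp only [← Real.exp_add]
    _ ≤ _ := Real.exp_le_exp.2 ?_
  have e1 : (1 : ℝ) ≤ X ^ 18 := one_le_pow₀ hX1
  have e2 : X ^ 2 ≤ X ^ 18 := pow_le_pow_right₀ hX1 (by norm_num)
  have e3 : X ^ 12 ≤ X ^ 18 := pow_le_pow_right₀ hX1 (by norm_num)
  have e4 : X ^ 18 * X ≤ X ^ 20 := by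
    rw [← pow_succ]; exact pow_le_pow_right₀ hX1 (by norm_num)
  have e5 : (4 * (n : ℝ) + 2 ^ 15 + 2) * X ^ 18 ≤ X * X ^ 18 :=
    mul_le_mul_of_nonneg_right hX (by positivity)
  have e6 : 4 * (n : ℝ) * Y ≤ 4 * n * X ^ 18 :=
    mul_le_mul_of_nonneg_left (hYX.trans e3) (by positivity)
  linarith

/-- As `s` is at least of the order of `1/X` and `X ≤ Y^{1/12}`, the decay `L^{s/2}` over the sub-box
still exceeds every power of `Y`: this is where the size `exp(Y^{1/10})` of the sub-box is needed. -/
theorem LargeScale.exp_le_subSize_rpow (h : LargeScale n lam Δ γ A₀ Y) (hlam : 0 < lam)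
    (hX : 1 ≤ X) (hXY : X ^ 12 ≤ Y) (hs : lam ≤ s * X) :
    Real.exp (lam / 8 * Y ^ ((1 : ℝ) / 60)) ≤ (subSize Y : ℝ) ^ (s / 2) := by
  have hY0 : 0 < Y := by linarith [h.one_le]
  have hX0 : 0 < X := by linarith
  have hspos : 0 < s := pos_of_mul_pos_left (hlam.trans_le hs) hX0.le
  have h1 : X ≤ Y ^ ((1 : ℝ) / 12) := by
    have := Real.rpow_le_rpow (by positivity) hXY (show (0 : ℝ) ≤ 1 / 12 by norm_num)
    rwa [← Real.rpow_natCast, ← Real.rpow_mul hX0.le,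
      show ((12 : ℕ) : ℝ) * (1 / 12) = 1 by norm_num, Real.rpow_one] at this
  have h2 : Y ^ ((1 : ℝ) / 60) * X ≤ Y ^ ((1 : ℝ) / 10) := by
    calc _ ≤ Y ^ ((1 : ℝ) / 60) * Y ^ ((1 : ℝ) / 12) :=
          mul_le_mul_of_nonneg_left h1 (by positivity)
      _ = _ := by rw [← Real.rpow_add hY0]; norm_num
  have h3 : lam * Y ^ ((1 : ℝ) / 60) ≤ s * Y ^ ((1 : ℝ) / 10) := by
    calc _ ≤ s * X * Y ^ ((1 : ℝ) / 60) := mul_le_mul_of_nonneg_right hs (by positivity)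
      _ = s * (Y ^ ((1 : ℝ) / 60) * X) := by ring
      _ ≤ _ := mul_le_mul_of_nonneg_left h2 hspos.le
  calc _ ≤ Real.exp (Y ^ ((1 : ℝ) / 10) * (s / 2)) := Real.exp_le_exp.2 (by
        nlinarith [mul_pos hlam (Real.rpow_pos_of_pos hY0 ((1 : ℝ) / 60))])
    _ = Real.exp (Y ^ ((1 : ℝ) / 10)) ^ (s / 2) := Real.exp_mul _ _
    _ ≤ _ := Real.rpow_le_rpow (Real.exp_nonneg _) (exp_le_subSize Y) (by positivity)

/-- At very large scales the decay over the size of a sub-box beats the inverse of the sub-box and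
the number of sites of the whole box. -/
theorem LargeScale.subbox_bound (h : LargeScale n lam Δ γ A₀ Y) (hn : 1 ≤ n) (hlam : 0 < lam)
    (hΔ : 0 < Δ) (hΔ1 : Δ ≤ 1 / 2) (hX : 1 ≤ X) (hXY : X ^ 12 ≤ Y)
    (hs : lam ≤ s * X) (hN : (N : ℝ) = Real.exp Y) {κ : ℝ} (hκ0 : 0 ≤ κ)
    (hκ : κ ≤ Real.exp (X ^ 2)) :
    (((2 * N + 1) ^ n * n : ℕ) : ℝ) *
      (2 * Real.exp (Real.log (subSize Y) ^ 15 + (subSize Y : ℝ) ^ (s / 2) / 2) * κ) *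
      (2 * (((2 * N + 1) ^ n * n : ℕ) : ℝ)) ≤ Real.exp (Δ / 4 * (subSize Y : ℝ) ^ s) := by
  have hL : (0 : ℝ) < subSize Y := by exact_mod_cast one_le_subSize Y
  have hpoly := h.poly_le hΔ (h.exp_le_subSize_rpow hlam hX hXY hs)
  set u := (subSize Y : ℝ) ^ (s / 2) with hu
  have hu2 : (subSize Y : ℝ) ^ s = u ^ 2 := by
    rw [hu, ← Real.rpow_natCast, ← Real.rpow_mul hL.le]; norm_num
  have hV := card_le_exp hn hN h.one_le
  have two : (2 : ℝ) ≤ Real.exp 1 := by linarith [Real.add_one_le_exp (1 : ℝ)]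
  have hXY' : X ≤ Y := le_trans (le_self_pow₀ hX (by norm_num)) hXY
  have hX2 : X ^ 2 ≤ Y ^ 2 := pow_le_pow_left₀ (by linarith) hXY' 2
  have e1 := h.pow_le (j := 0) (by norm_num)
  have e2 := h.pow_le (j := 1) (by norm_num)
  have e3 := h.pow_le (j := 2) (by norm_num)
  rw [pow_zero] at e1
  rw [pow_one] at e2
  have hu0 : 0 ≤ u := Real.rpow_nonneg hL.le _
  calc _ ≤ Real.exp (4 * n * Y) * (Real.exp 1 * Real.exp (2 ^ 15 * Y ^ 15 + u / 2) *
        Real.exp (Y ^ 2)) * (Real.exp 1 * Real.exp (4 * n * Y)) := by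
        gcongr
        · exact h.log_subSize_pow_le'
        · exact hκ.trans (Real.exp_le_exp.2 hX2)
    _ = Real.exp (4 * n * Y + (1 + (2 ^ 15 * Y ^ 15 + u / 2) + Y ^ 2) + (1 + 4 * n * Y)) := by
        simp only [← Real.exp_add]
    _ ≤ _ := Real.exp_le_exp.2 ?_
  have hnY : (n : ℝ) * Y ≤ n * Y ^ 15 := mul_le_mul_of_nonneg_left e2 (Nat.cast_nonneg n)
  have h1 : 4 * n * Y + (1 + 2 ^ 15 * Y ^ 15 + Y ^ 2) + (1 + 4 * n * Y) ≤ polyConst n * Y ^ 15 := by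
    rw [polyConst]; nlinarith
  have h2 : 2 ≤ Δ / 8 * u := by
    refine le_trans ?_ hpoly
    have : (0 : ℝ) ≤ n := Nat.cast_nonneg n
    rw [polyConst]; nlinarith
  have h3 : 1 ≤ u := by nlinarith
  rw [hu2]
  nlinarith

/-- The part of the operator that is not of Toeplitz type is negligible against the threshold of the
sub-box. -/
theorem LargeScale.hankel_bound (h : LargeScale n lam Δ γ A₀ Y) (hn : 1 ≤ n) (hlam : 0 < lam)
    (hγ : 0 < γ) (hX : 1 ≤ X) (hXY : X ^ ((5 : ℝ) / 4) ≤ Y) (hXY' : X ≤ Y)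
    (hs0 : 0 < s) (hs : lam ≤ s * X) (hN : (N : ℝ) = Real.exp Y) {K : ℝ} (hK0 : 0 ≤ K)
    (hK : K ≤ Real.exp (X ^ 2)) :
    (((2 * N + 1) ^ n * n : ℕ) : ℝ) ^ 2 * (K * Real.exp (-(γ * (N : ℝ) ^ s))) ≤
      thr (subSize Y) := by
  have hY0 : 0 < Y := by linarith [h.one_le]
  have hu : Real.exp (lam / 8 * Y ^ ((1 : ℝ) / 60)) ≤ (N : ℝ) ^ s := by
    refine (h.exp_le_rpow hlam hX hXY hs).trans ?_
    rw [hN, ← Real.exp_mul]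
    exact Real.exp_le_exp.2 (by nlinarith [mul_pos hs0 hY0])
  have hpoly := h.poly_le' hγ hu
  have hV := card_le_exp hn hN h.one_le
  have hX2 : X ^ 2 ≤ Y ^ 2 := pow_le_pow_left₀ (by linarith) hXY' 2
  have e1 := h.pow_le (j := 0) (by norm_num)
  have e2 := h.pow_le (j := 1) (by norm_num)
  have e3 := h.pow_le (j := 2) (by norm_num)
  rw [pow_zero] at e1
  rw [pow_one] at e2
  calc _ ≤ Real.exp (4 * n * Y) ^ 2 * (Real.exp (Y ^ 2) * Real.exp (-(γ * (N : ℝ) ^ s))) := by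
        gcongr
        exact hK.trans (Real.exp_le_exp.2 hX2)
    _ = Real.exp (2 * (4 * n * Y) + (Y ^ 2 + -(γ * (N : ℝ) ^ s))) := by
        rw [← Real.exp_nat_mul]
        simp only [← Real.exp_add]
        norm_num
    _ ≤ _ := Real.exp_le_exp.2 ?_
  have hnY : (n : ℝ) * Y ≤ n * Y ^ 15 := mul_le_mul_of_nonneg_left e2 (Nat.cast_nonneg n)
  have h1 : 2 * (4 * n * Y) + Y ^ 2 + 2 ^ 15 * Y ^ 15 ≤ polyConst n * Y ^ 15 := by
    rw [polyConst]; nlinarith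
  have := h.log_subSize_pow_le'
  linarith

end Scale

/-- At scales up to `exp(X^{5/4})` the perturbation is small against the square of the threshold of the
whole box. -/
theorem perturbative_bound {n N : ℕ} {X Y : ℝ} (hn : 1 ≤ n) (hN : (N : ℝ) = Real.exp Y) (hY0 : 0 ≤ Y)
    (hX : 5 * (n : ℝ) + 6 ≤ X) (hYX : Y ≤ X ^ ((5 : ℝ) / 4)) :
    4 * ((n : ℝ) ^ 2 * ((1 / thr N) ^ 2 * (Real.exp (-(X ^ 20)) * Real.exp (X ^ 2)) *
      (((2 * N + 1) ^ n * n : ℕ) : ℝ))) ≤ 1 := by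
  have hn' : (1 : ℝ) ≤ n := by exact_mod_cast hn
  have hX1 : 1 ≤ X := by linarith
  have h1 : (1 : ℝ) ≤ N := hN ▸ Real.one_le_exp hY0
  have h2 : 2 * (N : ℝ) + 1 ≤ Real.exp (2 + Y) := by
    rw [Real.exp_add, ← hN]
    nlinarith [Real.add_one_le_exp (2 : ℝ)]
  have h3 : (n : ℝ) ≤ Real.exp n := by linarith [Real.add_one_le_exp (n : ℝ)]
  have hV : (((2 * N + 1) ^ n * n : ℕ) : ℝ) ≤ Real.exp (n * (2 + Y) + n) := by
    push_cast
    calc (2 * (N : ℝ) + 1) ^ n * n ≤ Real.exp (2 + Y) ^ n * Real.exp n := by gcongr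
      _ = _ := by rw [← Real.exp_nat_mul, ← Real.exp_add]
  have hY15 : Y ^ 15 ≤ X ^ 19 := by
    calc Y ^ 15 ≤ (X ^ ((5 : ℝ) / 4)) ^ 15 := pow_le_pow_left₀ hY0 hYX 15
      _ = X ^ ((75 : ℝ) / 4) := by
        rw [← Real.rpow_natCast, ← Real.rpow_mul (by linarith)]; norm_num
      _ ≤ X ^ (19 : ℝ) := Real.rpow_le_rpow_of_exponent_le hX1 (by norm_num)
      _ = X ^ 19 := by rw [← Real.rpow_natCast]; norm_num
  have hYX2 : Y ≤ X ^ 19 := by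
    calc Y ≤ X ^ ((5 : ℝ) / 4) := hYX
      _ ≤ X ^ (19 : ℝ) := Real.rpow_le_rpow_of_exponent_le hX1 (by norm_num)
      _ = X ^ 19 := by rw [← Real.rpow_natCast]; norm_num
  rw [thr_of_eq_exp hN]
  have four : (4 : ℝ) ≤ Real.exp 3 := by linarith [Real.add_one_le_exp (3 : ℝ)]
  calc _ ≤ Real.exp 3 * (Real.exp n ^ 2 * (Real.exp (Y ^ 15) ^ 2 *
        (Real.exp (-(X ^ 20)) * Real.exp (X ^ 2)) * Real.exp (n * (2 + Y) + n))) := by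
        gcongr
    _ = Real.exp (3 + (2 * n + (2 * Y ^ 15 + (-(X ^ 20) + X ^ 2) + (n * (2 + Y) + n)))) := by
        rw [← Real.exp_nat_mul, ← Real.exp_nat_mul]
        simp only [← Real.exp_add]
        norm_num
    _ ≤ Real.exp 0 := Real.exp_le_exp.2 ?_
    _ = 1 := Real.exp_zero
  have e1 : (1 : ℝ) ≤ X ^ 19 := one_le_pow₀ hX1
  have e2 : X ^ 2 ≤ X ^ 19 := pow_le_pow_right₀ hX1 (by norm_num)
  have e4 : X ^ 20 = X ^ 19 * X := pow_succ X 19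
  have e5 : (5 * (n : ℝ) + 6) * X ^ 19 ≤ X * X ^ 19 :=
    mul_le_mul_of_nonneg_right hX (by positivity)
  have e6 : (n : ℝ) * Y ≤ n * X ^ 19 := mul_le_mul_of_nonneg_left hYX2 (by positivity)
  have e7 : (n : ℝ) * 1 ≤ n * X ^ 19 := mul_le_mul_of_nonneg_left e1 (by positivity)
  nlinarith

/-- As `1/s = O(X)`, the constants of the Gevrey class are at most `exp(O(X log X))`. -/
theorem eventually_kernelConst_le (n : ℕ) (C : ℝ) (hC : 0 ≤ C) (d : ℕ) {γ lam : ℝ}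
    (hγ1 : γ < 1) (hlam : 0 < lam) :
    ∀ᶠ X : ℝ in atTop, ∀ s : ℝ, 0 < s → s ≤ 1 → lam ≤ s * X →
      C * latticeSum n γ s ^ d ≤ Real.exp (X ^ 2) := by
  set g := 1 - γ with hg
  have hg0 : 0 < g := by rw [hg]; linarith
  set S := ∑' k : Lattice n, ((1 + len k) ^ (2 * n))⁻¹ with hS
  have hS0 : 0 ≤ S := tsum_nonneg fun k => inv_nonneg.2 (pow_nonneg (by
    linarith [len_nonneg k]) _)
  set a : ℝ := (2 * n + 1) / lam + 1 with ha
  have ha1 : 1 ≤ a := by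
    have : 0 ≤ (2 * (n : ℝ) + 1) / lam := by positivity
    linarith
  set C' : ℝ := C + d * g + d * S + d * a * |Real.log (a / g)| with hC'
  have hlog := Real.isLittleO_log_id_atTop.def (show (0 : ℝ) < 1 / (2 * (d * a + 1)) by positivity)
  filter_upwards [eventually_ge_atTop 1, eventually_ge_atTop (2 * C'), hlog] with X hX1 hXC hXl
  intro s hs hs1 hsX
  set q := ⌈(2 * (n : ℝ) + 1) / s⌉₊ with hq
  have hX0 : 0 < X := by linarith
  have hq1 : 2 * (n : ℝ) + 1 ≤ s * q := by
    have := Nat.le_ceil ((2 * (n : ℝ) + 1) / s)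
    rwa [div_le_iff₀ hs, mul_comm _ s] at this
  have hqX : (q : ℝ) ≤ a * X := by
    have h1 := (Nat.ceil_lt_add_one (show 0 ≤ (2 * (n : ℝ) + 1) / s by positivity)).le
    have h2 : (2 * (n : ℝ) + 1) / s ≤ (2 * n + 1) / lam * X := by
      rw [div_mul_eq_mul_div, div_le_div_iff₀ hs hlam]
      nlinarith [Nat.cast_nonneg (α := ℝ) n]
    rw [ha, add_mul, one_mul]
    linarith
  have hq0 : (0 : ℝ) ≤ q := Nat.cast_nonneg q
  have hx1 : 0 < a * X / g := by positivity
  have hfac : (q.factorial : ℝ) / g ^ q ≤ Real.exp (a * X * (|Real.log (a / g)| + |Real.log X|)) := by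
    have h1 : (q.factorial : ℝ) / g ^ q ≤ (a * X / g) ^ q := by
      rw [div_pow]
      refine div_le_div_of_nonneg_right ?_ (by positivity)
      calc (q.factorial : ℝ) ≤ (q : ℝ) ^ q := by exact_mod_cast Nat.factorial_le_pow q
        _ ≤ (a * X) ^ q := pow_le_pow_left₀ hq0 hqX q
    refine h1.trans ?_
    rw [← Real.exp_log (pow_pos hx1 q), Real.log_pow]
    refine Real.exp_le_exp.2 ?_
    have h2 : Real.log (a * X / g) ≤ |Real.log (a / g)| + |Real.log X| := by
      rw [mul_div_right_comm, Real.log_mul (by positivity) hX0.ne']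
      exact add_le_add (le_abs_self _) (le_abs_self _)
    exact (mul_le_mul_of_nonneg_left h2 hq0).trans
      (mul_le_mul_of_nonneg_right hqX (add_nonneg (abs_nonneg _) (abs_nonneg _)))
  have hW := latticeSum_le n hγ1 hs hs1 q hq1
  have hW0 : 0 ≤ latticeSum n γ s := le_trans zero_le_one (one_le_latticeSum hγ1 hs hs1)
  have hSe : S ≤ Real.exp S := by linarith [Real.add_one_le_exp S]
  have hCe : C ≤ Real.exp C := by linarith [Real.add_one_le_exp C]
  have hW' : latticeSum n γ s ≤
      Real.exp (g + a * X * (|Real.log (a / g)| + |Real.log X|) + S) := by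
    rw [Real.exp_add, Real.exp_add]
    refine hW.trans (mul_le_mul (mul_le_mul_of_nonneg_left hfac (Real.exp_nonneg _)) hSe hS0
      (by positivity))
  calc C * latticeSum n γ s ^ d
      ≤ Real.exp C * Real.exp (g + a * X * (|Real.log (a / g)| + |Real.log X|) + S) ^ d := by
        gcongr
    _ = Real.exp (C + d * (g + a * X * (|Real.log (a / g)| + |Real.log X|) + S)) := by
        rw [← Real.exp_nat_mul, ← Real.exp_add]
    _ ≤ _ := Real.exp_le_exp.2 ?_
  simp only [id, Real.norm_eq_abs, abs_of_pos hX0] at hXl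
  have h1 : d * a * |Real.log X| ≤ X / 2 := by
    rw [one_div_mul_eq_div, le_div_iff₀ (by positivity)] at hXl
    nlinarith [abs_nonneg (Real.log X)]
  have h2 : X * (d * a * |Real.log X|) ≤ X * (X / 2) := mul_le_mul_of_nonneg_left h1 hX0.le
  have h3 : C + d * g + d * S ≤ X * (C + d * g + d * S) :=
    le_mul_of_one_le_left (by positivity) hX1
  have h4 : X * C' ≤ X * (X / 2) := mul_le_mul_of_nonneg_left (by linarith) hX0.le
  rw [hC'] at h4
  nlinarith

/-! ### Localization from local resolvent inequalities -/

section Localization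

variable {n N : ℕ} {h : Coeffs n} {ε s Δ K : ℝ} {z : Lattice n → Vec n} {ω : Vec n} {k₀ : Lattice n}

theorem norm_opMatrix_le (hε : 0 ≤ ε)
    (hent : ∀ k ∈ box k₀ N, ∀ k' ∈ box k₀ N, ∀ i j,
      ‖tangent h z k i k' j + opB h z k i k' j‖ ≤ K * Real.exp (-((1 / 2 + Δ) * len (k - k') ^ s)))
    (x y : box k₀ N × Fin n) (hxy : x ≠ y) :
    ‖opMatrix h ε z ω k₀ N x y‖ ≤
      ε * K * Real.exp (-((1 / 2 + Δ) * len (x.1.1 - y.1.1) ^ s)) := by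
  have e : opMatrix h ε z ω k₀ N x y =
      (ε : ℂ) * (tangent h z x.1.1 x.2 y.1.1 y.2 + opB h z x.1.1 x.2 y.1.1 y.2) := by
    simp only [opMatrix, Matrix.of_apply, if_neg hxy]; ring
  rw [e, norm_mul, Complex.norm_real, Real.norm_of_nonneg hε, mul_assoc]
  exact mul_le_mul_of_nonneg_left (hent _ x.1.2 _ y.1.2 _ _) hε

theorem norm_inv_opMatrix_le (hinv : Inversion h ε z ω k₀ N) (x y : box k₀ N × Fin n) :
    ‖(opMatrix h ε z ω k₀ N)⁻¹ x y‖ ≤ 1 / thr N :=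
  (norm_entry_le_specNorm _ x y).trans hinv.2

theorem localization_of_entries
    (hloc : ∀ x q : box k₀ N × Fin n, (N : ℝ) ^ ((1 : ℝ) / 2) < len (x.1.1 - q.1.1) →
      (n : ℝ) ^ 2 * ‖(opMatrix h ε z ω k₀ N)⁻¹ x q‖ ≤ Real.exp (-(len (x.1.1 - q.1.1) ^ s) / 2)) :
    Localization h ε s z ω k₀ N := by
  intro k k' hkk
  rcases Nat.eq_zero_or_pos n with rfl | hn
  · refine (specNorm_le_of_norm_entry_le (r := 0) _ le_rfl fun i => i.elim0).trans ?_
    simpa using Real.exp_nonneg _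
  have hn2 : (0 : ℝ) < (n : ℝ) ^ 2 := by positivity
  have := specNorm_le_of_norm_entry_le (greenBlock h ε z ω k₀ N k k')
    (r := Real.exp (-(len (k.1 - k'.1) ^ s) / 2) / (n : ℝ) ^ 2) (by positivity) fun i j => by
      rw [le_div_iff₀ hn2, mul_comm]
      exact hloc (k, i) (k', j) hkk
  rw [Fintype.card_fin, mul_div_cancel₀ _ hn2.ne'] at this
  exact this

theorem len_sub_pos_ne {x q : box k₀ N × Fin n}
    (hx : (N : ℝ) ^ ((1 : ℝ) / 2) < len (x.1.1 - q.1.1)) : x ≠ q := by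
  rintro rfl
  rw [sub_self, len_zero] at hx
  exact absurd hx (not_lt.2 (by positivity))

/-- While the perturbation is small against the square of the threshold of the box, its decay passes to
the inverse directly. -/
theorem localization_of_perturbative (hn : 1 ≤ n) (hε : 0 ≤ ε) (hs0 : 0 < s) (hs1 : s ≤ 1)
    (hΔ : 0 ≤ Δ) (hK : 0 ≤ K) (hN : 1 ≤ N)
    (hent : ∀ k ∈ box k₀ N, ∀ k' ∈ box k₀ N, ∀ i j,
      ‖tangent h z k i k' j + opB h z k i k' j‖ ≤ K * Real.exp (-((1 / 2 + Δ) * len (k - k') ^ s)))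
    (hinv : Inversion h ε z ω k₀ N)
    (hsmall : 4 * ((n : ℝ) ^ 2 * ((1 / thr N) ^ 2 * (ε * K) *
      (((2 * N + 1) ^ n * n : ℕ) : ℝ))) ≤ 1) :
    Localization h ε s z ω k₀ N := by
  refine localization_of_entries fun x q hx => ?_
  have hn' : (1 : ℝ) ≤ n := by exact_mod_cast hn
  set B := 1 / thr N with hB
  have hB1 : 1 ≤ B := by
    rw [hB, thr, one_div, ← Real.exp_neg, neg_neg]
    exact Real.one_le_exp (pow_nonneg (Real.log_nonneg (by exact_mod_cast hN)) _)
  set c : ℝ := (((2 * N + 1) ^ n * n : ℕ) : ℝ) with hc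
  have hc0 : 0 ≤ c := Nat.cast_nonneg _
  have hεK : 0 ≤ ε * K := mul_nonneg hε hK
  have hdist : ∀ k : Lattice n, 0 ≤ len k ^ s := fun k => Real.rpow_nonneg (len_nonneg k) s
  have hn2 : 1 ≤ (n : ℝ) ^ 2 := one_le_pow₀ hn'
  have hmain := norm_inv_apply_le_of_small_coupling (opMatrix h ε z ω k₀ N) hinv.1 B (ε * K)
    (by linarith) hεK (norm_inv_opMatrix_le hinv) (fun x y => len (x.1.1 - y.1.1) ^ s / 2)
    (fun x y => by have := hdist (x.1.1 - y.1.1); positivity)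
    (fun x y w => by
      have := (Real.rpow_le_rpow (len_nonneg _) (len_sub_le_len_sub_add x.1.1 y.1.1 w.1.1) hs0.le).trans
        (rpow_add_le (len_nonneg _) (len_nonneg _) hs0.le hs1)
      linarith)
    (fun x y hxy => (norm_opMatrix_le hε hent x y hxy).trans (mul_le_mul_of_nonneg_left
      (Real.exp_le_exp.2 (by nlinarith [hdist (x.1.1 - y.1.1)])) hεK))
    (by
      rw [card_box]
      have h1 : B * (ε * K) * c ≤ B ^ 2 * (ε * K) * c := by
        have : B ≤ B ^ 2 := le_self_pow₀ hB1 (by norm_num)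
        gcongr
      have h2 : B ^ 2 * (ε * K) * c ≤ (n : ℝ) ^ 2 * (B ^ 2 * (ε * K) * c) :=
        le_mul_of_one_le_left (by positivity) hn2
      linarith) q (by simp [len_zero, Real.zero_rpow hs0.ne']) x (len_sub_pos_ne hx)
  rw [card_box] at hmain
  calc _ ≤ (n : ℝ) ^ 2 * (4 * B ^ 2 * (ε * K) * c * Real.exp (-(len (x.1.1 - q.1.1) ^ s / 2))) :=
        mul_le_mul_of_nonneg_left hmain (by positivity)
    _ = 4 * ((n : ℝ) ^ 2 * (B ^ 2 * (ε * K) * c)) * Real.exp (-(len (x.1.1 - q.1.1) ^ s) / 2) := by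
        ring_nf
    _ ≤ _ := mul_le_of_le_one_left (Real.exp_nonneg _) hsmall

/-- Localization at a large scale, from local resolvent inequalities off few clusters of bad sites. -/
theorem localization_of_good_sites {X Y lam γ A₀ : ℝ} (hY : LargeScale n lam Δ γ A₀ Y) (hn : 1 ≤ n)
    (hlam : 0 < lam) (hΔ : 0 < Δ) (hΔ1 : Δ ≤ 1 / 2) (hA : 0 < A₀) (hX : 1 ≤ X)
    (hXY : X ^ ((5 : ℝ) / 4) ≤ Y) (hXY' : X ≤ Y) (hs0 : 0 < s) (hs1 : s ≤ 1) (hs : lam ≤ s * X)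
    (hN : (N : ℝ) = Real.exp Y) (hε : 0 ≤ ε) (hε1 : ε ≤ 1) (hK : 0 ≤ K) (hKX : K ≤ Real.exp (X ^ 2))
    (hent : ∀ k ∈ box k₀ N, ∀ k' ∈ box k₀ N, ∀ i j,
      ‖tangent h z k i k' j + opB h z k i k' j‖ ≤ K * Real.exp (-((1 / 2 + Δ) * len (k - k') ^ s)))
    (hinv : Inversion h ε z ω k₀ N) (bad : box k₀ N × Fin n → Prop)
    (hgood : ∀ q x, ¬ bad x → ∃ Γ : box k₀ N × Fin n → ℝ, (∀ y, 0 ≤ Γ y) ∧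
      (∀ y, Γ y * (2 * (((2 * N + 1) ^ n * n : ℕ) : ℝ)) ≤
        Real.exp (-((1 / 2 + Δ / 2) * gauge s (A₀ * subSize Y) (len (x.1.1 - y.1.1))))) ∧
      ‖(opMatrix h ε z ω k₀ N)⁻¹ x q‖ ≤ 1 / thr N * Real.exp ((2 * n * (subSize Y : ℝ)) ^ s) *
        Real.exp (-((1 / 2 + Δ / 2) * gauge s (A₀ * subSize Y) (len (x.1.1 - q.1.1)))) +
        ∑ y, Γ y * ‖(opMatrix h ε z ω k₀ N)⁻¹ y q‖)
    {ι : Type*} [Fintype ι] (cl : ι → box k₀ N × Fin n → Prop) (hcl : ∀ x, bad x → ∃ i, cl i x)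
    (hm : Fintype.card ι ≤ (2 * subSize Y + 1) ^ n * n)
    (hD : ∀ i x y, cl i x → cl i y → len (x.1.1 - y.1.1) ≤ ((4 * n * subSize Y : ℕ) : ℝ)) :
    Localization h ε s z ω k₀ N := by
  refine localization_of_entries fun x q hx => ?_
  have hL : (0 : ℝ) < subSize Y := by exact_mod_cast one_le_subSize Y
  have hεK : 0 ≤ ε * K := mul_nonneg hε hK
  have hεK' : ε * K ≤ Real.exp (X ^ 2) := (mul_le_of_le_one_left hK hε1).trans hKX
  have hB0 : 0 ≤ 1 / thr N := one_div_nonneg.2 (Real.exp_nonneg _)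
  have hfin := hY.final_bound hn hlam hΔ hΔ1 hA hX hXY hs0 hs1 hs hN
    (hY.removed_le hn hΔ hA.le) hx
  -- A quarter of `Δ` each is spent on the cut-off across the clusters and on the final estimate; the
  -- remaining half was used by the local resolvent inequalities.
  have hrate : (1 / 2 + Δ / 4) + Δ / 4 = 1 / 2 + Δ / 2 := by ring
  have hmain := norm_inv_apply_le_of_clusters (opMatrix h ε z ω k₀ N) hinv.1 (s := s)
    (ℓ := A₀ * subSize Y) (b := 1 / 2 + Δ / 4) (b' := Δ / 4) (B := 1 / thr N)
    (A := 1 / thr N * Real.exp ((2 * n * (subSize Y : ℝ)) ^ s)) (κ := ε * K) hs0.le hs1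
    (mul_pos hA hL) (by linarith) (by linarith) hB0
    (le_mul_of_one_le_right hB0 (Real.one_le_exp (Real.rpow_nonneg (by positivity) s))) hεK
    (norm_inv_opMatrix_le hinv)
    (fun x y hxy => (norm_opMatrix_le hε hent x y hxy).trans (mul_le_mul_of_nonneg_left
      (Real.exp_le_exp.2 (neg_le_neg ?_)) hεK))
    ⌈Real.exp (Y / 8)⌉₊
    (by
      rw [card_box]
      exact hY.cutoff_bound hn hlam hΔ hΔ1 hA hX hXY hs0 hs1 hs hN hεK hεK' hXY')
    q bad (by rw [hrate, card_box]; exact hgood q) cl hcl (4 * n * subSize Y)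
    ((2 * subSize Y + 1) ^ n * n) hm hD x hfin.1
  · refine le_trans ?_ hfin.2
    exact mul_le_mul_of_nonneg_left hmain (by positivity)
  · rw [hrate]
    have h1 := gauge_le_rpow (ℓ := A₀ * subSize Y) hs1 (len_nonneg (x.1.1 - y.1.1))
    have h2 := gauge_nonneg (s := s) (ℓ := A₀ * subSize Y) (len_nonneg (x.1.1 - y.1.1))
    nlinarith

/-- Shifts of the frequency that nearly agree belong to nearby sites. -/
theorem len_le_of_not_diffResonant {Ω : Set (Vec n)} {zhat : Vec n → Lattice n → Vec n} (hn : 1 ≤ n)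
    (hω : ω ∈ Ω) (hres : ω ∉ diffResonant h Ω ε zhat) (hNM : bigM ε < N) {k k' : Lattice n}
    (hk : k ∈ box k₀ N) (hk' : k' ∈ box k₀ N)
    (hclose : |pair (k - k') (drift h ε (zhat ω) ω)| < 4 * thr (reduced N)) :
    len (k - k') ≤ n * (2 * reduced N) := by
  have hbox : InBox (2 * (N : ℝ)) (k - k') := by
    intro i
    have a1 : |(k i : ℝ) - k₀ i| ≤ N := by exact_mod_cast mem_box_iff.1 hk i
    have a2 : |(k' i : ℝ) - k₀ i| ≤ N := by exact_mod_cast mem_box_iff.1 hk' i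
    rw [abs_le] at a1 a2
    rw [Pi.sub_apply, Int.cast_sub, abs_le]
    constructor <;> linarith
  have hin : InBox (2 * reduced N) (k - k') := by
    by_contra hout
    refine hres ⟨N, hNM, hω, k - k', hbox, hout, ⟨0, hn⟩, ⟨0, hn⟩, ?_⟩
    rwa [add_sub_cancel_right, abs_neg]
  refine (Finset.sum_le_card_nsmul _ _ _ fun i _ => hin i).trans (le_of_eq ?_)
  rw [Finset.card_univ, Fintype.card_fin, nsmul_eq_mul]

theorem reduced_eq {Y : ℝ} (hN : (N : ℝ) = Real.exp Y) : reduced N = Real.exp (Y ^ ((1 : ℝ) / 10)) := by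
  rw [reduced, hN, Real.log_exp]

theorem thr_anti {x y : ℝ} (hx : 1 ≤ x) (hxy : x ≤ y) : thr y ≤ thr x := by
  refine Real.exp_le_exp.2 (neg_le_neg (pow_le_pow_left₀ (Real.log_nonneg hx) ?_ 15))
  exact Real.log_le_log (by linarith) hxy

end Localization

end DimEnlargedNewton

namespace DimEnlargedNewton

/-! ### Sites with a small diagonal entry -/

section SmallDiagonal

variable {n N : ℕ} {h : Coeffs n} {ε s Δ K : ℝ} {ω : Vec n} {k₀ : Lattice n}

theorem reduced_le_subSize {Y : ℝ} (hN : (N : ℝ) = Real.exp Y) : reduced N ≤ subSize Y :=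
  (reduced_eq hN).le.trans (exp_le_subSize Y)

theorem thr_subSize_le {Y : ℝ} (hY : 0 ≤ Y) (hN : (N : ℝ) = Real.exp Y) :
    thr (subSize Y) ≤ thr (reduced N) :=
  thr_anti (by rw [reduced_eq hN]; exact Real.one_le_exp (Real.rpow_nonneg hY _))
    (reduced_le_subSize hN)

/-- Localization at scales where the perturbation is smaller than the threshold of the reduced scale:
a site is bad when its diagonal entry is below this threshold, and by the absence of difference
resonances the bad sites of a given component are close to each other. -/
theorem localization_of_small_diagonal {X Y lam γ A₀ : ℝ} {Ω : Set (Vec n)}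
    {zhat : Vec n → Lattice n → Vec n}
    (hY : LargeScale n lam Δ γ A₀ Y) (hn : 1 ≤ n)
    (hlam : 0 < lam) (hΔ : 0 < Δ) (hΔ1 : Δ ≤ 1 / 2) (hA : 0 < A₀) (hX : 1 ≤ X)
    (hXY : X ^ ((5 : ℝ) / 4) ≤ Y) (hXY' : X ≤ Y) (hs0 : 0 < s) (hs1 : s ≤ 1) (hs : lam ≤ s * X)
    (hN : (N : ℝ) = Real.exp Y) (hε : 0 ≤ ε) (hε1 : ε ≤ 1) (hK : 0 ≤ K) (hKX : K ≤ Real.exp (X ^ 2))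
    (hent : ∀ k ∈ box k₀ N, ∀ k' ∈ box k₀ N, ∀ i j,
      ‖tangent h (zhat ω) k i k' j + opB h (zhat ω) k i k' j‖ ≤
        K * Real.exp (-((1 / 2 + Δ) * len (k - k') ^ s)))
    (hω : ω ∈ Ω) (hres : ω ∉ diffResonant h Ω ε zhat) (hNM : bigM ε < N)
    (hsmall : 2 * (((2 * N + 1) ^ n * n : ℕ) : ℝ) * (ε * K) ≤ thr (subSize Y))
    (hinv : Inversion h ε (zhat ω) ω k₀ N) :
    Localization h ε s (zhat ω) ω k₀ N := by
  classical
  have hY0 : 0 ≤ Y := by linarith [hY.one_le]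
  set L := subSize Y with hL
  set V : ℝ := (((2 * N + 1) ^ n * n : ℕ) : ℝ) with hV
  have hδ : 0 < thr L := Real.exp_pos _
  have hεK : 0 ≤ ε * K := mul_nonneg hε hK
  have hV1 : 1 ≤ V := by
    rw [hV]; exact_mod_cast Nat.mul_pos (by positivity) hn
  have hεKδ : ε * K ≤ thr L := by nlinarith
  have hL1 : (1 : ℝ) ≤ L := by exact_mod_cast one_le_subSize Y
  have hLN : (L : ℝ) ≤ N := by
    have h1 := hY.two_mul_subSize_le hΔ hA.le
    have h2 : Real.exp (Y / 8) ≤ N := hN ▸ Real.exp_le_exp.2 (by linarith)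
    have h3 : (1 : ℝ) ≤ n := by exact_mod_cast hn
    nlinarith
  set D : box k₀ N × Fin n → ℝ := fun x => -(pair x.1.1 (drift h ε (zhat ω) ω)) + ω x.2 with hD
  refine localization_of_good_sites hY hn hlam hΔ hΔ1 hA hX hXY hXY' hs0 hs1 hs hN hε hε1 hK hKX
    hent hinv (fun x => |D x| < 2 * thr L) (fun q x hx => ?_)
    (ι := Fin n) (fun j x => x.2 = j ∧ |D x| < 2 * thr L) (fun x hx => ⟨x.2, rfl, hx⟩) ?_ ?_
  · set T := opMatrix h ε (zhat ω) ω k₀ N with hT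
    have hdiag : thr L ≤ ‖T x x‖ := by
      have e : T x x = ((D x : ℝ) : ℂ) +
          (ε : ℂ) * (tangent h (zhat ω) x.1.1 x.2 x.1.1 x.2 +
            opB h (zhat ω) x.1.1 x.2 x.1.1 x.2) := by
        simp only [hT, opMatrix, Matrix.of_apply, if_true, hD]; ring
      have h1 := hent _ x.1.2 _ x.1.2 x.2 x.2
      rw [sub_self, len_zero, Real.zero_rpow hs0.ne', mul_zero, neg_zero, Real.exp_zero,
        mul_one] at h1
      have h2 := norm_sub_le_norm_add ((D x : ℝ) : ℂ)
        ((ε : ℂ) * (tangent h (zhat ω) x.1.1 x.2 x.1.1 x.2 + opB h (zhat ω) x.1.1 x.2 x.1.1 x.2))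
      rw [← e, norm_mul, Complex.norm_real, Complex.norm_real, Real.norm_of_nonneg hε,
        Real.norm_eq_abs] at h2
      have h3 := mul_le_mul_of_nonneg_left h1 hε
      have h4 := not_lt.1 hx
      linarith
    have hg0 : ∀ y, 0 ≤ if y = x then 0 else ‖T x y‖ / thr L := fun y => by
      split_ifs
      · exact le_rfl
      · positivity
    refine ⟨fun y => if y = x then 0 else ‖T x y‖ / thr L, hg0, fun y => ?_, ?_⟩
    · by_cases hyx : y = x
      · simp only [if_pos hyx, zero_mul]; exact (Real.exp_pos _).le
      · simp only [if_neg hyx]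
        have h1 := norm_opMatrix_le (ω := ω) hε hent x y (Ne.symm hyx)
        have hd0 := len_nonneg (x.1.1 - y.1.1)
        have h2 := gauge_le_rpow (ℓ := A₀ * L) hs1 hd0
        have h3 := Real.rpow_nonneg hd0 s
        rw [div_mul_eq_mul_div, div_le_iff₀ hδ]
        calc _ ≤ ε * K * Real.exp (-((1 / 2 + Δ) * len (x.1.1 - y.1.1) ^ s)) * (2 * V) :=
              mul_le_mul_of_nonneg_right h1 (by linarith)
          _ = Real.exp (-((1 / 2 + Δ) * len (x.1.1 - y.1.1) ^ s)) * (2 * V * (ε * K)) := by ring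
          _ ≤ _ := mul_le_mul (Real.exp_le_exp.2 (neg_le_neg
            (mul_le_mul (by linarith) h2 (gauge_nonneg hd0) (by linarith)))) hsmall
            (by positivity) (Real.exp_nonneg _)
    · have h1 := norm_diag_mul_norm_inv_apply_le T hinv.1 q x
      have h2 := (mul_le_mul_of_nonneg_right hdiag (norm_nonneg (T⁻¹ x q))).trans h1
      rw [mul_comm, ← le_div_iff₀ hδ, add_div] at h2
      refine h2.trans (add_le_add ?_ (le_of_eq ?_))
      · have hB := one_div_le_one_div_of_le (Real.exp_pos _) (thr_anti hL1 hLN)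
        have hE : 1 ≤ Real.exp ((2 * n * (L : ℝ)) ^ s) := Real.one_le_exp (by positivity)
        have hB0 : 0 < 1 / thr N := one_div_pos.2 (Real.exp_pos _)
        split_ifs with hxq
        · subst hxq
          rw [sub_self, len_zero, gauge_zero, mul_zero, neg_zero, Real.exp_zero, mul_one]
          exact hB.trans (le_mul_of_one_le_right hB0.le hE)
        · rw [zero_div]; positivity
      · rw [Finset.sum_div, ← Finset.add_sum_erase _ _ (Finset.mem_univ x)]
        simp only [if_true, zero_mul, zero_add]
        refine Finset.sum_congr rfl fun y hy => ?_
        rw [if_neg (Finset.ne_of_mem_erase hy), div_mul_eq_mul_div]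
  · rw [Fintype.card_fin]
    exact Nat.le_mul_of_pos_left n (by positivity)
  · rintro j x y ⟨hxj, hx⟩ ⟨hyj, hy⟩
    have hclose : |pair (x.1.1 - y.1.1) (drift h ε (zhat ω) ω)| < 4 * thr (reduced N) := by
      have e : pair (x.1.1 - y.1.1) (drift h ε (zhat ω) ω) = D y - D x := by
        simp only [hD, pair_sub, hxj, hyj]; ring
      have h1 := abs_sub (D y) (D x)
      have h2 := thr_subSize_le hY0 hN
      rw [e]
      linarith
    refine (len_le_of_not_diffResonant hn hω hres hNM x.1.2 y.1.2 hclose).trans ?_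
    have h1 := reduced_le_subSize hN
    have h2 : (0 : ℝ) ≤ n := Nat.cast_nonneg n
    push_cast
    rw [← hL]
    nlinarith [mul_le_mul_of_nonneg_left h1 h2]

end SmallDiagonal

/-! ### Sub-boxes -/

section SubBoxes

variable {n N : ℕ} {h : Coeffs n} {ε s Δ K : ℝ} {ω : Vec n} {k₀ : Lattice n}

theorem OffSide.of_mem_box {L : ℕ} {c : Lattice n} (hk₀ : OffSide k₀ N) (hc : c ∈ box k₀ N)
    (hLN : 2 * L < N) : OffSide c L := by
  obtain ⟨i, hi⟩ := hk₀.exists_coord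
  have h1 := (hi c hc c hc).1
  have h2 : 2 * (L : ℝ) < N := by exact_mod_cast hLN
  exact fun hin => absurd (hin i) (not_le.2 (by linarith))

theorem len_sub_center_le {c k : Lattice n} {L : ℕ} (hk : k ∈ box c L) : len (k - c) ≤ n * L := by
  have h1 : ∀ i ∈ Finset.univ, |(((k - c) i : ℤ) : ℝ)| ≤ L := by
    intro i _
    exact_mod_cast mem_box_iff.1 hk i
  refine (Finset.sum_le_card_nsmul _ _ _ h1).trans (le_of_eq ?_)
  rw [Finset.card_univ, Fintype.card_fin, nsmul_eq_mul]

/-- The inclusion of the index set of a sub-box. -/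
def subboxIncl {c : Lattice n} {L : ℕ} (hsub : box c L ⊆ box k₀ N) (x : box c L × Fin n) :
    box k₀ N × Fin n := (⟨x.1.1, hsub x.1.2⟩, x.2)

theorem subboxIncl_injective {c : Lattice n} {L : ℕ} (hsub : box c L ⊆ box k₀ N) :
    Function.Injective (subboxIncl hsub) := by
  rintro ⟨⟨a, ha⟩, i⟩ ⟨⟨b, hb⟩, j⟩ hab
  simpa [subboxIncl] using hab

theorem opMatrix_submatrix {z : Lattice n → Vec n} {c : Lattice n} {L : ℕ}
    (hsub : box c L ⊆ box k₀ N) :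
    (opMatrix h ε z ω k₀ N).submatrix (subboxIncl hsub) (subboxIncl hsub) =
      opMatrix h ε z ω c L := by
  ext p q
  simp only [opMatrix, Matrix.submatrix_apply, Matrix.of_apply,
    (subboxIncl_injective hsub).eq_iff]
  rfl

/-- Where `|k + k'|` dominates `|k - k'|`, two-sided localization is one-sided. -/
theorem norm_inv_le_of_localizationTwoSided {z : Lattice n → Vec n} {c : Lattice n} {L : ℕ}
    (hs0 : 0 < s) (hL : 1 ≤ L) (hinv : Inversion h ε z ω c L)
    (hloc : LocalizationTwoSided h ε s z ω c L)
    (hsum : ∀ k ∈ box c L, ∀ k' ∈ box c L, len (k - k') ≤ len (k + k'))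
    (x y : box c L × Fin n) :
    ‖(opMatrix h ε z ω c L)⁻¹ x y‖ ≤
      2 * Real.exp (Real.log L ^ 15 + (L : ℝ) ^ (s / 2) / 2) *
        Real.exp (-(len (x.1.1 - y.1.1) ^ s) / 2) := by
  have hlog : 0 ≤ Real.log L ^ 15 := pow_nonneg (Real.log_nonneg (by exact_mod_cast hL)) _
  have hu : 0 ≤ (L : ℝ) ^ (s / 2) := Real.rpow_nonneg (Nat.cast_nonneg L) _
  have hd := len_nonneg (x.1.1 - y.1.1)
  rcases le_or_gt (len (x.1.1 - y.1.1)) ((L : ℝ) ^ ((1 : ℝ) / 2)) with hle | hgt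
  · have h1 := (norm_entry_le_specNorm _ x y).trans hinv.2
    have h2 : len (x.1.1 - y.1.1) ^ s ≤ (L : ℝ) ^ (s / 2) := by
      refine (Real.rpow_le_rpow hd hle hs0.le).trans (le_of_eq ?_)
      rw [← Real.rpow_mul (Nat.cast_nonneg L)]; congr 1; ring
    rw [thr, one_div, ← Real.exp_neg, neg_neg] at h1
    rw [mul_assoc, ← Real.exp_add]
    calc _ ≤ Real.exp (Real.log L ^ 15) := h1
      _ ≤ Real.exp (Real.log L ^ 15 + (L : ℝ) ^ (s / 2) / 2 + -(len (x.1.1 - y.1.1) ^ s) / 2) :=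
        Real.exp_le_exp.2 (by linarith)
      _ ≤ _ := le_mul_of_one_le_left (Real.exp_nonneg _) one_le_two
  · have hsum' := hsum _ x.1.2 _ y.1.2
    have h1 := (norm_entry_le_specNorm (greenBlock h ε z ω c L x.1 y.1) x.2 y.2).trans
      (hloc x.1 y.1 hgt (hgt.trans_le hsum'))
    have h2 : len (x.1.1 - y.1.1) ^ s ≤ len (x.1.1 + y.1.1) ^ s := Real.rpow_le_rpow hd hsum' hs0.le
    have h3 : Real.exp (-(len (x.1.1 + y.1.1) ^ s) / 2) ≤ Real.exp (-(len (x.1.1 - y.1.1) ^ s) / 2) :=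
      Real.exp_le_exp.2 (by linarith)
    have h4 : 1 ≤ Real.exp (Real.log L ^ 15 + (L : ℝ) ^ (s / 2) / 2) :=
      Real.one_le_exp (by positivity)
    have h5 := mul_le_mul_of_nonneg_right h4
      (Real.exp_pos (-(len (x.1.1 - y.1.1) ^ s) / 2)).le
    calc _ ≤ Real.exp (-(len (x.1.1 - y.1.1) ^ s) / 2) +
          Real.exp (-(len (x.1.1 + y.1.1) ^ s) / 2) := h1
      _ ≤ _ := by linarith

/-- A path of two steps: a step inside a sub-box followed by a step leaving it. -/
theorem norm_mul_norm_le_of_gauge_step {s₀ θ A₀ E κ : ℝ} {L : ℕ} {c k k' l : Lattice n} {u v : ℂ}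
    (hs0 : 0 < s) (hss : s ≤ s₀) (hs₀ : s₀ < 1) (hθ : 0 < θ) (hθ1 : θ ≤ 1)
    (hθs : θ ^ (1 - s₀) ≤ 1 / 2) (hΔ : 0 < Δ) (hΔ1 : Δ ≤ 1 / 2) (hAθ : 8 * n ≤ Δ * θ * A₀)
    (hE : 0 ≤ E) (hκ : 0 ≤ κ) (hk : k ∈ box c L) (hk' : k' ∈ box c L)
    (hfar : (L : ℝ) ^ s ≤ len (k - l) ^ s)
    (hu : ‖u‖ ≤ 2 * E * Real.exp (-(len (k - k') ^ s) / 2))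
    (hv : ‖v‖ ≤ κ * Real.exp (-((1 / 2 + Δ) * len (k' - l) ^ s))) :
    ‖u‖ * ‖v‖ ≤ 2 * E * κ *
      Real.exp (-((1 / 2 + Δ / 2) * gauge s (A₀ * L) (len (k - l)) + Δ / 4 * (L : ℝ) ^ s)) := by
  have hL0 : (0 : ℝ) ≤ L := Nat.cast_nonneg L
  have hR : 2 * n * (L : ℝ) ≤ Δ / 4 * (θ * (A₀ * L)) := by
    have := mul_le_mul_of_nonneg_right hAθ hL0
    linarith
  have h3 := gauge_step hs0 hss hs₀ hθ hθ1 hθs hΔ hΔ1 (len_nonneg (k - k')) (len_nonneg (k' - l))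
    (len_nonneg (k - l)) (len_sub_le_of_mem_box hk hk') hR (len_sub_le_len_sub_add k k' l)
  have h4 := mul_le_mul_of_nonneg_left hfar (show 0 ≤ Δ / 4 by linarith)
  calc _ ≤ 2 * E * Real.exp (-(len (k - k') ^ s) / 2) *
        (κ * Real.exp (-((1 / 2 + Δ) * len (k' - l) ^ s))) :=
        mul_le_mul hu hv (norm_nonneg _) (by positivity)
    _ = 2 * E * κ * Real.exp (-(len (k - k') ^ s) / 2 + -((1 / 2 + Δ) * len (k' - l) ^ s)) := by
        rw [Real.exp_add]; ring
    _ ≤ _ := mul_le_mul_of_nonneg_left (Real.exp_le_exp.2 (by linarith)) (by positivity)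

/-- The resolvent identity at a site of a sub-box whose inverse is localized: the contributions of the
sites outside the sub-box are small and decay at a rate beyond `1/2`. -/
theorem local_resolvent_of_subbox {X Y lam γ A₀ s₀ θ : ℝ} {z : Lattice n → Vec n}
    (hY : LargeScale n lam Δ γ A₀ Y) (hn : 1 ≤ n)
    (hlam : 0 < lam) (hΔ : 0 < Δ) (hΔ1 : Δ ≤ 1 / 2) (hA : 0 < A₀) (hX : 1 ≤ X)
    (hXY : X ^ 12 ≤ Y) (hs0 : 0 < s) (hss : s ≤ s₀) (hs₀ : s₀ < 1)
    (hs : lam ≤ s * X) (hθ : 0 < θ) (hθ1 : θ ≤ 1) (hθs : θ ^ (1 - s₀) ≤ 1 / 2)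
    (hAθ : 8 * n ≤ Δ * θ * A₀)
    (hN : (N : ℝ) = Real.exp Y) (hε : 0 ≤ ε) (hε1 : ε ≤ 1) (hK : 0 ≤ K) (hKX : K ≤ Real.exp (X ^ 2))
    (hent : ∀ k ∈ box k₀ N, ∀ k' ∈ box k₀ N, ∀ i j,
      ‖tangent h z k i k' j + opB h z k i k' j‖ ≤ K * Real.exp (-((1 / 2 + Δ) * len (k - k') ^ s)))
    (hinv : Inversion h ε z ω k₀ N) {c : Lattice n} (hsub : box c (subSize Y) ⊆ box k₀ N)
    (hinvc : Inversion h ε z ω c (subSize Y))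
    (hG : ∀ x y : box c (subSize Y) × Fin n, ‖(opMatrix h ε z ω c (subSize Y))⁻¹ x y‖ ≤
      2 * Real.exp (Real.log (subSize Y) ^ 15 + (subSize Y : ℝ) ^ (s / 2) / 2) *
        Real.exp (-(len (x.1.1 - y.1.1) ^ s) / 2))
    (x : box k₀ N × Fin n) (hx : x.1.1 ∈ box c (subSize Y))
    (hfar : ∀ y ∈ box k₀ N, y ∉ box c (subSize Y) → (subSize Y : ℝ) ≤ len (x.1.1 - y))
    (q : box k₀ N × Fin n) :
    ∃ Γ : box k₀ N × Fin n → ℝ, (∀ y, 0 ≤ Γ y) ∧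
      (∀ y, Γ y * (2 * (((2 * N + 1) ^ n * n : ℕ) : ℝ)) ≤
        Real.exp (-((1 / 2 + Δ / 2) * gauge s (A₀ * subSize Y) (len (x.1.1 - y.1.1))))) ∧
      ‖(opMatrix h ε z ω k₀ N)⁻¹ x q‖ ≤ 1 / thr N * Real.exp ((2 * n * (subSize Y : ℝ)) ^ s) *
        Real.exp (-((1 / 2 + Δ / 2) * gauge s (A₀ * subSize Y) (len (x.1.1 - q.1.1)))) +
        ∑ y, Γ y * ‖(opMatrix h ε z ω k₀ N)⁻¹ y q‖ := by
  classical
  have hs1 : s ≤ 1 := by linarith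
  have hbound := hY.subbox_bound hn hlam hΔ hΔ1 hX hXY hs hN (mul_nonneg hε hK)
    ((mul_le_of_le_one_left hK hε1).trans hKX)
  have hL1 : (1 : ℝ) ≤ subSize Y := by exact_mod_cast one_le_subSize Y
  have hn' : (1 : ℝ) ≤ n := by exact_mod_cast hn
  have hLN : 2 * n * (subSize Y : ℝ) ≤ N := (hY.two_mul_subSize_le hΔ hA.le).trans
    (hN ▸ Real.exp_le_exp.2 (by linarith [hY.one_le]))
  have hLN1 : (subSize Y : ℝ) ≤ N := by nlinarith
  set L := subSize Y with hL
  set V : ℝ := (((2 * N + 1) ^ n * n : ℕ) : ℝ) with hV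
  set E : ℝ := Real.exp (Real.log L ^ 15 + (L : ℝ) ^ (s / 2) / 2) with hE
  have hE0 : 0 < E := Real.exp_pos _
  set T := opMatrix h ε z ω k₀ N with hT
  set f : box c L × Fin n → box k₀ N × Fin n := subboxIncl hsub with hf
  have hTf : T.submatrix f f = opMatrix h ε z ω c L := opMatrix_submatrix hsub
  set x₀ : box c L × Fin n := (⟨x.1.1, hx⟩, x.2) with hx₀
  have hfx : f x₀ = x := rfl
  have hres := norm_inv_apply_le_of_submatrix T hinv.1 f (subboxIncl_injective hsub)
    (by rw [hTf]; exact hinvc.1) x₀ q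
  rw [hTf, hfx] at hres
  set G := (opMatrix h ε z ω c L)⁻¹ with hGdef
  have hεK : 0 ≤ ε * K := mul_nonneg hε hK
  have hV0 : 0 ≤ V := Nat.cast_nonneg _
  have hcard : (Fintype.card (box c L × Fin n) : ℝ) ≤ V := by
    rw [card_box, hV]
    have : L ≤ N := by exact_mod_cast hLN1
    exact_mod_cast Nat.mul_le_mul_right n (Nat.pow_le_pow_left (by omega) n)
  have hΓ0 : ∀ y, 0 ≤ ∑ x', ‖G x₀ x'‖ * (if y ∈ Set.range f then 0 else ‖T (f x') y‖) :=
    fun y => Finset.sum_nonneg fun x' _ => mul_nonneg (norm_nonneg _) (by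
      split_ifs
      · exact le_rfl
      · exact norm_nonneg _)
  refine ⟨_, hΓ0, fun y => ?_, hres.trans (add_le_add_left ?_ _)⟩
  · by_cases hy : y ∈ Set.range f
    · simp only [if_pos hy, mul_zero, Finset.sum_const_zero, zero_mul]
      exact (Real.exp_pos _).le
    simp only [if_neg hy]
    have hyc : y.1.1 ∉ box c L := fun hyc => hy ⟨(⟨y.1.1, hyc⟩, y.2), rfl⟩
    set d := len (x.1.1 - y.1.1) with hd
    have hd0 : 0 ≤ d := len_nonneg _
    have hdL : (L : ℝ) ^ s ≤ d ^ s :=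
      Real.rpow_le_rpow (by linarith) (hfar _ y.1.2 hyc) hs0.le
    set g := gauge s (A₀ * L) d with hg
    have hterm : ∀ x', ‖G x₀ x'‖ * ‖T (f x') y‖ ≤
        2 * E * (ε * K) * Real.exp (-((1 / 2 + Δ / 2) * g + Δ / 4 * (L : ℝ) ^ s)) := by
      intro x'
      have hne : f x' ≠ y := fun he => hy ⟨x', he⟩
      exact norm_mul_norm_le_of_gauge_step hs0 hss hs₀ hθ hθ1 hθs hΔ hΔ1 hAθ hE0.le hεK
        hx x'.1.2 hdL (hG x₀ x') (norm_opMatrix_le hε hent (f x') y hne)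
    have hsum := Finset.sum_le_card_nsmul Finset.univ _ _ fun x' _ => hterm x'
    rw [nsmul_eq_mul, Finset.card_univ] at hsum
    calc _ ≤ V * (2 * E * (ε * K) * Real.exp (-((1 / 2 + Δ / 2) * g + Δ / 4 * (L : ℝ) ^ s))) *
          (2 * V) := by
          refine mul_le_mul_of_nonneg_right (hsum.trans ?_) (by positivity)
          exact mul_le_mul_of_nonneg_right hcard (by positivity)
      _ = V * (2 * E * (ε * K)) * (2 * V) *
          Real.exp (-((1 / 2 + Δ / 2) * g + Δ / 4 * (L : ℝ) ^ s)) := by ring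
      _ ≤ Real.exp (Δ / 4 * (L : ℝ) ^ s) *
          Real.exp (-((1 / 2 + Δ / 2) * g + Δ / 4 * (L : ℝ) ^ s)) :=
          mul_le_mul_of_nonneg_right hbound (Real.exp_nonneg _)
      _ = _ := by rw [← Real.exp_add]; congr 1; ring
  · have hB0 : 0 < 1 / thr N := one_div_pos.2 (Real.exp_pos _)
    by_cases hq : q ∈ Set.range f
    · obtain ⟨q₀, rfl⟩ := hq
      rw [Finset.sum_eq_single q₀ (fun b _ hb => by
        rw [if_neg fun he => hb (subboxIncl_injective hsub he), mul_zero])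
        (fun hb => absurd (Finset.mem_univ _) hb), if_pos rfl, mul_one]
      have h1 := (norm_entry_le_specNorm G x₀ q₀).trans hinvc.2
      have h2 := one_div_le_one_div_of_le (Real.exp_pos _) (thr_anti hL1 hLN1)
      have h3 := len_sub_le_of_mem_box hx q₀.1.2
      have h4 := len_nonneg (x.1.1 - q₀.1.1)
      have h5 := gauge_le_rpow (ℓ := A₀ * L) hs1 h4
      have h6 := Real.rpow_le_rpow h4 h3 hs0.le
      have h7 := gauge_nonneg (s := s) (ℓ := A₀ * L) h4
      rw [mul_assoc, ← Real.exp_add]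
      refine (h1.trans h2).trans (le_mul_of_one_le_right hB0.le (Real.one_le_exp ?_))
      have h8 : (1 / 2 + Δ / 2) * gauge s (A₀ * L) (len (x.1.1 - q₀.1.1)) ≤
          gauge s (A₀ * L) (len (x.1.1 - q₀.1.1)) := mul_le_of_le_one_left h7 (by linarith)
      have h9 : (f q₀).1.1 = q₀.1.1 := rfl
      rw [h9]
      linarith
    · rw [Finset.sum_eq_zero fun x' _ => by rw [if_neg fun he => hq ⟨x', he⟩, mul_zero]]
      positivity

/-- Localization at very large scales: a site is bad when the translate of its sub-box is close to a
resonance of the central box. The remaining sub-boxes are invertible, hence localized, and the absence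
of difference resonances puts the bad sites of a given eigenvalue close to each other. -/
theorem localization_of_subboxes {X Y lam γ A₀ s₀ θ : ℝ} {Ω : Set (Vec n)}
    {zhat : Vec n → Lattice n → Vec n}
    (hY : LargeScale n lam Δ γ A₀ Y) (hn : 1 ≤ n)
    (hlam : 0 < lam) (hΔ : 0 < Δ) (hΔ1 : Δ ≤ 1 / 2) (hγ : 0 < γ) (hA : 0 < A₀) (hX : 1 ≤ X)
    (hXY : X ^ 12 ≤ Y) (hs0 : 0 < s) (hss : s ≤ s₀) (hs₀ : s₀ < 1)
    (hs : lam ≤ s * X) (hθ : 0 < θ) (hθ1 : θ ≤ 1) (hθs : θ ^ (1 - s₀) ≤ 1 / 2)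
    (hAθ : 8 * n ≤ Δ * θ * A₀)
    (hN : (N : ℝ) = Real.exp Y) (hε : 0 ≤ ε) (hε1 : ε ≤ 1) (hK : 0 ≤ K) (hKX : K ≤ Real.exp (X ^ 2))
    (hk₀ : OffSide k₀ N)
    (hent : ∀ k ∈ box k₀ N, ∀ k' ∈ box k₀ N, ∀ i j,
      ‖tangent h (zhat ω) k i k' j + opB h (zhat ω) k i k' j‖ ≤
        K * Real.exp (-((1 / 2 + Δ) * len (k - k') ^ s)))
    (hhank : ∀ k ∈ box k₀ N, ∀ k' ∈ box k₀ N, ∀ i j,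
      ‖kernelH h (zhat ω) (k + k') i j + opB h (zhat ω) k i k' j‖ ≤
        K * Real.exp (-(γ * (N : ℝ) ^ s)))
    (hω : ω ∈ Ω) (hres : ω ∉ diffResonant h Ω ε zhat) (hNM : bigM ε < N)
    (hloc : ∀ c, OffSide c (subSize Y) → Inversion h ε (zhat ω) ω c (subSize Y) →
      LocalizationTwoSided h ε s (zhat ω) ω c (subSize Y))
    (hinv : Inversion h ε (zhat ω) ω k₀ N) :
    Localization h ε s (zhat ω) ω k₀ N := by
  classical
  have hXY₁ : X ^ ((5 : ℝ) / 4) ≤ Y := by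
    refine le_trans ?_ hXY
    rw [← Real.rpow_natCast]
    exact Real.rpow_le_rpow_of_exponent_le hX (by norm_num)
  have hXY₂ : X ≤ Y := le_trans (le_self_pow₀ hX (by norm_num)) hXY
  have hY0 : 0 ≤ Y := by linarith [hY.one_le]
  have hs1 : s ≤ 1 := by linarith
  have hL1 : (1 : ℝ) ≤ subSize Y := by exact_mod_cast one_le_subSize Y
  have hn' : (1 : ℝ) ≤ n := by exact_mod_cast hn
  have hLN : 2 * n * (subSize Y : ℝ) < N := (hY.two_mul_subSize_le hΔ hA.le).trans_lt
    (hN ▸ Real.exp_lt_exp.2 (by linarith [hY.one_le]))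
  have hLN2 : 2 * subSize Y < N := by
    have : 2 * (subSize Y : ℝ) < N := by nlinarith
    exact_mod_cast this
  have hhb := hY.hankel_bound hn hlam hγ hX hXY₁ hXY₂ hs0 hs hN hK hKX
  have hthr := thr_subSize_le hY0 hN
  set L := subSize Y with hL
  choose c hcsub hkc hcmem hcfar using fun k : box k₀ N => exists_subbox (L := L) (by omega) k.2
  set μ := (centralMatrix_isHermitian h ε (zhat ω) ω L).eigenvalues with hμ
  set ω' := drift h ε (zhat ω) ω with hω'
  refine localization_of_good_sites hY hn hlam hΔ hΔ1 hA hX hXY₁ hXY₂ hs0 hs1 hs hN hε hε1 hK hKX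
    hent hinv (fun x => ∃ i, |μ i - pair (c x.1) ω'| < 2 * thr L) (fun q x hx => ?_)
    (ι := box (0 : Lattice n) L × Fin n) (fun i x => |μ i - pair (c x.1) ω'| < 2 * thr L)
    (fun x hx => hx) ?_ ?_
  · push Not at hx
    have hinvc : Inversion h ε (zhat ω) ω (c x.1) L := by
      refine inversion_of_eigenvalues_far h ε (zhat ω) ω (c x.1) L
        (r := K * Real.exp (-(γ * (N : ℝ) ^ s))) hε (by positivity)
        (fun k hk k' hk' i j => hhank k (hcsub _ hk) k' (hcsub _ hk') i j) (le_trans ?_ hhb) hx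
      have hr0 : 0 ≤ K * Real.exp (-(γ * (N : ℝ) ^ s)) := by positivity
      refine mul_le_mul (pow_le_pow_left₀ (Nat.cast_nonneg _) ?_ 2)
        (mul_le_of_le_one_left hr0 hε1) (mul_nonneg hε hr0) (by positivity)
      rw [card_box]
      exact_mod_cast Nat.mul_le_mul_right n (Nat.pow_le_pow_left (by omega) n)
    refine local_resolvent_of_subbox hY hn hlam hΔ hΔ1 hA hX hXY hs0 hss hs₀ hs hθ hθ1 hθs hAθ hN hε
      hε1 hK hKX hent hinv (hcsub x.1) hinvc (norm_inv_le_of_localizationTwoSided hs0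
        (one_le_subSize Y) hinvc (hloc _ (hk₀.of_mem_box (hcmem _) hLN2) hinvc)
        fun k hk k' hk' => ?_) x (hkc x.1) (hcfar x.1) q
    have h1 := len_sub_le_of_mem_box hk hk'
    have h2 := hk₀.two_mul_le_len_add (hcsub _ hk) (hcsub _ hk')
    have h3 : (0 : ℝ) ≤ N := Nat.cast_nonneg N
    linarith
  · rw [card_box]
  · intro i x y hx hy
    have hclose : |pair (c x.1 - c y.1) ω'| < 4 * thr (reduced N) := by
      have e : pair (c x.1 - c y.1) ω' = (μ i - pair (c y.1) ω') - (μ i - pair (c x.1) ω') := by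
        rw [pair_sub]; ring
      have h1 := abs_sub (μ i - pair (c y.1) ω') (μ i - pair (c x.1) ω')
      rw [e]
      linarith
    have h1 := len_le_of_not_diffResonant hn hω hres hNM (hcmem x.1) (hcmem y.1) hclose
    have h2 := len_sub_center_le (hkc x.1)
    have h3 := len_sub_center_le (hkc y.1)
    rw [← len_neg, neg_sub] at h3
    have h4 := len_sub_le_len_sub_add x.1.1 (c x.1) y.1.1
    have h5 := len_sub_le_len_sub_add (c x.1) (c y.1) y.1.1
    have h6 := mul_le_mul_of_nonneg_left (reduced_le_subSize hN) (show (0 : ℝ) ≤ n by linarith)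
    push_cast
    linarith

end SubBoxes

/-! ### The logarithmic scale -/

theorem bigM_eq {ε X : ℝ} (hX : 0 ≤ X) (hε : ε = Real.exp (-(X ^ 20))) :
    bigM ε = Real.exp X := by
  rw [bigM, hε, one_div, ← Real.exp_neg, neg_neg, Real.log_exp, ← Real.rpow_natCast,
    ← Real.rpow_mul hX, show ((20 : ℕ) : ℝ) * (1 / 20) = 1 by norm_num, Real.rpow_one]

theorem exists_scale {ε X₀ : ℝ} (hX₀ : 0 ≤ X₀) (hε0 : 0 < ε) (hε : ε ≤ Real.exp (-(X₀ ^ 20))) :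
    ∃ X, X₀ ≤ X ∧ ε = Real.exp (-(X ^ 20)) := by
  have h1 : X₀ ^ 20 ≤ -Real.log ε := by
    have := Real.log_le_log hε0 hε
    rw [Real.log_exp] at this
    linarith
  have h0 : 0 ≤ -Real.log ε := (pow_nonneg hX₀ 20).trans h1
  have h2 : ((-Real.log ε) ^ ((1 : ℝ) / 20)) ^ 20 = -Real.log ε := by
    rw [← Real.rpow_natCast, ← Real.rpow_mul h0]; norm_num
  refine ⟨(-Real.log ε) ^ ((1 : ℝ) / 20), ?_, by rw [h2, neg_neg, Real.exp_log hε0]⟩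
  refine le_of_pow_le_pow_left₀ (n := 20) (by norm_num) (Real.rpow_nonneg h0 _) ?_
  rwa [h2]

theorem GevreyDecay.norm_le {n : ℕ} {s : ℝ} {zhat : Vec n → Lattice n → Vec n} {ω : Vec n}
    (h : GevreyDecay s zhat ω) (k : Lattice n) : ‖zhat ω k‖ ≤ Real.exp (-(len k ^ s)) := by
  rw [Real.exp_neg, ← one_div, le_div_iff₀ (Real.exp_pos _)]
  refine le_trans (mul_le_mul_of_nonneg_right ?_ (Real.exp_nonneg _)) (h.decay k)
  exact le_add_of_nonneg_right (norm_nonneg _)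

end DimEnlargedNewton

theorem theorem4p2 (n : ℕ) (hn : 1 ≤ n) (h : Coeffs n)
    (Ω : Set (Vec n)) (hΩ_open : IsOpen Ω) (hΩ_conn : IsConnected Ω)
    (hΩ_bdd : Bornology.IsBounded Ω) (τ : ℝ) (hτ : (n : ℝ) - 1 < τ)
    (s₀ : ℝ) (hs₀_pos : 0 < s₀) (hs₀_lt : s₀ < 1) (hs₀_dim : ((n : ℝ) - 1) ^ s₀ < 2)
    (c : ℝ) (hc : 1 < c) :
    ∃ ε₀ : ℝ, 0 < ε₀ ∧ ε₀ ≤ 1 / 2 ∧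
      ∀ ε : ℝ, 0 < ε → ε ≤ ε₀ →
      ∀ s : ℝ, 0 < s → s ≤ s₀ → c ≤ bigM ε ^ s →
      ∀ (zhat : Vec n → Lattice n → Vec n) (ω : Vec n),
        GevreyDecay s zhat ω →
        (∀ j, zhat ω (basisVec j) j = amplitude) →
        ω ∈ Ω \ (nearlyResonant Ω τ ε ∪ diffResonant h Ω ε zhat) →
      ∀ r : ℕ,
        (∀ N : ℕ, smallM ε ≤ (N : ℝ) → (N : ℝ) ≤ bigM ε ^ r →
          ∀ k₀ : Lattice n, OffSide k₀ N →
            Inversion h ε (zhat ω) ω k₀ N → LocalizationTwoSided h ε s (zhat ω) ω k₀ N) →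
        ∀ N : ℕ, bigM ε ^ r < (N : ℝ) → (N : ℝ) ≤ bigM ε ^ (r + 1) →
          ∀ k₀ : Lattice n, OffSide k₀ N →
            Inversion h ε (zhat ω) ω k₀ N → Localization h ε s (zhat ω) ω k₀ N := by
  classical
  obtain ⟨C, d, hC, hCd⟩ := exists_entry_bound h
  have hn' : (1 : ℝ) ≤ n := by exact_mod_cast hn
  set ρ : ℝ := max 1 (((n : ℝ) - 1) ^ s₀) with hρ
  have hρ1 : 1 ≤ ρ := le_max_left _ _
  have hρ2 : ρ < 2 := max_lt one_lt_two hs₀_dim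
  -- `γ < 1` is chosen such that the rate `γ / ρ` left by the Hankel part still exceeds `1 / 2`.
  set γ : ℝ := (1 + ρ / 2) / 2 with hγ
  set Δ : ℝ := 1 / (2 * ρ) - 1 / 4 with hΔ
  have hγ0 : 0 < γ := by rw [hγ]; linarith
  have hγ1 : γ < 1 := by rw [hγ]; linarith
  have hγΔ : γ / ρ = 1 / 2 + Δ := by rw [hγ, hΔ]; field_simp; ring
  have hΔ0 : 0 < Δ := by
    rw [hΔ, sub_pos]
    exact one_div_lt_one_div_of_lt (by linarith) (by linarith)
  have hΔ1 : Δ ≤ 1 / 2 := by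
    have : 1 / (2 * ρ) ≤ 1 / 2 := one_div_le_one_div_of_le (by norm_num) (by linarith)
    rw [hΔ]; linarith
  set lam := Real.log c with hlam
  have hlam0 : 0 < lam := Real.log_pos hc
  set θ : ℝ := (1 / 2 : ℝ) ^ (1 / (1 - s₀)) with hθ
  have hs₀' : 0 < 1 - s₀ := by linarith
  have hθ0 : 0 < θ := Real.rpow_pos_of_pos (by norm_num) _
  have hθ1 : θ ≤ 1 := Real.rpow_le_one (by norm_num) (by norm_num) (by positivity)
  have hθs : θ ^ (1 - s₀) ≤ 1 / 2 := by
    rw [hθ, ← Real.rpow_mul (by norm_num), one_div_mul_cancel hs₀'.ne', Real.rpow_one]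
  -- At distances below `θ` times the length `A₀ L` of the gauge, the gauge is at most half of `d^s`, and
  -- `A₀` makes the diameter `2nL` of a sub-box a fraction `Δ / 4` of such a distance.
  set A₀ : ℝ := 8 * n / (Δ * θ) with hA
  have hA0 : 0 < A₀ := by positivity
  have hAθ : 8 * n ≤ Δ * θ * A₀ := by rw [hA]; field_simp; exact le_rfl
  obtain ⟨X₁, hX₁⟩ := Filter.eventually_atTop.1 (eventually_kernelConst_le n C hC d hγ1 hlam0)
  obtain ⟨X₂, hX₂⟩ := Filter.eventually_atTop.1 (eventually_largeScale n A₀ hlam0 hΔ0 hγ0)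
  set X₀ : ℝ := max (max X₁ X₂) (5 * n + 2 ^ 15 + 6) with hX₀
  have hX₀1 : 1 ≤ X₀ := le_trans (by linarith) (le_max_right _ _)
  refine ⟨Real.exp (-(X₀ ^ 20)), Real.exp_pos _, ?_, ?_⟩
  · have h1 : (1 : ℝ) ≤ X₀ ^ 20 := one_le_pow₀ hX₀1
    have h2 := Real.add_one_le_exp (X₀ ^ 20)
    rw [Real.exp_neg, ← one_div]
    exact one_div_le_one_div_of_le two_pos (by linarith)
  intro ε hε hεX s hs hss hMs zhat ω hz _ hω r hscale N hNr hNr' k₀ hk₀ hinv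
  obtain ⟨X, hXX, hεeq⟩ := exists_scale (by linarith) hε hεX
  have hXa : 5 * (n : ℝ) + 2 ^ 15 + 6 ≤ X := (le_max_right _ _).trans hXX
  have hXb : X₁ ≤ X := ((le_max_left _ _).trans (le_max_left _ _)).trans hXX
  have hXc : X₂ ≤ X := ((le_max_right _ _).trans (le_max_left _ _)).trans hXX
  have hX1 : 1 ≤ X := by linarith
  have hM := bigM_eq (by linarith) hεeq
  rw [hM] at hMs
  have hs1 : s ≤ 1 := by linarith
  have hsX : lam ≤ s * X := by
    rw [hlam, Real.log_le_iff_le_exp (by linarith), mul_comm, Real.exp_mul]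
    exact hMs
  have hε1 : ε ≤ 1 := by
    rw [hεeq, Real.exp_le_one_iff]; linarith [show (0 : ℝ) ≤ X ^ 20 by positivity]
  rw [hM, ← Real.exp_nat_mul] at hNr hNr'
  have hN0 : (0 : ℝ) < N := (Real.exp_pos _).trans hNr
  set Y := Real.log N with hY
  have hN : (N : ℝ) = Real.exp Y := (Real.exp_log hN0).symm
  rw [hN, Real.exp_lt_exp] at hNr
  rw [hN, Real.exp_le_exp] at hNr'
  push_cast at hNr'
  have hY0 : 0 ≤ Y := le_trans (by positivity) hNr.le
  have hN1 : 1 ≤ N := by exact_mod_cast hN0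
  set K := C * latticeSum n γ s ^ d with hK
  have hK0 : 0 ≤ K := mul_nonneg hC (pow_nonneg
    (zero_le_one.trans (one_le_latticeSum hγ1 hs hs1)) d)
  have hKX : K ≤ Real.exp (X ^ 2) := hX₁ X hXb s hs hs1 hsX
  have hρs : max 1 ((n : ℝ) - 1) ^ s ≤ ρ := by
    rcases le_total ((n : ℝ) - 1) 1 with h1 | h1
    · rwa [max_eq_left h1, Real.one_rpow]
    · rw [max_eq_right h1]
      exact (Real.rpow_le_rpow_of_exponent_le h1 hss).trans (le_max_right _ _)
  have hent := hCd γ s ρ (zhat ω) hγ0.le hγ1 hs hs1 hρ1 hρs hz.norm_le k₀ N hk₀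
  rw [hγΔ] at hent
  have hent1 := fun k hk k' hk' i j => (hent k hk k' hk' i j).1
  have hent2 := fun k hk k' hk' i j => (hent k hk k' hk' i j).2
  rcases le_or_gt Y (X ^ ((5 : ℝ) / 4)) with hYX | hYX
  · refine localization_of_perturbative hn hε.le hs hs1 hΔ0.le hK0 hN1 hent1 hinv
      (le_trans ?_ (perturbative_bound hn hN hY0 (by linarith) hYX))
    rw [hεeq]
    gcongr
  have hXY : X < Y := by
    refine lt_of_le_of_lt ?_ hYX
    calc X = X ^ (1 : ℝ) := (Real.rpow_one X).symm
      _ ≤ _ := Real.rpow_le_rpow_of_exponent_le hX1 (by norm_num)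
  have hLS := hX₂ Y (by linarith)
  have hω' : ω ∉ diffResonant h Ω ε zhat := fun hmem => hω.2 (Or.inr hmem)
  have hNM : bigM ε < N := by rw [hM, hN]; exact Real.exp_lt_exp.2 hXY
  rcases le_or_gt Y (X ^ 12) with hYX' | hYX'
  · refine localization_of_small_diagonal hLS hn hlam0 hΔ0 hΔ1 hA0 hX1 hYX.le hXY.le hs hs1 hsX hN
      hε.le hε1 hK0 hKX hent1 hω.1 hω' hNM (le_trans ?_
        (hLS.intermediate_bound hn hN (by linarith) hYX')) hinv
    rw [hεeq]
    gcongr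
  · refine localization_of_subboxes hLS hn hlam0 hΔ0 hΔ1 hγ0 hA0 hX1 hYX'.le hs hss hs₀_lt hsX hθ0 hθ1
      hθs hAθ hN hε.le hε1 hK0 hKX hk₀ hent1 hent2 hω.1 hω' hNM (hscale (subSize Y) ?_ ?_) hinv
    · refine le_trans ?_ (exp_le_subSize Y)
      rw [smallM, hM, Real.log_exp]
      refine Real.exp_le_exp.2 ?_
      calc X ^ ((1 : ℝ) / 20) ≤ X ^ ((1 : ℝ) / 10) :=
            Real.rpow_le_rpow_of_exponent_le hX1 (by norm_num)
        _ ≤ _ := Real.rpow_le_rpow (by linarith) hXY.le (by norm_num)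
    · -- As `X < Y ≤ (r + 1) X`, the exponent `r` is positive, and so `Y ≤ 2 r X`.
      have hr : (1 : ℝ) ≤ r := by
        have : r ≠ 0 := by
          rintro rfl
          norm_num at hNr'
          linarith
        exact_mod_cast Nat.one_le_iff_ne_zero.2 this
      have h1 := hLS.two_mul_subSize_le hΔ0 hA0.le
      have h2 : (subSize Y : ℝ) ≤ 2 * n * (subSize Y : ℝ) :=
        le_mul_of_one_le_left (Nat.cast_nonneg _) (by linarith)
      rw [hM, ← Real.exp_nat_mul]
      refine (h2.trans h1).trans (Real.exp_le_exp.2 ?_)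
      have h3 : X ≤ r * X := le_mul_of_one_le_left (by linarith) hr
      rw [add_mul, one_mul] at hNr'
      linarith
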